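/- **Setting.** A path in a finite graph is a finite oriented walk $\sigma=(v_0,\dots,v_k)$, $k\ge 0$, with entrance $v_0$ and exit $v_k$ (vertices and edges may be repeated), and $n(\sigma,e)$ is the number of times $\sigma$ uses the edge $e$, in either direction. A path-flow is a finite nonnegative measure $\mu$ on paths. Its transportation measure $\mathrm{tra}(\mu)$ is the push-forward of $\mu$ under $\sigma\mapsto(v_0,v_k)$, and its flow-volume is $f(e)=\int n(\sigma,e)\,\mu(d\sigma)$. An environment $\mathbf c$ assigns a number $c(e)\ge 0$ to every edge, and $\mathrm{cost}(\mathbf f,\mathbf c)=\sum_e c(e)f(e)^2$. Fix $B>\tfrac14$, an integer $M\ge1$, and a probability distribution $\kappa$ on $[0,c^*]$ with $0<c^*<\infty$. *The extended square.* It consists of $[0,M-1]^2$ with its nearest-neighbour edges, together with the set $\mathrm{Bou}_M$ of the $4M$ boundary points $(-\frac12,j)$, $(M-\frac12,j)$, $(i,-\frac12)$, $(i,M-\frac12)$, each joined by a half-edge to the nearest vertex of the square. Let $b\mapsto b^{\mathrm{reflect}}$ be the reflection of $\mathrm{Bou}_M$ exchanging left with right and bottom with top. Let $\mathcal Q_M$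 be the set of finite measures $Q$ on $\mathrm{Bou}_M\times\mathrm{Bou}_M$ such that the push-forward of the second marginal under reflection is the first marginal, and let $\mathrm{drift}(Q)=M^{-2}\sum_{b_1,b_2}(b_2-b_1)Q(b_1,b_2)\in\mathbb R^2$. Call $Q_0$ isotropic if $Q_0=\int Q\,\psi(dQ)$ for a probability distribution $\psi$ on $\mathcal Q_M$ under which $\mathrm{drift}(Q)$ modulo $(1,1)$ is uniform on the continuous torus $\mathcal T^2=\mathbb R^2/\mathbb Z^2$. Let $\mathrm{cost}_{M,B}(Q,\mathbf c)$ be the infimum of $\mathrm{cost}(\mathbf f,\mathbf c)$ over the flow-volumes $\mathbf f$ with $\max_e f(e)\le B$ of path-flows across the square (that is, on paths with at least one edge) with transportation measure $Q$ ($+\infty$ if there are none). Let $$c_{M,B}=\inf\{\mathbb E\,\mathrm{cost}_{M,B}(Q,\mathbf c): Q\text{ isotropic}\},$$ where the $c(e)$ are i.i.d. with law $\kappa$ on internal edges and on the half-edges at the left and bottom sides, and $c(e)=0$ on the half-edges at the right and top sides. *The torus.* For a positive multiple $N$ of $M$, partition the $N\times N$ discrete torus into $(N/M)^2$ squares of size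 $M\times M$ in the natural way. Let $\mathrm{Bou}_{N,M}$ be the set of the $2N^2/M$ midpoints of the edges that link squares; insert these points as vertices, so that each such edge is divided into two halves. For a path-flow on the resulting graph whose flow-volume is the same on the two halves of every divided edge, this common value is its flow-volume $f(e)$ on that edge $e$ of the torus. The cost on the torus is the sum over its $2N^2$ edges. **Proposition 5.** For all positive multiples $N$ of $M$ and all environments $\mathbf c$ on the $N\times N$ torus there are path-flows $\mu_{N,M}(\cdot\mid\mathbf c)$, depending measurably on $\mathbf c$, with flow-volumes $\mathbf f(\cdot\mid\mathbf c)$ on the edges of the torus (equal on the two halves of each divided edge), and there are finite measures $\rho_{N,M}$ on $\mathrm{Bou}_{N,M}\times\mathrm{Bou}_{N,M}$, such that: (i) $\max_e f(e\mid\mathbf c)\le B$ for every environment $\mathbf c$; (ii) if the $c(e)$ are i.i.d. with law $\kappa$, then $\mathbb E\,\mathrm{cost}(\mathbf f(\cdot\mid\mathbf c),\mathbf c)=(N/M)^2\,c_{M,B}$; (iii) $\mathrm{tra}(\mu_{N,M}(\cdot\mid\mathbf c))=\rho_{N,M}$ for every environment $\mathbf c$ (so it does not depend on $\mathbf c$);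 $\rho_{N,M}$ has total mass $N$, is invariant under translation of the torus by $(M,0)$ and by $(0,M)$ (applied to both components), and has equal first and second marginals; (iv) if $\tilde\rho_{N,M}$ is the push-forward of $\rho_{N,M}$ under $(z^1,z^2)\mapsto(\frac1Nz^1,\frac1Nz^2)$ to $\mathcal T^2\times\mathcal T^2$, then, as $N\to\infty$ through the multiples of $M$ with $M$ fixed, $N^{-1}\tilde\rho_{N,M}$ converges weakly to the uniform probability distribution on $\mathcal T^2\times\mathcal T^2$. -/

import Mathlib

open MeasureTheory ProbabilityTheory Filter Topology
open scoped NNReal ENNReal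

namespace DisorderedFlow

/-! ## Finite paths, path-flows, flow-volumes and costs on a graph -/

/-- A graph with vertex type `V` and edge type `E`; parallel edges are allowed, so that the
`N × N` torus makes sense (with its `2 N ^ 2` edges) for every `N`. -/
structure Multigraph (V E : Type) where
  /-- The two endpoints of an edge. -/
  ends : E → Sym2 V

/-- Walks from one vertex to another. -/
inductive Multigraph.Walk {V E : Type} (G : Multigraph V E) : V → V → Type
  | nil (v : V) : Multigraph.Walk G v v
  | cons {u v w : V} (e : E) (h : G.ends e = s(u, v)) (p : Multigraph.Walk G v w) :
      Multigraph.Walk G u w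

/-- The number of edges of a walk. -/
def Multigraph.Walk.length {V E : Type} {G : Multigraph V E} :
    {u v : V} → G.Walk u v → ℕ
  | _, _, .nil _ => 0
  | _, _, .cons _ _ p => p.length + 1

open Classical in
/-- The number of times that the edge `e` occurs, in either direction, in a walk. -/
noncomputable def Multigraph.Walk.count {V E : Type} {G : Multigraph V E} (e : E) :
    {u v : V} → G.Walk u v → ℕ
  | _, _, .nil _ => 0
  | _, _, .cons e' _ p => p.count e + (if e' = e then 1 else 0)

/-- A finite oriented path `σ`, from its entrance `ent` to its exit `exi`. -/
structure FinPath {V E : Type} (G : Multigraph V E) where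
  ent : V
  exi : V
  walk : G.Walk ent exi

/-- The (countable) space of finite paths is discrete. -/
instance {V E : Type} (G : Multigraph V E) : MeasurableSpace (FinPath G) := ⊤

instance {V E : Type} (G : Multigraph V E) : DiscreteMeasurableSpace (FinPath G) :=
  ⟨fun _ => trivial⟩

section General

variable {V E : Type} {G : Multigraph V E}

/-- The transportation measure of a path-flow: the joint law of entrance and exit. -/
noncomputable def tra [MeasurableSpace V] (μ : Measure (FinPath G)) : Measure (V × V) :=
  μ.map (fun σ => (σ.ent, σ.exi))

/-- The flow-volume of a path-flow. -/
noncomputable def flo (μ : Measure (FinPath G)) (e : E) : ℝ≥0∞ :=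
  ∫⁻ σ, (σ.walk.count e : ℝ≥0∞) ∂μ

end General

/-- The cost of the flow-volume `f` in the environment `c`. -/
noncomputable def cost {E : Type} [Fintype E] (f : E → ℝ≥0∞) (c : E → ℝ≥0) : ℝ≥0∞ :=
  ∑ e, (c e : ℝ≥0∞) * f e ^ 2

/-! ## Grids -/

/-- The direction of an edge. -/
inductive Axis
  | horiz
  | vert
  deriving DecidableEq

instance : Fintype Axis := ⟨{.horiz, .vert}, fun a => by cases a <;> simp⟩

instance : MeasurableSpace Axis := ⊤

instance : DiscreteMeasurableSpace Axis := ⟨fun _ => trivial⟩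

/-- The vertices `[0, n - 1]²`. -/
abbrev Grid (n : ℕ) : Type := Fin n × Fin n

/-- The coordinate of a vertex along an axis. -/
def coord {n : ℕ} : Axis → Grid n → Fin n
  | .horiz, v => v.1
  | .vert, v => v.2

/-- Addition of `k` modulo `n`. -/
def rot {n : ℕ} (k : ℕ) (x : Fin n) : Fin n := ⟨(x + k) % n, Nat.mod_lt _ x.pos⟩

/-- Translation by `k`, modulo `n`, along an axis. -/
def shift {n : ℕ} (k : ℕ) : Axis → Grid n → Grid n
  | .horiz, v => (rot k v.1, v.2)
  | .vert, v => (v.1, rot k v.2)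

/-! ## The extended `M × M` square -/

/-- The four sides of a square. -/
inductive Side
  | left
  | right
  | bottom
  | top
  deriving DecidableEq

instance : Fintype Side := ⟨{.left, .right, .bottom, .top}, fun a => by cases a <;> simp⟩

instance : MeasurableSpace Side := ⊤

instance : DiscreteMeasurableSpace Side := ⟨fun _ => trivial⟩

/-- The `4 M` boundary points of the extended `M × M` square. -/
abbrev SqBou (M : ℕ) : Type := Side × Fin M

/-- Coordinates of the boundary points: `(-1/2, j)`, `(M - 1/2, j)`, `(i, -1/2)`,
`(i, M - 1/2)`. -/
noncomputable def SqBou.pos {M : ℕ} : SqBou M → ℝ × ℝ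
  | (.left, j) => (-1 / 2, (j : ℕ))
  | (.right, j) => (M - 1 / 2, (j : ℕ))
  | (.bottom, i) => ((i : ℕ), -1 / 2)
  | (.top, i) => ((i : ℕ), M - 1 / 2)

/-- Reflection of the boundary points, left to right and top to bottom. -/
def SqBou.reflect {M : ℕ} : SqBou M → SqBou M
  | (.left, j) => (.right, j)
  | (.right, j) => (.left, j)
  | (.bottom, i) => (.top, i)
  | (.top, i) => (.bottom, i)

/-- The vertex of the square at the other end of the half-edge of a boundary point. -/
def SqBou.inner {M : ℕ} : SqBou M → Grid M
  | (.left, j) => (⟨0, j.pos⟩, j)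
  | (.right, j) => (⟨M - 1, Nat.sub_lt j.pos Nat.one_pos⟩, j)
  | (.bottom, i) => (i, ⟨0, i.pos⟩)
  | (.top, i) => (i, ⟨M - 1, Nat.sub_lt i.pos Nat.one_pos⟩)

/-- Vertices of the extended square: internal vertices and boundary points. -/
abbrev SqVertex (M : ℕ) : Type := Grid M ⊕ SqBou M

/-- Edges of the extended square: internal edges (from `v` one step along the axis, inside the
square), and one half-edge for each boundary point. -/
abbrev SqEdge (M : ℕ) : Type :=
  {e : Axis × Grid M // (coord e.1 e.2 : ℕ) + 1 < M} ⊕ SqBou M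

/-- The extended `M × M` square. -/
def sqGraph (M : ℕ) : Multigraph (SqVertex M) (SqEdge M) where
  ends
    | .inl e => s(.inl e.1.2, .inl (shift 1 e.1.1 e.1.2))
    | .inr b => s(.inl b.inner, .inr b)

/-- A (finite, nonnegative) measure on `Bou_M × Bou_M`, given by its point masses. -/
abbrev SqTrans (M : ℕ) : Type := SqBou M × SqBou M → ℝ≥0

section Square

variable {M : ℕ}

/-- `Q` as a measure on pairs of vertices of the extended square. -/
noncomputable def SqTrans.toMeasure (Q : SqTrans M) : Measure (SqVertex M × SqVertex M) :=
  ∑ p : SqBou M × SqBou M,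
    (Q p : ℝ≥0∞) • Measure.dirac ((Sum.inr p.1, Sum.inr p.2) : SqVertex M × SqVertex M)

/-- The entrance marginal. -/
def SqTrans.ent (Q : SqTrans M) (b : SqBou M) : ℝ≥0 := ∑ b', Q (b, b')

/-- The exit marginal. -/
def SqTrans.exi (Q : SqTrans M) (b : SqBou M) : ℝ≥0 := ∑ b', Q (b', b)

/-- The set `𝒬_M` of the `Q` for which the push-forward of the exit marginal under reflection
equals the entrance marginal. -/
def compatible (M : ℕ) : Set (SqTrans M) :=
  {Q | ∀ b, ∑ b' with SqBou.reflect b' = b, Q.exi b' = Q.ent b}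

/-- The drift of `Q`, a point of the plane. -/
noncomputable def SqTrans.drift (Q : SqTrans M) : ℝ × ℝ :=
  ((M : ℝ) ^ 2)⁻¹ • ∑ p : SqBou M × SqBou M, (Q p : ℝ) • (p.2.pos - p.1.pos)

end Square

/-- The continuous torus. -/
abbrev Torus2 : Type := UnitAddCircle × UnitAddCircle

instance : SecondCountableTopology Torus2 := inferInstance

instance : BorelSpace Torus2 := inferInstance

instance : OpensMeasurableSpace (Torus2 × Torus2) := inferInstance

/-- Reduction modulo `(1, 1)`. -/
def mod1 (x : ℝ × ℝ) : Torus2 := (x.1, x.2)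

/-- `Q₀` is isotropic: it is a mixture `∫ Q ψ(dQ)` for a probability distribution `ψ` on `𝒬_M`
under which the drift modulo `(1, 1)` is uniform on the continuous torus. -/
def IsIsotropic {M : ℕ} (Q₀ : SqTrans M) : Prop :=
  ∃ ψ : Measure (SqTrans M), IsProbabilityMeasure ψ ∧ (∀ᵐ Q ∂ψ, Q ∈ compatible M) ∧
    (∀ p, ∫⁻ Q, (Q p : ℝ≥0∞) ∂ψ = Q₀ p) ∧
    ψ.map (fun Q => mod1 Q.drift) = (volume : Measure Torus2)

/-- `μ` is a flow across the square (so each path has at least one edge), with transportation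
measure `Q` and with flow-volume at most `B` on every edge. -/
structure IsAdmissible {M : ℕ} (B : ℝ≥0) (Q : SqTrans M) (μ : Measure (FinPath (sqGraph M))) :
    Prop where
  finite : IsFiniteMeasure μ
  nontrivial : ∀ᵐ σ ∂μ, 0 < σ.walk.length
  tra_eq : tra μ = Q.toMeasure
  flo_le : ∀ e, flo μ e ≤ B

/-- The minimal cost `cost_{M,B}(Q, c)`; it is `∞` when no flow is admissible. -/
noncomputable def minCost {M : ℕ} (B : ℝ≥0) (Q : SqTrans M) (c : SqEdge M → ℝ≥0) : ℝ≥0∞ :=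
  ⨅ (μ : Measure (FinPath (sqGraph M))) (_ : IsAdmissible B Q μ), cost (flo μ) c

/-- The law of a single cost-factor of the square: `κ` on internal edges and on the half-edges of
the left and bottom sides, and the unit mass at `0` on those of the right and top sides. -/
noncomputable def sqEdgeLaw {M : ℕ} (κ : Measure ℝ≥0) : SqEdge M → Measure ℝ≥0
  | .inl _ => κ
  | .inr (.left, _) => κ
  | .inr (.bottom, _) => κ
  | .inr (.right, _) => Measure.dirac 0
  | .inr (.top, _) => Measure.dirac 0

/-- The law of the random environment (independent cost-factors) on the extended square. -/
noncomputable def sqEnvLaw (M : ℕ) (κ : Measure ℝ≥0) : Measure (SqEdge M → ℝ≥0) :=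
  Measure.pi (sqEdgeLaw κ)

/-- The constant `c_{M,B}`. -/
noncomputable def cConst (M : ℕ) (B : ℝ≥0) (κ : Measure ℝ≥0) : ℝ≥0∞ :=
  ⨅ (Q : SqTrans M) (_ : IsIsotropic Q), ∫⁻ c, minCost B Q c ∂(sqEnvLaw M κ)

/-! ## The `N × N` torus, partitioned into `M × M` squares -/

/-- The `2 N ^ 2` edges of the `N × N` torus; `(a, v)` joins `v` and `shift 1 a v`. -/
abbrev TorusEdge (N : ℕ) : Type := Axis × Grid N

/-- The edge links two different squares `[iM, (i+1)M - 1] × [jM, (j+1)M - 1]` of the partition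
(for `M = N`, it leaves the only square and comes back to it). -/
def IsCut (M : ℕ) {N : ℕ} (e : TorusEdge N) : Prop := M ∣ (coord e.1 e.2 : ℕ) + 1

/-- The boundary points `Bou_{N,M}`, which are the midpoints of the edges linking squares. -/
abbrev TorusBou (N M : ℕ) : Type := {e : TorusEdge N // IsCut M e}

/-- Vertices of the torus with the boundary points inserted. -/
abbrev SplitVertex (N M : ℕ) : Type := Grid N ⊕ TorusBou N M

/-- Edges of the torus with the boundary points inserted: the edges inside squares, and two
half-edges for each edge linking squares. -/
abbrev SplitEdge (N M : ℕ) : Type := {e : TorusEdge N // ¬ IsCut M e} ⊕ (TorusBou N M × Bool)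

/-- The `N × N` torus with the boundary points inserted. -/
def splitGraph (N M : ℕ) : Multigraph (SplitVertex N M) (SplitEdge N M) where
  ends
    | .inl e => s(.inl e.1.2, .inl (shift 1 e.1.1 e.1.2))
    | .inr (b, false) => s(.inl b.1.2, .inr b)
    | .inr (b, true) => s(.inr b, .inl (shift 1 b.1.1 b.1.2))

/-- The edge of the torus that an edge or half-edge is part of. -/
def SplitEdge.parent {N M : ℕ} : SplitEdge N M → TorusEdge N
  | .inl e => e.1
  | .inr (b, _) => b.1

/-- `f` is the flow-volume on the edges of the torus of the path-flow `μ`: it is the flow-volume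
on each edge inside a square and on both halves of each edge linking squares. -/
def IsTorusFlow {N M : ℕ} (μ : Measure (FinPath (splitGraph N M))) (f : TorusEdge N → ℝ≥0∞) :
    Prop :=
  ∀ s : SplitEdge N M, flo μ s = f s.parent

/-- The law of the i.i.d. environment on the torus. -/
noncomputable def torusEnvLaw (N : ℕ) (κ : Measure ℝ≥0) : Measure (TorusEdge N → ℝ≥0) :=
  Measure.pi fun _ => κ

/-- The boundary points, rescaled by `1 / N`, in the continuous torus. -/
noncomputable def TorusBou.scaled {N M : ℕ} (b : TorusBou N M) : Torus2 :=
  match b.1 with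
  | (.horiz, v) => mod1 ((((v.1 : ℕ) : ℝ) + 1 / 2) / N, ((v.2 : ℕ) : ℝ) / N)
  | (.vert, v) => mod1 (((v.1 : ℕ) : ℝ) / N, (((v.2 : ℕ) : ℝ) + 1 / 2) / N)

theorem coord_shift {n : ℕ} (k : ℕ) (a a' : Axis) (v : Grid n) :
    coord a (shift k a' v) = if a = a' then rot k (coord a v) else coord a v := by
  cases a <;> cases a' <;> rfl

theorem isCut_shift {N M : ℕ} (h : M ∣ N) (a : Axis) (e : TorusEdge N) (he : IsCut M e) :
    IsCut M (e.1, shift M a e.2) := by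
  unfold IsCut at he ⊢
  rw [coord_shift]
  split_ifs
  · have h1 : M ∣ ((coord e.1 e.2 : ℕ) + M) + 1 := by
      have := Nat.dvd_add he (dvd_refl M)
      rwa [add_right_comm] at this
    have h2 : ((coord e.1 e.2 : ℕ) + M) + 1 =
        N * (((coord e.1 e.2 : ℕ) + M) / N) + (((coord e.1 e.2 : ℕ) + M) % N + 1) := by
      rw [← add_assoc, Nat.div_add_mod]
    rw [h2] at h1
    exact (Nat.dvd_add_right (h.mul_right _)).1 h1
  · exact he

/-- Translation of the boundary points by `(M, 0)` (for `.horiz`) or `(0, M)` (for `.vert`). -/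
def TorusBou.translate {N M : ℕ} (h : M ∣ N) (a : Axis) (b : TorusBou N M) : TorusBou N M :=
  ⟨(b.1.1, shift M a b.1.2), isCut_shift h a b.1 b.2⟩

/-- Total mass `N`, invariance under translation by `(M, 0)` and by `(0, M)`, and equality of
the two marginals. -/
structure IsBalanced {N M : ℕ} (h : M ∣ N) (θ : FiniteMeasure (TorusBou N M × TorusBou N M)) :
    Prop where
  mass_eq : θ.mass = N
  translate_eq : ∀ a : Axis,
    θ.map (Prod.map (TorusBou.translate h a) (TorusBou.translate h a)) = θ
  marginal_eq : θ.map Prod.fst = θ.map Prod.snd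

/-- A measure on pairs of boundary points, as a measure on pairs of vertices. -/
noncomputable def asVertexMeasure {N M : ℕ} (θ : FiniteMeasure (TorusBou N M × TorusBou N M)) :
    Measure (SplitVertex N M × SplitVertex N M) :=
  (θ : Measure (TorusBou N M × TorusBou N M)).map (Prod.map Sum.inr Sum.inr)

/-- The uniform probability distribution on `𝒯² × 𝒯²`. -/
noncomputable def uniformPair : FiniteMeasure (Torus2 × Torus2) := ⟨volume, inferInstance⟩

end DisorderedFlow

open DisorderedFlow

/-! Write N = mM. A path on the torus is a chain of crossings of squares: an exit at `b` is an
entrance at `b.reflect` of the neighbouring square, so a path is coded by a word, that is, an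
initial state and a list of exits. Compatibility of a transport Q is flow conservation for the
transitions (entrance, exit). An Euler-trail argument therefore gives a closed word that uses each
transition p at least (m/M) Q(p) and at most (m/M) Q(p) + C times, with C depending only on M
(`exists_rounded_word`, `exists_measurable_word`).

Let ψ witness the isotropy of a nearly optimal Q₀. Draw Q from ψ and start its word in every square
with mass M/m. Then each square sees the transition p with mean volume Q₀(p) + O(1/m)
(`le_wordTrans_map`). The word moves by about m · drift(Q) squares; since the starting square is
uniform and the drift is uniform modulo (1,1), the rescaled pair of ends is nearly uniform
(`near_endsMeasure`).

The words ignore the environment, so the transportation measure is deterministic. The environment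
only selects, in each square separately, the random crossings that realize the transitions
(`sum_wordFlow`, `exists_torus_flow`). Crossings are pruned so as to meet boundary points only at
their ends (`exists_prune`); the volume on a half-edge then depends on the transport alone, and
balance makes the two halves of a divided edge agree (`crossingFlow_reflect`). Each divided edge is
charged in one square only, so the expected cost is m² times that of one square.

Three adjustments remain. Room below B for the O(1/m) errors comes from mixing in straight flows,
whose volume is at most 1/4 < B (`exists_nearly_optimal_crossings`). The exact cost comes from
laziness: rounding was upwards, so the flow dominates an isotropic one and costs at least `cConst`;
letting a path stay at its start with probability t multiplies the cost by (1 - t)², and t is solved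
for (`exists_exactFlow`). That t is small needs `cConst` to be positive, and if it vanishes then so
do all costs (`cConst_ne_zero`). Finally, straight flows serve the small N, and a tolerance that
decreases with N gives the limit (`exists_exactFlow_tendsto`). -/

namespace DisorderedFlow

/-! ## Operations on walks and their realization by random walks -/

section Walks

variable {V E V' E' : Type} {G : Multigraph V E} {H : Multigraph V' E'}

namespace Multigraph.Walk

/-- Concatenation of walks. -/
def append : {u v w : V} → G.Walk u v → G.Walk v w → G.Walk u w
  | _, _, _, .nil _, q => q
  | _, _, _, .cons e h p, q => .cons e h (p.append q)

@[simp]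
theorem count_append {u v w : V} (p : G.Walk u v) (q : G.Walk v w) (e : E) :
    (p.append q).count e = p.count e + q.count e := by
  induction p with
  | nil => simp [append, count]
  | cons e' h p ih => simp [append, count, ih]; ring

/-- The walk along a single edge. -/
def single {u v : V} (e : E) (h : G.ends e = s(u, v)) : G.Walk u v := .cons e h (.nil v)

open Classical in
theorem count_single {u v : V} (e : E) (h : G.ends e = s(u, v)) (e' : E) :
    (single e h).count e' = if e = e' then 1 else 0 := by
  simp [single, count]

/-- The reversed walk. -/
def reverse : {u v : V} → G.Walk u v → G.Walk v u
  | _, _, .nil v => .nil v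
  | _, _, .cons e h p => p.reverse.append (single e (h.trans Sym2.eq_swap))

@[simp]
theorem count_reverse {u v : V} (p : G.Walk u v) (e : E) : p.reverse.count e = p.count e := by
  induction p with
  | nil => simp [reverse, count]
  | cons e' h p ih => simp [reverse, count, ih, count_single]

/-- The image of a walk under a graph homomorphism. -/
def map (φ : V → V') (χ : E → E')
    (hφ : ∀ e u v, G.ends e = s(u, v) → H.ends (χ e) = s(φ u, φ v)) :
    {u v : V} → G.Walk u v → H.Walk (φ u) (φ v)
  | _, _, .nil v => .nil (φ v)
  | _, _, .cons e h p => .cons (χ e) (hφ _ _ _ h) (p.map φ χ hφ)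

theorem count_map {φ : V → V'} {χ : E → E'}
    (hφ : ∀ e u v, G.ends e = s(u, v) → H.ends (χ e) = s(φ u, φ v))
    (hχ : Function.Injective χ) {u v : V} (p : G.Walk u v) (e : E) :
    (p.map φ χ hφ).count (χ e) = p.count e := by
  induction p with
  | nil => simp [map, count]
  | cons e' h p ih =>
    simp only [map, count, ih, add_right_inj]
    by_cases he : e' = e
    · simp [he]
    · simp [he, hχ.ne he]

theorem count_map_of_notMem {φ : V → V'} {χ : E → E'}
    (hφ : ∀ e u v, G.ends e = s(u, v) → H.ends (χ e) = s(φ u, φ v))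
    {e : E'} (he : e ∉ Set.range χ) {u v : V} (p : G.Walk u v) :
    (p.map φ χ hφ).count e = 0 := by
  induction p with
  | nil => simp [map, count]
  | cons e' h p ih =>
    have : χ e' ≠ e := fun h => he ⟨e', h⟩
    simp [map, count, ih, this]

theorem count_eq_zero_of_length_eq_zero {u v : V} (p : G.Walk u v) (hp : p.length = 0) (e : E) :
    p.count e = 0 := by
  cases p with
  | nil => rfl
  | cons => simp [length] at hp

/-- Walks with fixed ends form a discrete measurable space. -/
instance instMeasurableSpace (u v : V) : MeasurableSpace (G.Walk u v) := ⊤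

instance instDiscreteMeasurableSpace (u v : V) : DiscreteMeasurableSpace (G.Walk u v) :=
  ⟨fun _ => trivial⟩

end Multigraph.Walk

/-- A random walk from `u` to `v` uses each edge `e` on average `g e` times. -/
def Realizes (G : Multigraph V E) (u v : V) (g : E → ℝ≥0∞) : Prop :=
  ∃ P : Measure (G.Walk u v), IsProbabilityMeasure P ∧
    ∀ e, ∫⁻ p, (p.count e : ℝ≥0∞) ∂P = g e

theorem Realizes.nil (u : V) : Realizes G u u 0 :=
  ⟨Measure.dirac (.nil u), inferInstance, fun e => by
    rw [lintegral_dirac]; simp [Multigraph.Walk.count]⟩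

/-- Concatenate two independent random walks; counts add. -/
theorem Realizes.append {u v w : V} {g h : E → ℝ≥0∞} (hg : Realizes G u v g)
    (hh : Realizes G v w h) : Realizes G u w (g + h) := by
  obtain ⟨P, hP, hPg⟩ := hg
  obtain ⟨R, hR, hRh⟩ := hh
  have hm : ∀ p : G.Walk u v, Measurable (fun q : G.Walk v w => p.append q) :=
    fun p => Measurable.of_discrete
  have hk : AEMeasurable (fun p : G.Walk u v => R.map fun q => p.append q) P :=
    Measurable.of_discrete.aemeasurable
  refine ⟨P.bind fun p => R.map fun q => p.append q, ⟨?_⟩, fun e => ?_⟩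
  · rw [Measure.bind_apply .univ hk]
    have : ∀ p : G.Walk u v, (R.map fun q => p.append q) Set.univ = 1 := fun p => by
      rw [Measure.map_apply (hm p) .univ]; simp
    simp [this]
  · rw [Measure.lintegral_bind hk Measurable.of_discrete.aemeasurable]
    have : ∀ p : G.Walk u v, ∫⁻ q, (q.count e : ℝ≥0∞) ∂(R.map fun q => p.append q) =
        p.count e + h e := fun p => by
      rw [lintegral_map Measurable.of_discrete (hm p)]
      simp only [Multigraph.Walk.count_append, Nat.cast_add]
      rw [lintegral_add_left measurable_const, hRh]
      simp
    simp only [this]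
    rw [lintegral_add_right _ measurable_const, hPg]
    simp

/-- Injectivity is demanded on edges only: on a torus that consists of a single square, opposite
boundary points are identified while their half-edges stay distinct. -/
theorem Realizes.map {φ : V → V'} {χ : E → E'}
    (hφ : ∀ e u v, G.ends e = s(u, v) → H.ends (χ e) = s(φ u, φ v))
    (hχ : Function.Injective χ) {u v : V} {g : E → ℝ≥0∞} {g' : E' → ℝ≥0∞}
    (hg : Realizes G u v g) (hg' : ∀ e, g' (χ e) = g e)
    (hg0 : ∀ e, e ∉ Set.range χ → g' e = 0) : Realizes H (φ u) (φ v) g' := by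
  obtain ⟨P, hP, hPg⟩ := hg
  have hm : Measurable (fun p : G.Walk u v => p.map φ χ hφ) := Measurable.of_discrete
  refine ⟨P.map fun p => p.map φ χ hφ, Measure.isProbabilityMeasure_map hm.aemeasurable,
    fun e => ?_⟩
  rw [lintegral_map Measurable.of_discrete hm]
  by_cases he : e ∈ Set.range χ
  · obtain ⟨e, rfl⟩ := he
    simp only [Multigraph.Walk.count_map hφ hχ, hPg, hg']
  · simp [Multigraph.Walk.count_map_of_notMem hφ he, hg0 e he]

end Walks

/-! ## Crossings of the extended square -/

section Crossings

variable {M : ℕ}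

@[simp]
theorem SqBou.reflect_reflect (b : SqBou M) : b.reflect.reflect = b := by
  rcases b with ⟨_ | _ | _ | _, j⟩ <;> rfl

theorem SqBou.reflect_involutive : Function.Involutive (SqBou.reflect (M := M)) :=
  SqBou.reflect_reflect

theorem SqBou.reflect_eq_iff {b b' : SqBou M} : b'.reflect = b ↔ b' = b.reflect :=
  SqBou.reflect_involutive.eq_iff

open Classical in
/-- Any walk that ends at a boundary point can be shortened so as to avoid all other boundary
points. -/
theorem exists_prune_of_inl {u w : SqVertex M} (p : (sqGraph M).Walk u w) (b₂ : SqBou M)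
    (hw : w = .inr b₂) (v : Grid M) :
    (u = .inl v → ∃ q : (sqGraph M).Walk (.inl v) (.inr b₂), (∀ e, q.count e ≤ p.count e) ∧
      ∀ b, q.count (.inr b) = if b₂ = b then 1 else 0) ∧
    (∀ b, u = .inr b → b.inner = v → b = b₂ ∨
      ∃ q : (sqGraph M).Walk (.inl v) (.inr b₂), (∀ e, q.count e ≤ p.count e) ∧
        ∀ b, q.count (.inr b) = if b₂ = b then 1 else 0) := by
  -- A boundary point `b` has the single neighbour `b.inner`, so a visit that is not final goes out
  -- and back along the same half-edge, and both steps can be dropped. The second clause of the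
  -- induction treats a walk that currently stands at a boundary point.
  induction p generalizing v with
  | nil u =>
    subst hw
    exact ⟨fun h => by simp at h, fun b h _ => .inl (by simpa using h.symm)⟩
  | @cons u u' w e h p ih =>
    specialize ih hw
    constructor
    · rintro rfl
      rcases e with e | b
      · obtain ⟨v', rfl⟩ : ∃ v', u' = .inl v' := by
          have : u' ∈ (sqGraph M).ends (.inl e) := by rw [h]; exact Sym2.mem_mk_right _ _
          simp only [sqGraph, Sym2.mem_iff] at this
          rcases this with h | h <;> exact ⟨_, h⟩
        obtain ⟨q, hq, hq'⟩ := (ih v').1 rfl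
        refine ⟨.cons _ h q, fun e => ?_, fun b => ?_⟩
        · simp only [Multigraph.Walk.count]
          gcongr
          exact hq e
        · simp [Multigraph.Walk.count, hq']
      · obtain ⟨h1, h2⟩ : b.inner = v ∧ u' = .inr b := by
          simp only [sqGraph, Sym2.eq_iff] at h
          rcases h with ⟨h1, h2⟩ | ⟨h1, h2⟩
          · exact ⟨by simpa using h1, h2.symm⟩
          · simp at h2
        subst h2
        -- Either the walk has reached its final point and the half-edge is kept, or the excursion
        -- to `b` is cut out.
        rcases (ih v).2 b rfl h1 with rfl | ⟨q, hq, hq'⟩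
        · refine ⟨.cons (.inr b) h (.nil (Sum.inr b)), fun e => ?_, fun b' => ?_⟩
          · simp [Multigraph.Walk.count]
          · simp [Multigraph.Walk.count]
        · refine ⟨q, fun e => (hq e).trans ?_, hq'⟩
          simp [Multigraph.Walk.count]
    · rintro b rfl rfl
      right
      rcases e with e | b'
      · exfalso
        simp [sqGraph] at h
      · have h1 : u' = .inl b.inner := by
          simp only [sqGraph, Sym2.eq_iff] at h
          rcases h with ⟨h1, h2⟩ | ⟨h1, h2⟩
          · simp at h1
          · have : b' = b := by simpa using h2
            rw [← h1, this]
        obtain ⟨q, hq, hq'⟩ := (ih _).1 h1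
        exact ⟨q, fun e => (hq e).trans (by simp [Multigraph.Walk.count]), hq'⟩

open Classical in
/-- The number of uses of a half-edge by a walk that only meets the boundary points at its
ends. -/
noncomputable def SqBou.endCount (b₁ b₂ b : SqBou M) : ℕ :=
  (if b₁ = b then 1 else 0) + (if b₂ = b then 1 else 0)

/-- The first edge is necessarily the half-edge of `b₁`; the remainder is pruned. Positive length
matters when `b₁ = b₂`: the empty walk would not use the half-edge, whereas `endCount` is then 2. -/
theorem exists_prune {b₁ b₂ : SqBou M} (p : (sqGraph M).Walk (.inr b₁) (.inr b₂))
    (hp : 0 < p.length) :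
    ∃ q : (sqGraph M).Walk (.inr b₁) (.inr b₂), (∀ e, q.count e ≤ p.count e) ∧
      0 < q.length ∧ ∀ b, q.count (.inr b) = SqBou.endCount b₁ b₂ b := by
  classical
  obtain ⟨u', e, h, p', hpe⟩ : ∃ (u' : SqVertex M) (e : SqEdge M)
      (h : (sqGraph M).ends e = s(.inr b₁, u')) (p' : (sqGraph M).Walk u' (.inr b₂)),
      p = .cons e h p' := by
    cases p with
    | nil => simp [Multigraph.Walk.length] at hp
    | cons e h p' => exact ⟨_, e, h, p', rfl⟩
  subst hpe
  rcases e with e | b'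
  · exfalso
    simp [sqGraph] at h
  · obtain ⟨h1, h2⟩ : u' = .inl b₁.inner ∧ b' = b₁ := by
      simp only [sqGraph, Sym2.eq_iff] at h
      rcases h with ⟨h1, h2⟩ | ⟨h1, h2⟩
      · simp at h1
      · have : b' = b₁ := by simpa using h2
        exact ⟨by rw [← h1, this], this⟩
    subst h1 h2
    obtain ⟨q, hq, hq'⟩ := (exists_prune_of_inl p' b₂ rfl _).1 rfl
    refine ⟨.cons _ h q, fun e => ?_, ?_, fun b => ?_⟩
    · simp only [Multigraph.Walk.count]
      gcongr
      exact hq e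
    · simp [Multigraph.Walk.length]
    · simp only [Multigraph.Walk.count, hq', SqBou.endCount, Sum.inr.injEq]
      ring

/-- A random walk across the square from `b₁` to `b₂`, that meets the boundary points only at its
ends, uses each edge `e` on average `g e` times. -/
def Crosses (b₁ b₂ : SqBou M) (g : SqEdge M → ℝ≥0∞) : Prop :=
  ∃ P : Measure ((sqGraph M).Walk (.inr b₁) (.inr b₂)), IsProbabilityMeasure P ∧
    (∀ᵐ p ∂P, 0 < p.length ∧ ∀ b, p.count (.inr b) = SqBou.endCount b₁ b₂ b) ∧
    ∀ e, ∫⁻ p, (p.count e : ℝ≥0∞) ∂P = g e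

theorem Crosses.realizes {b₁ b₂ : SqBou M} {g : SqEdge M → ℝ≥0∞} (h : Crosses b₁ b₂ g) :
    Realizes (sqGraph M) (.inr b₁) (.inr b₂) g :=
  let ⟨P, hP, _, hg⟩ := h
  ⟨P, hP, hg⟩

/-- The use of half-edges is deterministic, so it does not depend on how the square is crossed. -/
theorem Crosses.apply_inr {b₁ b₂ : SqBou M} {g : SqEdge M → ℝ≥0∞} (h : Crosses b₁ b₂ g)
    (b : SqBou M) : g (.inr b) = SqBou.endCount b₁ b₂ b := by
  obtain ⟨P, hP, hp, hg⟩ := h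
  rw [← hg, lintegral_congr_ae (g := fun _ => (SqBou.endCount b₁ b₂ b : ℝ≥0∞))]
  · simp
  · filter_upwards [hp] with p hp
    rw [hp.2]

theorem Crosses.of_walk {b₁ b₂ : SqBou M} (p : (sqGraph M).Walk (.inr b₁) (.inr b₂))
    (hp : 0 < p.length) (hp' : ∀ b, p.count (.inr b) = SqBou.endCount b₁ b₂ b) :
    Crosses b₁ b₂ (fun e => p.count e) :=
  ⟨Measure.dirac p, inferInstance, by rw [ae_dirac_eq]; exact ⟨hp, hp'⟩,
    fun e => by rw [lintegral_dirac]⟩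

/-- The flow across the square with transportation measure `Q` along random crossings. -/
noncomputable def crossingFlow (Q : SqBou M × SqBou M → ℝ≥0∞)
    (g : SqBou M × SqBou M → SqEdge M → ℝ≥0∞) (e : SqEdge M) : ℝ≥0∞ :=
  ∑ p, Q p * g p e

/-- The sum over pairs of ends of `Q p` times the law of the crossing is an admissible flow. -/
theorem minCost_le_cost_crossingFlow {B : ℝ≥0} {Q : SqTrans M}
    {g : SqBou M × SqBou M → SqEdge M → ℝ≥0∞} (hg : ∀ p, Crosses p.1 p.2 (g p))
    (hB : ∀ e, crossingFlow (fun p => Q p) g e ≤ B) (c : SqEdge M → ℝ≥0) :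
    minCost B Q c ≤ cost (crossingFlow (fun p => Q p) g) c := by
  choose P hP hp hPg using hg
  have hm : ∀ p : SqBou M × SqBou M, Measurable
      (fun q : (sqGraph M).Walk (.inr p.1) (.inr p.2) => FinPath.mk _ _ q) :=
    fun p => Measurable.of_discrete
  set μ : Measure (FinPath (sqGraph M)) := ∑ p : SqBou M × SqBou M,
    (Q p : ℝ≥0∞) • (P p).map (fun q => FinPath.mk _ _ q) with hμ
  have hflo : flo μ = crossingFlow (fun p => Q p) g := by
    funext e
    simp only [flo, hμ, crossingFlow]
    rw [lintegral_finsetSum_measure]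
    refine Finset.sum_congr rfl fun p _ => ?_
    rw [lintegral_smul_measure, lintegral_map Measurable.of_discrete (hm p), hPg]
    rfl
  have hadm : IsAdmissible B Q μ := by
    refine ⟨?_, ?_, ?_, fun e => ?_⟩
    · refine ⟨?_⟩
      simp only [hμ, Measure.coe_finsetSum, Finset.sum_apply, Measure.smul_apply, smul_eq_mul]
      refine ENNReal.sum_lt_top.2 fun p _ => ENNReal.mul_lt_top ENNReal.coe_lt_top ?_
      rw [Measure.map_apply (hm p) .univ]
      simp
    · rw [ae_iff]
      simp only [hμ, Measure.coe_finsetSum, Finset.sum_apply, Measure.smul_apply, smul_eq_mul]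
      refine Finset.sum_eq_zero fun p _ => ?_
      rw [Measure.map_apply (hm p) .of_discrete]
      have : P p {q | ¬ 0 < q.length} = 0 := by
        rw [← ae_iff]
        exact (hp p).mono fun q hq => hq.1
      rw [show _ ⁻¹' {a : FinPath (sqGraph M) | ¬ 0 < a.walk.length} = {q | ¬ 0 < q.length} from rfl,
        this, mul_zero]
    · have hf : Measurable (fun σ : FinPath (sqGraph M) => (σ.ent, σ.exi)) :=
        Measurable.of_discrete
      ext S hS
      rw [tra, Measure.map_apply hf hS, SqTrans.toMeasure]
      simp only [hμ, Measure.coe_finsetSum, Finset.sum_apply, Measure.smul_apply, smul_eq_mul]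
      refine Finset.sum_congr rfl fun p _ => ?_
      rw [Measure.map_apply (hm p) .of_discrete, Measure.dirac_apply' _ hS]
      by_cases h : ((Sum.inr p.1, Sum.inr p.2) : SqVertex M × SqVertex M) ∈ S
      · rw [Set.indicator_of_mem h]
        have : (fun q : (sqGraph M).Walk (.inr p.1) (.inr p.2) => FinPath.mk _ _ q) ⁻¹'
          ((fun σ : FinPath (sqGraph M) => (σ.ent, σ.exi)) ⁻¹' S) = Set.univ := by
          ext; simpa using h
        rw [this]
        simp
      · rw [Set.indicator_of_notMem h]
        have : (fun q : (sqGraph M).Walk (.inr p.1) (.inr p.2) => FinPath.mk _ _ q) ⁻¹'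
          ((fun σ : FinPath (sqGraph M) => (σ.ent, σ.exi)) ⁻¹' S) = ∅ := by
          ext; simpa using h
        rw [this]
        simp
    · rw [hflo]
      exact hB e
  rw [← hflo]
  exact iInf₂_le μ hadm

end Crossings

/-! ## Existence of crossings -/

section ExistsCrossings

variable {M : ℕ}

/-- The vertex with coordinate `i` along the axis `a` and coordinate `k` along the other axis. -/
def gridPt : Axis → Fin M → Fin M → Grid M
  | .horiz, i, k => (i, k)
  | .vert, i, k => (k, i)

/-- The coordinate of a vertex along the other axis. -/
def cross : Axis → Grid M → Fin M
  | .horiz, v => v.2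
  | .vert, v => v.1

@[simp] theorem coord_gridPt (a : Axis) (i k : Fin M) : coord a (gridPt a i k) = i := by
  cases a <;> rfl

@[simp] theorem cross_gridPt (a : Axis) (i k : Fin M) : cross a (gridPt a i k) = k := by
  cases a <;> rfl

theorem shift_one_gridPt (a : Axis) (i : ℕ) (hi : i + 1 < M) (k : Fin M) :
    shift 1 a (gridPt a ⟨i, (Nat.lt_succ_self i).trans hi⟩ k) = gridPt a ⟨i + 1, hi⟩ k := by
  cases a <;> simp [shift, gridPt, rot, Nat.mod_eq_of_lt hi]

/-- Walk step by step along the axis. That no edge is used twice is what later keeps the straight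
flows below 1/4. -/
theorem exists_line (a : Axis) (k : Fin M) (i : ℕ) (hi : i < M) :
    ∃ p : (sqGraph M).Walk (.inl (gridPt a ⟨0, k.pos⟩ k)) (.inl (gridPt a ⟨i, hi⟩ k)),
      (∀ e, p.count (.inl e) ≤
        if e.1.1 = a ∧ cross a e.1.2 = k ∧ (coord a e.1.2 : ℕ) < i then 1 else 0) ∧
      ∀ b, p.count (.inr b) = 0 := by
  classical
  induction i with
  | zero => exact ⟨.nil _, fun e => by simp [Multigraph.Walk.count], fun b => rfl⟩
  | succ i ih =>
    obtain ⟨p, hp, hp'⟩ := ih ((Nat.lt_succ_self i).trans hi)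
    let e₀ : SqEdge M := .inl ⟨(a, gridPt a ⟨i, (Nat.lt_succ_self i).trans hi⟩ k), by simpa using hi⟩
    have he₀ : (sqGraph M).ends e₀ = s(.inl (gridPt a ⟨i, (Nat.lt_succ_self i).trans hi⟩ k),
        .inl (gridPt a ⟨i + 1, hi⟩ k)) := by
      simp only [e₀, sqGraph, shift_one_gridPt a i hi k]
    refine ⟨p.append (.single e₀ he₀), fun e => ?_, fun b => ?_⟩
    · rw [Multigraph.Walk.count_append, Multigraph.Walk.count_single]
      by_cases h : e₀ = Sum.inl e
      · rw [if_pos h]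
        have h1 := (Sum.inl.inj h).symm
        have h2 := hp e
        subst h1
        simpa using h2
      · rw [if_neg h, add_zero]
        refine (hp e).trans ?_
        split_ifs with h1 h2
        · exact le_rfl
        · exact absurd ⟨h1.1, h1.2.1, h1.2.2.trans (Nat.lt_succ_self i)⟩ h2
        · exact zero_le_one
        · exact le_rfl
    · rw [Multigraph.Walk.count_append, Multigraph.Walk.count_single, hp', if_neg (by simp [e₀])]

/-- The axis perpendicular to a side. -/
def Side.axis : Side → Axis
  | .left => .horiz
  | .right => .horiz
  | .bottom => .vert
  | .top => .vert

theorem exists_straight_aux (a : Axis) (k : Fin M) (b₁ b₂ : SqBou M)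
    (h₁ : b₁.inner = gridPt a ⟨0, k.pos⟩ k)
    (h₂ : b₂.inner = gridPt a ⟨M - 1, Nat.sub_lt k.pos Nat.one_pos⟩ k) :
    ∃ p : (sqGraph M).Walk (.inr b₁) (.inr b₂),
      0 < p.length ∧ (∀ b, p.count (.inr b) = SqBou.endCount b₁ b₂ b) ∧
      ∀ e, p.count (.inl e) ≤ if e.1.1 = a ∧ cross a e.1.2 = k then 1 else 0 := by
  classical
  obtain ⟨p, hp, hp'⟩ := exists_line a k (M - 1) (Nat.sub_lt k.pos Nat.one_pos)
  have e₁ : (sqGraph M).ends (.inr b₁) = s(.inr b₁, .inl (gridPt a ⟨0, k.pos⟩ k)) := by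
    rw [← h₁]; exact Sym2.eq_swap
  have e₂ : (sqGraph M).ends (.inr b₂) =
      s(.inl (gridPt a ⟨M - 1, Nat.sub_lt k.pos Nat.one_pos⟩ k), .inr b₂) := by
    rw [← h₂]; rfl
  refine ⟨.cons _ e₁ (p.append (.single _ e₂)), by simp [Multigraph.Walk.length],
    fun b => ?_, fun e => ?_⟩
  · simp only [Multigraph.Walk.count, Multigraph.Walk.count_append, hp',
      Multigraph.Walk.count_single, SqBou.endCount, Sum.inr.injEq]
    ring
  · simp only [Multigraph.Walk.count, Multigraph.Walk.count_append,
      Multigraph.Walk.count_single, reduceCtorEq, if_false, add_zero]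
    refine (hp e).trans ?_
    split_ifs with h1 h2
    · exact le_rfl
    · exact absurd ⟨h1.1, h1.2.1⟩ h2
    · exact zero_le_one
    · exact le_rfl

theorem SqBou.endCount_comm (b₁ b₂ b : SqBou M) :
    SqBou.endCount b₁ b₂ b = SqBou.endCount b₂ b₁ b := by
  simp [SqBou.endCount, add_comm]

theorem length_pos_of_count_pos {V E : Type} {G : Multigraph V E} {u v : V} (p : G.Walk u v)
    (e : E) (h : 0 < p.count e) : 0 < p.length := by
  by_contra h0
  have := p.count_eq_zero_of_length_eq_zero (by omega) e
  omega

theorem SqBou.endCount_self_pos (b₁ b₂ : SqBou M) : 0 < SqBou.endCount b₁ b₂ b₁ := by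
  simp [SqBou.endCount]

/-- A boundary point is joined to the opposite one by a straight walk. -/
theorem exists_straight (b : SqBou M) :
    ∃ p : (sqGraph M).Walk (.inr b) (.inr b.reflect),
      0 < p.length ∧ (∀ b', p.count (.inr b') = SqBou.endCount b b.reflect b') ∧
      ∀ e, p.count (.inl e) ≤
        if e.1.1 = b.1.axis ∧ cross e.1.1 e.1.2 = b.2 then 1 else 0 := by
  classical
  have key : ∀ (a : Axis) (k : Fin M) (e : {e : Axis × Grid M // (coord e.1 e.2 : ℕ) + 1 < M}),
      (if e.1.1 = a ∧ cross a e.1.2 = k then 1 else 0) =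
        if e.1.1 = a ∧ cross e.1.1 e.1.2 = k then 1 else 0 := by
    intro a k e
    by_cases h : e.1.1 = a
    · subst h; rfl
    · simp [h]
  rcases b with ⟨_ | _ | _ | _, k⟩
  · obtain ⟨p, hp, hp', hp''⟩ := exists_straight_aux .horiz k (.left, k) (.right, k) rfl rfl
    exact ⟨p, hp, hp', fun e => (hp'' e).trans (key _ _ e).le⟩
  · obtain ⟨p, hp, hp', hp''⟩ := exists_straight_aux .horiz k (.left, k) (.right, k) rfl rfl
    have h1 : ∀ b', p.reverse.count (.inr b') = SqBou.endCount (.right, k) (.left, k) b' :=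
      fun b' => by rw [Multigraph.Walk.count_reverse, hp', SqBou.endCount_comm]
    exact ⟨p.reverse, length_pos_of_count_pos _ (.inr (.right, k))
      ((SqBou.endCount_self_pos _ _).trans_eq (h1 _).symm), h1, fun e =>
        (p.count_reverse _).trans_le ((hp'' e).trans (key _ _ e).le)⟩
  · obtain ⟨p, hp, hp', hp''⟩ := exists_straight_aux .vert k (.bottom, k) (.top, k) rfl rfl
    exact ⟨p, hp, hp', fun e => (hp'' e).trans (key _ _ e).le⟩
  · obtain ⟨p, hp, hp', hp''⟩ := exists_straight_aux .vert k (.bottom, k) (.top, k) rfl rfl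
    have h1 : ∀ b', p.reverse.count (.inr b') = SqBou.endCount (.top, k) (.bottom, k) b' :=
      fun b' => by rw [Multigraph.Walk.count_reverse, hp', SqBou.endCount_comm]
    exact ⟨p.reverse, length_pos_of_count_pos _ (.inr (.top, k))
      ((SqBou.endCount_self_pos _ _).trans_eq (h1 _).symm), h1, fun e =>
        (p.count_reverse _).trans_le ((hp'' e).trans (key _ _ e).le)⟩

theorem nonempty_walk_grid (v w : Grid M) : Nonempty ((sqGraph M).Walk (.inl v) (.inl w)) := by
  have h0 : ∀ v : Grid M, Nonempty ((sqGraph M).Walk (.inl (⟨0, v.1.pos⟩, ⟨0, v.1.pos⟩)) (.inl v)) := by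
    rintro ⟨i, k⟩
    obtain ⟨p, -⟩ := exists_line .horiz k i i.2
    obtain ⟨q, -⟩ := exists_line .vert ⟨0, k.pos⟩ k k.2
    exact ⟨Multigraph.Walk.append q p⟩
  obtain ⟨p⟩ := h0 v
  obtain ⟨q⟩ := h0 w
  exact ⟨p.reverse.append q⟩

/-- Any two boundary points are joined by a walk that meets the boundary points only at its
ends. -/
theorem exists_crossing_walk (b₁ b₂ : SqBou M) :
    ∃ p : (sqGraph M).Walk (.inr b₁) (.inr b₂),
      0 < p.length ∧ ∀ b, p.count (.inr b) = SqBou.endCount b₁ b₂ b := by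
  obtain ⟨p⟩ := nonempty_walk_grid b₁.inner b₂.inner
  obtain ⟨q, -, hq, hq'⟩ := exists_prune (b₁ := b₁) (b₂ := b₂)
    (.cons (.inr b₁) Sym2.eq_swap (p.append (.single (.inr b₂) rfl)))
    (by simp [Multigraph.Walk.length])
  exact ⟨q, hq, hq'⟩

instance Sum.instDiscreteMeasurableSpace {α β : Type*} [MeasurableSpace α] [MeasurableSpace β]
    [DiscreteMeasurableSpace α] [DiscreteMeasurableSpace β] : DiscreteMeasurableSpace (α ⊕ β) :=
  ⟨fun _ => measurableSet_sum_iff.2 ⟨.of_discrete, .of_discrete⟩⟩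

theorem IsAdmissible.measure_ends {B : ℝ≥0} {Q : SqTrans M} {μ : Measure (FinPath (sqGraph M))}
    (h : IsAdmissible B Q μ) (p : SqBou M × SqBou M) :
    μ {σ | σ.ent = .inr p.1 ∧ σ.exi = .inr p.2} = Q p := by
  have hf : Measurable (fun σ : FinPath (sqGraph M) => (σ.ent, σ.exi)) := Measurable.of_discrete
  have h1 := congrArg (fun ν => ν {((Sum.inr p.1, Sum.inr p.2) : SqVertex M × SqVertex M)}) h.tra_eq
  simp only [tra] at h1
  rw [Measure.map_apply hf (measurableSet_singleton _), SqTrans.toMeasure] at h1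
  simp only [Measure.coe_finsetSum, Finset.sum_apply, Measure.smul_apply, smul_eq_mul] at h1
  rw [Finset.sum_eq_single p] at h1
  · simp only [Measure.dirac_apply' _ (measurableSet_singleton _)] at h1
    rw [Set.indicator_of_mem (Set.mem_singleton _)] at h1
    simp only [Pi.one_apply, mul_one] at h1
    rw [← h1]
    congr 1
    ext σ
    simp
  · intro q _ hq
    rw [Measure.dirac_apply' _ (measurableSet_singleton _), Set.indicator_of_notMem, mul_zero]
    simp only [Set.mem_singleton_iff, Prod.mk.injEq, Sum.inr.injEq]
    rintro ⟨h1, h2⟩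
    exact hq (Prod.ext h1 h2)
  · simp

/-- Condition the flow on its two ends, an event of mass `Q p`, and prune every path. -/
theorem IsAdmissible.exists_crosses {B : ℝ≥0} {Q : SqTrans M}
    {μ : Measure (FinPath (sqGraph M))} (h : IsAdmissible B Q μ) {p : SqBou M × SqBou M}
    (hp : Q p ≠ 0) :
    ∃ g, Crosses p.1 p.2 g ∧ ∀ e, Q p * g e ≤
      ∫⁻ σ in {σ | σ.ent = .inr p.1 ∧ σ.exi = .inr p.2}, (σ.walk.count e : ℝ≥0∞) ∂μ := by
  set S : Set (FinPath (sqGraph M)) := {σ | σ.ent = .inr p.1 ∧ σ.exi = .inr p.2} with hS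
  have hSm : MeasurableSet S := .of_discrete
  have : ∀ σ : FinPath (sqGraph M), ∃ q : (sqGraph M).Walk (.inr p.1) (.inr p.2),
      (σ ∈ S → 0 < σ.walk.length → ∀ e, q.count e ≤ σ.walk.count e) ∧
      0 < q.length ∧ ∀ b, q.count (.inr b) = SqBou.endCount p.1 p.2 b := by
    intro σ
    by_cases hσ : σ ∈ S ∧ 0 < σ.walk.length
    · obtain ⟨⟨h1, h2⟩, h3⟩ := hσ
      obtain ⟨u, v, w⟩ := σ
      simp only at h1 h2 h3
      subst h1 h2
      obtain ⟨q, hq, hq'⟩ := exists_prune w h3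
      exact ⟨q, fun _ _ => hq, hq'⟩
    · obtain ⟨q, hq⟩ := exists_crossing_walk p.1 p.2
      exact ⟨q, fun h1 h2 => absurd ⟨h1, h2⟩ hσ, hq⟩
  choose φ hφ hφl hφc using this
  have hm : Measurable φ := Measurable.of_discrete
  have hQ : (Q p : ℝ≥0∞) ≠ 0 := by simpa using hp
  refine ⟨_, ⟨(Q p : ℝ≥0∞)⁻¹ • (μ.restrict S).map φ, ⟨?_⟩, ?_, fun e => rfl⟩, fun e => ?_⟩
  · rw [Measure.smul_apply, Measure.map_apply hm .univ, Set.preimage_univ,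
      Measure.restrict_apply_univ, h.measure_ends, smul_eq_mul,
      ENNReal.inv_mul_cancel hQ ENNReal.coe_ne_top]
  · refine Measure.ae_smul_measure ?_ _
    rw [ae_map_iff hm.aemeasurable .of_discrete]
    exact Filter.Eventually.of_forall fun σ => ⟨hφl σ, hφc σ⟩
  · rw [lintegral_smul_measure, lintegral_map Measurable.of_discrete hm, smul_eq_mul, ← mul_assoc,
      ENNReal.mul_inv_cancel hQ ENNReal.coe_ne_top, one_mul]
    refine lintegral_mono_ae ?_
    filter_upwards [ae_restrict_mem hSm, ae_restrict_of_ae h.nontrivial] with σ h1 h2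
    exact_mod_cast hφ σ h1 h2 e

/-- The paths of an admissible flow can be replaced by random crossings, that do not increase the
flow-volume. -/
theorem exists_crossings (B : ℝ≥0) (Q : SqTrans M) :
    ∃ L : ℝ≥0, ∀ μ : Measure (FinPath (sqGraph M)), IsAdmissible B Q μ →
      ∃ g : SqBou M × SqBou M → SqEdge M → ℝ≥0∞, (∀ p, Crosses p.1 p.2 (g p)) ∧
        (∀ e, crossingFlow (fun p => Q p) g e ≤ flo μ e) ∧ ∀ p e, g p e ≤ L := by
  choose d hd hd' using fun p : SqBou M × SqBou M => exists_crossing_walk p.1 p.2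
  -- If `Q p ≠ 0`, then `Q p * g p e` is at most the flow-volume, hence at most `B`, and `g p e ≤ B
  -- / Q p`. If `Q p = 0`, a fixed walk `d p` is used. Neither bound involves `μ`, so `L` is
  -- uniform.
  set L : ℝ≥0 := ∑ p, ∑ e, (B / Q p + (d p).count e) with hL
  have hL' : ∀ p e, B / Q p + (d p).count e ≤ L := fun p e =>
    (Finset.single_le_sum (f := fun e => B / Q p + ((d p).count e : ℝ≥0)) (fun _ _ => zero_le)
      (Finset.mem_univ e)).trans
      (Finset.single_le_sum (f := fun p => ∑ e, (B / Q p + ((d p).count e : ℝ≥0)))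
        (fun _ _ => zero_le) (Finset.mem_univ p))
  refine ⟨L, fun μ h => ?_⟩
  have : ∀ p : SqBou M × SqBou M, ∃ g, Crosses p.1 p.2 g ∧ (∀ e, Q p * g e ≤
      ∫⁻ σ in {σ | σ.ent = .inr p.1 ∧ σ.exi = .inr p.2}, (σ.walk.count e : ℝ≥0∞) ∂μ) ∧
      ∀ e, g e ≤ L := by
    intro p
    by_cases hp : Q p = 0
    · refine ⟨_, Crosses.of_walk (d p) (hd p) (hd' p), fun e => by simp [hp], fun e => ?_⟩
      have h1 : ((d p).count e : ℝ≥0) ≤ L := le_trans (le_add_of_nonneg_left zero_le) (hL' p e)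
      exact_mod_cast h1
    · obtain ⟨g, hg, hg'⟩ := h.exists_crosses hp
      refine ⟨g, hg, hg', fun e => ?_⟩
      have h1 : (Q p : ℝ≥0∞) * g e ≤ B :=
        (hg' e).trans ((setLIntegral_le_lintegral _ _).trans (h.flo_le e))
      have h2 : g e ≤ B / Q p := by
        rw [ENNReal.le_div_iff_mul_le (by simp [hp]) (by simp), mul_comm]
        exact h1
      refine h2.trans ?_
      rw [← ENNReal.coe_div hp]
      exact_mod_cast le_trans (le_add_of_nonneg_right zero_le) (hL' p e)
  choose g hg hg' hgL using this
  refine ⟨g, hg, fun e => ?_, hgL⟩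
  refine (Finset.sum_le_sum fun p _ => hg' p e).trans ?_
  -- The events that prescribe different ends are disjoint, so the partial integrals add up to at
  -- most the whole flow-volume.
  rw [← tsum_fintype (L := .unconditional _), ← lintegral_iUnion]
  · exact setLIntegral_le_lintegral _ _
  · exact fun _ => .of_discrete
  · intro p q hpq
    refine Set.disjoint_left.2 fun σ h1 h2 => hpq ?_
    have h3 := h1.1.symm.trans h2.1
    have h4 := h1.2.symm.trans h2.2
    exact Prod.ext (by simpa using h3) (by simpa using h4)

end ExistsCrossings

/-! ## The squares of the torus -/

section Squares

variable {m M : ℕ} [NeZero m]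

/-- The index set of the squares of the partition. -/
abbrev Sq (m : ℕ) : Type := ZMod m × ZMod m

theorem val_mul_add_lt (i : ZMod m) (x : Fin M) : i.val * M + x < m * M := by
  have h1 : i.val + 1 ≤ m := ZMod.val_lt i
  calc i.val * M + x < i.val * M + M := by have := x.2; omega
    _ = (i.val + 1) * M := by ring
    _ ≤ m * M := Nat.mul_le_mul_right M h1

/-- The coordinate `x` in the `i`-th block. -/
def place (i : ZMod m) (x : Fin M) : Fin (m * M) := ⟨i.val * M + x, val_mul_add_lt i x⟩

theorem place_injective {i i' : ZMod m} {x x' : Fin M} (h : place i x = place i' x') :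
    i = i' ∧ x = x' := by
  have h0 : i.val * M + x = i'.val * M + x' := congrArg Fin.val h
  have h1 : i.val = i'.val := by
    have := congrArg (· / M) h0
    simpa [Nat.add_comm, Nat.add_mul_div_right _ _ x.pos, Nat.div_eq_of_lt x.2,
      Nat.div_eq_of_lt x'.2] using this
  refine ⟨ZMod.val_injective m h1, Fin.ext ?_⟩
  rw [h1] at h0
  omega

theorem place_surjective (y : Fin (m * M)) : ∃ (i : ZMod m) (x : Fin M), place i x = y := by
  have hM : 0 < M := Nat.pos_of_ne_zero fun h => by subst h; exact y.elim0
  have h1 : (y : ℕ) / M < m := (Nat.div_lt_iff_lt_mul hM).2 y.2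
  refine ⟨((y / M : ℕ) : ZMod m), ⟨y % M, Nat.mod_lt _ hM⟩, Fin.ext ?_⟩
  simp only [place, ZMod.val_natCast, Nat.mod_eq_of_lt h1]
  rw [mul_comm]
  exact Nat.div_add_mod _ _

theorem val_add_one_mul (i : ZMod m) : (i + 1).val * M = ((i.val + 1) * M) % (m * M) := by
  have h : (i + 1).val = (i.val + 1) % m := by
    rw [← ZMod.val_natCast]
    simp
  rw [h, Nat.mul_mod_mul_right]

theorem rot_place (i : ZMod m) (x : Fin M) : rot M (place i x) = place (i + 1) x := by
  refine Fin.ext ?_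
  simp only [rot, place]
  rw [val_add_one_mul]
  have h1 : i.val + 1 ≤ m := ZMod.val_lt i
  rcases h1.lt_or_eq with h | h
  · have h2 : (i.val + 2) * M ≤ m * M := Nat.mul_le_mul_right M h
    have h3 := x.2
    have h4 : (i.val + 1) * M = i.val * M + M := by ring
    have h5 : (i.val + 2) * M = i.val * M + M + M := by ring
    rw [Nat.mod_eq_of_lt (by omega), Nat.mod_eq_of_lt (by omega)]
    omega
  · have h2 : i.val * M + x + M = m * M + x := by
      calc i.val * M + x + M = (i.val + 1) * M + x := by ring
        _ = _ := by rw [h]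
    have hm : M ≤ m * M := Nat.le_mul_of_pos_left M (Nat.pos_of_ne_zero (NeZero.ne m))
    rw [h2, h, Nat.add_mod_left, Nat.mod_self, zero_add, Nat.mod_eq_of_lt (by have := x.2; omega)]

theorem rot_one_place (i : ZMod m) (x : Fin M) (hx : (x : ℕ) + 1 < M) :
    rot 1 (place i x) = place i ⟨x + 1, hx⟩ := by
  refine Fin.ext ?_
  simp only [rot, place]
  rw [Nat.mod_eq_of_lt, add_assoc]
  exact val_mul_add_lt i ⟨x + 1, hx⟩

theorem rot_one_place_last (i : ZMod m) (x : Fin M) (hx : (x : ℕ) + 1 = M) :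
    rot 1 (place i x) = place (i + 1) ⟨0, x.pos⟩ := by
  refine Fin.ext ?_
  simp only [rot, place]
  rw [val_add_one_mul, add_assoc, hx, add_zero]
  congr 1
  ring

theorem dvd_place_add_one_iff (i : ZMod m) (x : Fin M) :
    M ∣ (place i x : ℕ) + 1 ↔ (x : ℕ) + 1 = M := by
  simp only [place, add_assoc]
  rw [Nat.dvd_add_right (Dvd.intro_left _ rfl)]
  constructor
  · intro h
    have h1 := Nat.le_of_dvd (Nat.succ_pos _) h
    have h2 := x.2
    omega
  · intro h
    rw [h]

/-- The vertex `v` of the square `s`. -/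
def vertAt (s : Sq m) (v : Grid M) : Grid (m * M) := (place s.1 v.1, place s.2 v.2)

theorem vertAt_injective {s s' : Sq m} {v v' : Grid M} (h : vertAt s v = vertAt s' v') :
    s = s' ∧ v = v' := by
  obtain ⟨h1, h2⟩ := Prod.ext_iff.1 h
  obtain ⟨h3, h4⟩ := place_injective h1
  obtain ⟨h5, h6⟩ := place_injective h2
  exact ⟨Prod.ext h3 h5, Prod.ext h4 h6⟩

theorem vertAt_surjective (w : Grid (m * M)) : ∃ (s : Sq m) (v : Grid M), vertAt s v = w := by
  obtain ⟨i, x, h1⟩ := place_surjective w.1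
  obtain ⟨j, y, h2⟩ := place_surjective w.2
  exact ⟨(i, j), (x, y), Prod.ext h1 h2⟩

/-- The unit vector along an axis. -/
def Axis.unit (R : Type*) [Ring R] : Axis → R × R
  | .horiz => (1, 0)
  | .vert => (0, 1)

theorem shift_vertAt (s : Sq m) (a : Axis) (v : Grid M) :
    shift M a (vertAt s v) = vertAt (s + a.unit (ZMod m)) v := by
  cases a <;> simp [shift, vertAt, rot_place, Axis.unit]

theorem shift_one_vertAt (s : Sq m) (a : Axis) (v : Grid M) (h : (coord a v : ℕ) + 1 < M) :
    shift 1 a (vertAt s v) = vertAt s (shift 1 a v) := by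
  have hr : ∀ x : Fin M, ∀ hx : (x : ℕ) + 1 < M, rot 1 x = ⟨x + 1, hx⟩ := fun x hx =>
    Fin.ext (Nat.mod_eq_of_lt hx)
  cases a <;> simp only [shift, vertAt, coord] at h ⊢ <;> rw [rot_one_place _ _ h, hr _ h]

theorem isCut_vertAt_iff (s : Sq m) (a : Axis) (v : Grid M) :
    IsCut M ((a, vertAt s v) : TorusEdge (m * M)) ↔ (coord a v : ℕ) + 1 = M := by
  cases a
  · exact dvd_place_add_one_iff s.1 v.1
  · exact dvd_place_add_one_iff s.2 v.2

/-- The last element of `Fin M`. -/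
def lastOf (k : Fin M) : Fin M := ⟨M - 1, Nat.sub_lt k.pos Nat.one_pos⟩

theorem lastOf_add_one (k : Fin M) : (lastOf k : ℕ) + 1 = M := by
  have := k.pos
  simp only [lastOf]
  omega

/-- The midpoint of the edge that leaves the square `s` along the axis `a`, in the `k`-th row or
column. -/
def cutAt (s : Sq m) (a : Axis) (k : Fin M) : TorusBou (m * M) M :=
  ⟨(a, vertAt s (gridPt a (lastOf k) k)), by
    rw [isCut_vertAt_iff, coord_gridPt]; exact lastOf_add_one k⟩

theorem cutAt_injective {s s' : Sq m} {a a' : Axis} {k k' : Fin M}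
    (h : cutAt s a k = cutAt s' a' k') : s = s' ∧ a = a' ∧ k = k' := by
  have h1 := Subtype.ext_iff.1 h
  simp only [cutAt, Prod.mk.injEq] at h1
  obtain ⟨rfl, h2⟩ := h1
  obtain ⟨h3, h4⟩ := vertAt_injective h2
  refine ⟨h3, rfl, ?_⟩
  have := congrArg (cross a) h4
  simpa using this

theorem cutAt_surjective (b : TorusBou (m * M) M) :
    ∃ (s : Sq m) (a : Axis) (k : Fin M), cutAt s a k = b := by
  obtain ⟨⟨a, w⟩, hb⟩ := b
  obtain ⟨s, v, rfl⟩ := vertAt_surjective w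
  rw [isCut_vertAt_iff] at hb
  refine ⟨s, a, cross a v, Subtype.ext (Prod.ext rfl ?_)⟩
  simp only [cutAt]
  congr 1
  have h1 : lastOf (cross a v) = coord a v := Fin.ext (by
    have := lastOf_add_one (cross a v)
    omega)
  rw [h1]
  cases a <;> rfl

/-- The displacement, in squares, when a square is left through a given side. -/
def Side.dir (R : Type*) [Ring R] : Side → R × R
  | .left => (-1, 0)
  | .right => (1, 0)
  | .bottom => (0, -1)
  | .top => (0, 1)

/-- The boundary point `b` of the square `s`. -/
def bouAt (s : Sq m) : SqBou M → TorusBou (m * M) M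
  | (.left, j) => cutAt (s + Side.dir _ .left) .horiz j
  | (.right, j) => cutAt s .horiz j
  | (.bottom, i) => cutAt (s + Side.dir _ .bottom) .vert i
  | (.top, i) => cutAt s .vert i

/-- This is the gluing of squares: the midpoint through which `s` is left is, for the neighbour
beyond it, the reflected boundary point. Hence an exit `b` leads to the state `b.reflect`. -/
theorem bouAt_reflect (s : Sq m) (b : SqBou M) :
    bouAt (s + b.1.dir _) b.reflect = bouAt s b := by
  rcases b with ⟨_ | _ | _ | _, k⟩ <;> simp [bouAt, SqBou.reflect, Side.dir, add_assoc, Prod.mk_zero_zero]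

/-- The half of the divided edge that belongs to the square on a given side of the square. -/
def Side.half : Side → Bool
  | .left => true
  | .right => false
  | .bottom => true
  | .top => false

/-- The vertices of the square `s` in the torus. -/
def vertexAt (s : Sq m) : SqVertex M → SplitVertex (m * M) M
  | .inl v => .inl (vertAt s v)
  | .inr b => .inr (bouAt s b)

/-- The edges of the square `s` in the torus. -/
def edgeAt (s : Sq m) : SqEdge M → SplitEdge (m * M) M
  | .inl e => .inl ⟨(e.1.1, vertAt s e.1.2), by rw [isCut_vertAt_iff]; exact e.2.ne⟩
  | .inr b => .inr (bouAt s b, b.1.half)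

theorem shift_one_cutAt (s : Sq m) (a : Axis) (k : Fin M) :
    shift 1 a (cutAt s a k).1.2 = vertAt (s + a.unit _) (gridPt a ⟨0, k.pos⟩ k) := by
  cases a <;> simp [shift, cutAt, vertAt, gridPt, Axis.unit,
    rot_one_place_last _ _ (lastOf_add_one k)]

theorem ends_edgeAt (s : Sq m) (e : SqEdge M) (u v : SqVertex M)
    (h : (sqGraph M).ends e = s(u, v)) :
    (splitGraph (m * M) M).ends (edgeAt s e) = s(vertexAt s u, vertexAt s v) := by
  rw [← Sym2.map_mk, ← h]
  rcases e with e | ⟨_ | _ | _ | _, k⟩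
  · simp [sqGraph, splitGraph, edgeAt, vertexAt, shift_one_vertAt s _ _ e.2]
  · simp [sqGraph, splitGraph, edgeAt, vertexAt, Side.half, bouAt, SqBou.inner]
    refine (shift_one_cutAt _ .horiz k).trans ?_
    simp [Axis.unit, Side.dir, gridPt, add_assoc, Prod.mk_zero_zero]
  · simp [sqGraph, splitGraph, edgeAt, vertexAt, Side.half, bouAt, SqBou.inner]
    rfl
  · simp [sqGraph, splitGraph, edgeAt, vertexAt, Side.half, bouAt, SqBou.inner]
    refine (shift_one_cutAt _ .vert k).trans ?_
    simp [Axis.unit, Side.dir, gridPt, add_assoc, Prod.mk_zero_zero]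
  · simp [sqGraph, splitGraph, edgeAt, vertexAt, Side.half, bouAt, SqBou.inner]
    rfl

/-- The Boolean tells the two halves of a divided edge apart, so this holds even when `m = 1`. -/
theorem edgeAt_injective {s s' : Sq m} {e e' : SqEdge M} (h : edgeAt s e = edgeAt s' e') :
    s = s' ∧ e = e' := by
  rcases e with e | ⟨_ | _ | _ | _, k⟩ <;> rcases e' with e' | ⟨_ | _ | _ | _, k'⟩ <;>
    simp only [edgeAt, reduceCtorEq, Sum.inl.injEq, Sum.inr.injEq, Subtype.mk.injEq, Prod.mk.injEq,
      bouAt, Side.half, and_true, and_false, Bool.true_eq_false, Bool.false_eq_true] at h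
  · obtain ⟨h1, h2⟩ := h
    obtain ⟨h3, h4⟩ := vertAt_injective h2
    exact ⟨h3, congrArg _ (Subtype.ext (Prod.ext h1 h4))⟩
  all_goals
    obtain ⟨h1, h2, h3⟩ := cutAt_injective h
    first
    | exact absurd h2 (by decide)
    | exact ⟨by simpa using h1, by rw [h3]⟩

theorem edgeAt_surjective (E : SplitEdge (m * M) M) : ∃ (s : Sq m) (e : SqEdge M),
    edgeAt s e = E := by
  rcases E with ⟨⟨a, w⟩, hE⟩ | ⟨b, _ | _⟩
  · obtain ⟨s, v, rfl⟩ := vertAt_surjective w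
    rw [isCut_vertAt_iff] at hE
    exact ⟨s, .inl ⟨(a, v), lt_of_le_of_ne (coord a v).2 hE⟩, rfl⟩
  · obtain ⟨s, a, k, rfl⟩ := cutAt_surjective b
    cases a
    · exact ⟨s, .inr (.right, k), rfl⟩
    · exact ⟨s, .inr (.top, k), rfl⟩
  · obtain ⟨s, a, k, rfl⟩ := cutAt_surjective b
    cases a
    · exact ⟨s - Side.dir _ .left, .inr (.left, k), by simp [edgeAt, bouAt, Side.half]⟩
    · exact ⟨s - Side.dir _ .bottom, .inr (.bottom, k), by simp [edgeAt, bouAt, Side.half]⟩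

/-- Each edge of the divided torus belongs to exactly one square. -/
noncomputable def edgeEquiv (m M : ℕ) [NeZero m] : Sq m × SqEdge M ≃ SplitEdge (m * M) M :=
  Equiv.ofBijective (fun p => edgeAt p.1 p.2)
    ⟨fun _ _ h => Prod.ext (edgeAt_injective h).1 (edgeAt_injective h).2, fun E =>
      let ⟨s, e, h⟩ := edgeAt_surjective E
      ⟨(s, e), h⟩⟩

@[simp]
theorem edgeEquiv_symm_edgeAt (s : Sq m) (e : SqEdge M) :
    (edgeEquiv m M).symm (edgeAt s e) = (s, e) :=
  (edgeEquiv m M).symm_apply_apply (s, e)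

theorem translate_cutAt (h : M ∣ m * M) (s : Sq m) (a a' : Axis) (k : Fin M) :
    TorusBou.translate h a (cutAt s a' k) = cutAt (s + a.unit _) a' k :=
  Subtype.ext (Prod.ext rfl (shift_vertAt s a _))

theorem translate_bouAt (h : M ∣ m * M) (s : Sq m) (a : Axis) (b : SqBou M) :
    TorusBou.translate h a (bouAt s b) = bouAt (s + a.unit _) b := by
  rcases b with ⟨_ | _ | _ | _, k⟩ <;> simp [bouAt, translate_cutAt, add_right_comm]

end Squares

/-! ## Words of transitions -/

section Words

variable {σ : Type} (r : σ → σ)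

/-- The state that is reached from a state by a sequence of exits; the exit `b` leads to the
state `r b`. -/
def endState : σ → List σ → σ
  | x, [] => x
  | _, b :: l => endState (r b) l

theorem endState_append (x : σ) (l l' : List σ) :
    endState r x (l ++ l') = endState r (endState r x l) l' := by
  induction l generalizing x with
  | nil => rfl
  | cons b l ih => exact ih _

variable [DecidableEq σ]

/-- The number of times that the sequence of exits `l` from the state `x` uses a given transition
(a pair of a state and an exit). -/
def usage : σ → List σ → σ × σ → ℕ
  | _, [], _ => 0
  | x, b :: l, p => (if p = (x, b) then 1 else 0) + usage (r b) l p

theorem usage_append (x : σ) (l l' : List σ) (p : σ × σ) :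
    usage r x (l ++ l') p = usage r x l p + usage r (endState r x l) l' p := by
  induction l generalizing x with
  | nil => simp [usage, endState]
  | cons b l ih => simp only [List.cons_append, usage, endState, ih]; ring

variable {r} [Fintype σ]

/-- Flow conservation at all states. -/
def Balanced {R : Type*} [AddCommMonoid R] (r : σ → σ) (n : σ × σ → R) : Prop :=
  ∀ a, ∑ b, n (a, b) = ∑ b, n (b, r a)

theorem sum_ite_eq_left (x y a : σ) :
    ∑ b, (if a = x ∧ b = y then 1 else 0) = if a = x then 1 else 0 := by
  by_cases hax : a = x <;> simp [hax]

theorem sum_ite_eq_right (hr : Function.Involutive r) (x y a : σ) :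
    ∑ b, (if b = x ∧ r a = y then 1 else 0) = if a = r y then 1 else 0 := by
  by_cases hay : r a = y
  · obtain rfl : a = r y := hr.eq_iff.1 hay
    simp [hr y]
  · have : a ≠ r y := fun h => hay (hr.eq_iff.2 h)
    simp [hay, this]

/-- The arrivals at the state `a` are the transitions with exit `r a`. Along a word every arrival
except the last one is followed by a departure, and every departure except the first one is preceded
by an arrival. -/
theorem usage_conservation (hr : Function.Involutive r) (x : σ) (l : List σ) (a : σ) :
    ∑ b, usage r x l (a, b) + (if a = endState r x l then 1 else 0) =
      ∑ b, usage r x l (b, r a) + (if a = x then 1 else 0) := by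
  induction l generalizing x with
  | nil => simp [usage]; rfl
  | cons y l ih =>
    have h := ih (r y)
    rw [show endState r x (y :: l) = endState r (r y) l from rfl]
    simp only [usage, Finset.sum_add_distrib, Prod.mk.injEq] at h ⊢
    rw [sum_ite_eq_left, sum_ite_eq_right hr]
    omega

theorem balanced_usage (hr : Function.Involutive r) {x : σ} {l : List σ}
    (h : endState r x l = x) : Balanced r (usage r x l) := fun a => by
  have := usage_conservation hr x l a
  rw [h] at this
  omega

/-- A maximal trail. -/
theorem exists_trail (hr : Function.Involutive r) (k : ℕ) (n : σ × σ → ℕ) (hk : ∑ p, n p = k)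
    (x b : σ) (hn : ∀ a, ∑ y, n (a, y) + (if a = b then 1 else 0) =
      ∑ y, n (y, r a) + (if a = x then 1 else 0)) :
    ∃ l, endState r x l = b ∧ (∀ p, usage r x l p ≤ n p) ∧
      ∀ y, usage r x l (b, y) = n (b, y) := by
  induction k generalizing n x with
  | zero =>
    have h0 : ∀ p, n p = 0 := by simpa using hk
    have := hn x
    simp only [h0, Finset.sum_const_zero, if_true] at this
    have hx : x = b := by
      by_contra h
      simp [h] at this
    subst hx
    exact ⟨[], rfl, fun p => by simp [usage], fun y => by simp [usage, h0]⟩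
  | succ k ih =>
    -- The trail stops only in a state without remaining departures, and conservation then forces
    -- this state to be `b`. Otherwise one transition `(x, y)` is removed, and the hypothesis
    -- persists with the new start `r y`.
    by_cases hx : ∀ y, n (x, y) = 0
    · have := hn x
      simp only [hx, Finset.sum_const_zero, if_true] at this
      have hx' : x = b := by
        by_contra h
        simp [h] at this
      subst hx'
      exact ⟨[], rfl, fun p => by simp [usage], fun y => by simp [usage, hx]⟩
    · push Not at hx
      obtain ⟨y, hy⟩ := hx
      set n' : σ × σ → ℕ := fun p => n p - if p = (x, y) then 1 else 0 with hn'
      have hadd : ∀ p, n p = n' p + if p = (x, y) then 1 else 0 := by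
        intro p
        simp only [hn']
        split_ifs with h
        · subst h; omega
        · omega
      have hk' : ∑ p, n' p = k := by
        have : ∑ p, n p = ∑ p, n' p + 1 := by
          simp only [hadd, Finset.sum_add_distrib]
          simp
        omega
      obtain ⟨l, h1, h2, h3⟩ := ih n' hk' (r y) fun a => by
        have h := hn a
        simp only [hadd, Finset.sum_add_distrib, Prod.mk.injEq] at h
        rw [sum_ite_eq_left, sum_ite_eq_right hr] at h
        omega
      refine ⟨y :: l, h1, fun p => ?_, fun z => ?_⟩
      · rw [hadd, usage, add_comm]
        exact Nat.add_le_add_right (h2 p) _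
      · rw [hadd, usage, h3, add_comm]

/-- A closed word that uses each transition at least as often as a given conserved flow of
integers. -/
theorem exists_closed_word_aux (hr : Function.Involutive r) (n : σ × σ → ℕ) (hn : Balanced r n)
    (h : σ) (S : Finset σ) :
    ∃ (l : List σ) (u : σ × σ → ℕ), endState r h l = h ∧ Balanced r u ∧ (∀ p, u p ≤ n p) ∧
      (∀ a ∈ S, ∀ y, u (a, y) = n (a, y)) ∧
      ∀ p, u p ≤ usage r h l p ∧ usage r h l p ≤ u p + 2 * S.card := by
  induction S using Finset.induction_on with
  | empty => exact ⟨[], 0, rfl, fun a => by simp, fun p => zero_le, by simp,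
      fun p => by simp [usage]⟩
  | insert a S ha ih =>
    obtain ⟨l, u, hl, hu, hun, huS, hlu⟩ := ih
    have hadd : ∀ p, n p = (n p - u p) + u p := fun p => by have := hun p; omega
    -- `u` is the part of `n` that has been used by closed trails so far. The rest `n - u` is
    -- conserved, so a maximal trail in it from `a` closes up at `a` and exhausts all departures
    -- from `a`.
    obtain ⟨l', h1, h2, h3⟩ := exists_trail hr _ (fun p => n p - u p) rfl a a fun b => by
      have e1 := hn b
      have e2 := hu b
      rw [Finset.sum_congr rfl fun y _ => hadd (b, y),
        Finset.sum_congr rfl fun y _ => hadd (y, r b)] at e1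
      simp only [Finset.sum_add_distrib] at e1
      omega
    -- The trail at `a` is attached to the hub `h` by the extra transitions `(h, r a)` and `(a, r
    -- h)`. They are not counted in `u` and cause the error 2 per state.
    refine ⟨l ++ (r a :: (l' ++ [r h])), fun p => u p + usage r a l' p, ?_, fun b => ?_,
      fun p => ?_, fun b hb y => ?_, fun p => ?_⟩
    · simp [endState_append, endState, hr h]
    · simp only [Finset.sum_add_distrib]
      rw [hu b, balanced_usage hr h1 b]
    · have := h2 p
      have := hun p
      simp only at *
      omega
    · rcases Finset.mem_insert.1 hb with rfl | hb
      · simp only [h3]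
        have := hun (b, y)
        omega
      · have e1 := huS b hb y
        have e2 := h2 (b, y)
        simp only at *
        omega
    · rw [usage_append, hl, usage, usage_append, hr a, h1]
      simp only [usage, Finset.card_insert_of_notMem ha]
      have := hlu p
      split_ifs <;> omega

/-- With all states treated, `u` equals `n`. The detours through the hub replace the connectedness
that an Euler circuit would need. -/
theorem exists_closed_word (hr : Function.Involutive r) (n : σ × σ → ℕ) (hn : Balanced r n)
    (h : σ) : ∃ l : List σ, endState r h l = h ∧
      ∀ p, n p ≤ usage r h l p ∧ usage r h l p ≤ n p + 2 * Fintype.card σ := by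
  obtain ⟨l, u, hl, -, -, hu, hlu⟩ := exists_closed_word_aux hr n hn h Finset.univ
  refine ⟨l, hl, fun p => ?_⟩
  have := hlu p
  rwa [hu p.1 (Finset.mem_univ _) p.2] at this

/-- A conserved flow is rounded up to a conserved flow of integers. -/
theorem exists_integer_flow (hr : Function.Involutive r) (n : σ × σ → ℝ≥0) (hn : Balanced r n)
    (h : σ) : ∃ k : σ × σ → ℕ, Balanced r k ∧
      ∀ p, n p ≤ k p ∧ (k p : ℝ≥0) ≤ n p + (1 + 2 * Fintype.card σ : ℕ) := by
  set c : σ × σ → ℕ := fun p => ⌈n p⌉₊ with hc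
  set o : σ → ℕ := fun a => ∑ y, c (a, y) with ho
  set i : σ → ℕ := fun a => ∑ y, c (y, r a) with hi
  have hcn : ∀ p, n p ≤ c p := fun p => Nat.le_ceil _
  have hcn' : ∀ p, (c p : ℝ≥0) ≤ n p + 1 := fun p => (Nat.ceil_lt_add_one zero_le).le
  -- Each ceiling exceeds its argument by at most one, so arrivals and departures at a state are out
  -- of balance by at most the number of states.
  have hio : ∀ a, i a ≤ o a + Fintype.card σ := by
    intro a
    have : (i a : ℝ≥0) ≤ o a + Fintype.card σ := by
      simp only [hi, ho, Nat.cast_sum]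
      calc ∑ y, (c (y, r a) : ℝ≥0) ≤ ∑ y, (n (y, r a) + 1) := Finset.sum_le_sum fun y _ => hcn' _
        _ = ∑ y, n (a, y) + Fintype.card σ := by
          rw [Finset.sum_add_distrib, hn a]; simp
        _ ≤ _ := by gcongr; exact hcn _
    exact_mod_cast this
  have hoi : ∀ a, o a ≤ i a + Fintype.card σ := by
    intro a
    have : (o a : ℝ≥0) ≤ i a + Fintype.card σ := by
      simp only [hi, ho, Nat.cast_sum]
      calc ∑ y, (c (a, y) : ℝ≥0) ≤ ∑ y, (n (a, y) + 1) := Finset.sum_le_sum fun y _ => hcn' _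
        _ = ∑ y, n (y, r a) + Fintype.card σ := by
          rw [Finset.sum_add_distrib, hn a]; simp
        _ ≤ _ := by gcongr; exact hcn _
    exact_mod_cast this
  have htot : ∑ a, o a = ∑ a, i a := by
    simp only [ho, hi]
    rw [Finset.sum_comm, ← hr.bijective.sum_comp (fun y => ∑ x, c (x, y))]
  have hdef : ∑ a, (i a - o a) = ∑ a, (o a - i a) := by
    have e1 : ∀ a, o a + (i a - o a) = i a + (o a - i a) := fun a => by omega
    have e2 := Finset.sum_congr rfl fun a (_ : a ∈ Finset.univ) => e1 a
    rw [Finset.sum_add_distrib, Finset.sum_add_distrib, htot] at e2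
    exact Nat.add_left_cancel e2
  -- Imbalances are repaired through the hub: a state `a` with too many arrivals sends the excess to
  -- `h` by the exit `r h`, and a state with too many departures is supplied from `h`. Subtraction
  -- is truncated, so at most one of the two corrections is active for a state; by `hdef` the totals
  -- cancel at `h`.
  refine ⟨fun p => c p + ((if p.2 = r h then i p.1 - o p.1 else 0) +
    if p.1 = h then o (r p.2) - i (r p.2) else 0), fun a => ?_, fun p => ⟨?_, ?_⟩⟩
  · simp only [Finset.sum_add_distrib, Finset.sum_ite_eq', Finset.mem_univ, if_true, hr a]
    have e1 : ∑ y, (if a = h then o (r y) - i (r y) else 0) =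
        if a = h then ∑ y, (o y - i y) else 0 := by
      split_ifs
      · exact hr.bijective.sum_comp (fun y => o y - i y)
      · simp
    have e2 : ∑ y, (if r a = r h then i y - o y else 0) =
        if a = h then ∑ y, (i y - o y) else 0 := by
      by_cases hah : a = h
      · simp [hah]
      · simp [hah, hr.injective.eq_iff]
    rw [e1, e2, hdef]
    have e3 : ∑ y, c (a, y) = o a := rfl
    have e4 : ∑ y, c (y, r a) = i a := rfl
    rw [e3, e4]
    omega
  · push_cast
    exact (hcn p).trans (le_add_of_nonneg_right zero_le)
  · have e1 : (c p + ((if p.2 = r h then i p.1 - o p.1 else 0) +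
      if p.1 = h then o (r p.2) - i (r p.2) else 0)) ≤ c p + 2 * Fintype.card σ := by
      have := hio p.1
      have := hoi (r p.2)
      split_ifs <;> omega
    calc _ ≤ ((c p + 2 * Fintype.card σ : ℕ) : ℝ≥0) := by exact_mod_cast e1
      _ = c p + (2 * Fintype.card σ : ℕ) := by push_cast; ring
      _ ≤ n p + 1 + (2 * Fintype.card σ : ℕ) := by gcongr; exact hcn' p
      _ = _ := by push_cast; ring

/-- Both roundings go upwards. The lower bound is what later makes the torus flow at least as costly
as an isotropic one. -/
theorem exists_rounded_word (hr : Function.Involutive r) (n : σ × σ → ℝ≥0) (hn : Balanced r n)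
    (h : σ) : ∃ l : List σ, endState r h l = h ∧ ∀ p, n p ≤ usage r h l p ∧
      (usage r h l p : ℝ≥0) ≤ n p + (1 + 4 * Fintype.card σ : ℕ) := by
  obtain ⟨k, hk, hkn⟩ := exists_integer_flow hr n hn h
  obtain ⟨l, hl, hlk⟩ := exists_closed_word hr k hk h
  refine ⟨l, hl, fun p => ⟨(hkn p).1.trans (by exact_mod_cast (hlk p).1), ?_⟩⟩
  calc (usage r h l p : ℝ≥0) ≤ ((k p + 2 * Fintype.card σ : ℕ) : ℝ≥0) := by
        exact_mod_cast (hlk p).2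
    _ = k p + (2 * Fintype.card σ : ℕ) := by push_cast; ring
    _ ≤ n p + (1 + 2 * Fintype.card σ : ℕ) + (2 * Fintype.card σ : ℕ) := by
      gcongr; exact (hkn p).2
    _ = _ := by push_cast; ring

end Words

/-- A sequence of transitions between boundary points of the square: a state, and the exits that
are used successively. -/
def Word (M : ℕ) : Type := SqBou M × List (SqBou M)

instance (M : ℕ) : MeasurableSpace (Word M) := ⊤

instance (M : ℕ) : DiscreteMeasurableSpace (Word M) := ⟨fun _ => trivial⟩

/-! ### Words for compatible transports on the square -/

section SquareWords

variable {M : ℕ}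

theorem balanced_of_compatible {Q : SqTrans M} (h : Q ∈ compatible M) :
    Balanced SqBou.reflect Q := fun a => by
  have := h a
  simp only [SqBou.reflect_eq_iff, Finset.filter_eq', Finset.mem_univ, if_true,
    Finset.sum_singleton] at this
  exact this.symm

/-- The number of uses of a transition by a word. -/
def Word.usage (w : Word M) (p : SqBou M × SqBou M) : ℕ :=
  DisorderedFlow.usage SqBou.reflect w.1 w.2 p

/-- The last state is the first one. -/
def Word.Closed (w : Word M) : Prop := endState SqBou.reflect w.1 w.2 = w.1

/-- Compatible transports are approximated by closed words, measurably. -/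
theorem exists_measurable_word (hM : 0 < M) : ∃ C : ℕ, ∀ T : ℝ≥0, 0 < T →
    ∃ W : SqTrans M → Word M, Measurable W ∧ (∀ Q, (W Q).Closed) ∧
      ∀ Q ∈ compatible M, ∀ p, T * Q p ≤ (W Q).usage p ∧ ((W Q).usage p : ℝ≥0) ≤ T * Q p + C := by
  refine ⟨2 + (1 + 4 * Fintype.card (SqBou M)), fun T hT => ?_⟩
  set h : SqBou M := (.left, ⟨0, hM⟩)
  -- The word depends on `Q` only through the integer parts of `T * Q`, hence is a measurable
  -- function of `Q` with countably many values.
  set cell : SqTrans M → (SqBou M × SqBou M → ℕ) := fun Q p => ⌊T * Q p⌋₊ with hcell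
  have hcm : Measurable cell := measurable_pi_lambda _ fun p =>
    Nat.measurable_floor.comp (measurable_const.mul (measurable_pi_apply p))
  have key : ∀ k : SqBou M × SqBou M → ℕ, ∃ w : Word M, w.Closed ∧
      ∀ Q ∈ compatible M, cell Q = k → ∀ p, T * Q p ≤ w.usage p ∧
        (w.usage p : ℝ≥0) ≤ T * Q p + (2 + (1 + 4 * Fintype.card (SqBou M)) : ℕ) := by
    intro k
    by_cases hk : ∃ Q ∈ compatible M, cell Q = k
    · obtain ⟨R, hR, rfl⟩ := hk
      -- One representative `R` serves its whole cell. Adding 1 to every entry keeps balance and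
      -- dominates `T * Q` for all `Q` in the cell; it accounts for one unit of the error, and
      -- passing back from `R` to `Q` for another.
      obtain ⟨l, hl, hlu⟩ := exists_rounded_word SqBou.reflect_involutive
        (fun p => T * R p + 1) (fun a => by
          have := balanced_of_compatible hR a
          simp only [Finset.sum_add_distrib, ← Finset.mul_sum, this]) h
      refine ⟨(h, l), hl, fun Q hQ hQR p => ?_⟩
      have e1 : ⌊T * Q p⌋₊ = ⌊T * R p⌋₊ := congrFun hQR p
      have e2 := Nat.lt_floor_add_one (T * Q p)
      have e3 := Nat.lt_floor_add_one (T * R p)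
      have e4 := Nat.floor_le (a := T * Q p) zero_le
      have e5 := Nat.floor_le (a := T * R p) zero_le
      rw [e1] at e2 e4
      refine ⟨?_, (hlu p).2.trans ?_⟩
      · calc T * Q p ≤ ⌊T * R p⌋₊ + 1 := e2.le
          _ ≤ T * R p + 1 := by gcongr
          _ ≤ _ := (hlu p).1
      · push_cast
        calc _ ≤ (⌊T * R p⌋₊ + 1 : ℝ≥0) + 1 + (1 + 4 * Fintype.card (SqBou M)) := by
              gcongr
          _ ≤ (T * Q p + 1) + 1 + (1 + 4 * Fintype.card (SqBou M)) := by gcongr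
          _ = _ := by ring
    · exact ⟨(h, []), rfl, fun Q hQ hQk => absurd ⟨Q, hQ, hQk⟩ hk⟩
  choose w hw hwu using key
  refine ⟨fun Q => w (cell Q), (measurable_of_countable w).comp hcm, fun Q => hw _,
    fun Q hQ p => hwu _ Q hQ rfl p⟩

end SquareWords

/-! ## The flow along a word on the torus -/

section TorusWords

variable {m M : ℕ} [NeZero m]

/-- The displacement, in squares, of a sequence of exits. -/
def displacement (R : Type*) [Ring R] (l : List (SqBou M)) : R × R :=
  (l.map fun b => b.1.dir R).sum

open Classical in
/-- The flow on the edge `e` of the square `s'`, of random crossings along a sequence of exits that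
starts in the square `s` in the state `x`. -/
noncomputable def wordFlow (g : Sq m → SqBou M × SqBou M → SqEdge M → ℝ≥0∞) :
    Sq m → SqBou M → List (SqBou M) → Sq m → SqEdge M → ℝ≥0∞
  | _, _, [], _, _ => 0
  | s, x, b :: l, s', e => (if s' = s then g s (x, b) e else 0) +
      wordFlow g (s + b.1.dir _) b.reflect l s' e

/-- By `bouAt_reflect` the exit point of each crossing is the entrance point of the next one, so
independent crossings can be concatenated. -/
theorem realizes_wordFlow {g : Sq m → SqBou M × SqBou M → SqEdge M → ℝ≥0∞}
    (hg : ∀ s p, Crosses p.1 p.2 (g s p)) (s : Sq m) (x : SqBou M) (l : List (SqBou M)) :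
    Realizes (splitGraph (m * M) M) (.inr (bouAt s x))
      (.inr (bouAt (s + displacement _ l) (endState SqBou.reflect x l)))
      (fun E => wordFlow g s x l ((edgeEquiv m M).symm E).1 ((edgeEquiv m M).symm E).2) := by
  classical
  induction l generalizing s x with
  | nil =>
    simp only [displacement, List.map_nil, List.sum_nil, add_zero]
    exact Realizes.nil _
  | cons b l ih =>
    have h1 : Realizes (splitGraph (m * M) M) (.inr (bouAt s x)) (.inr (bouAt s b))
        (fun E => if ((edgeEquiv m M).symm E).1 = s then g s (x, b) ((edgeEquiv m M).symm E).2
          else 0) := by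
      refine (hg s (x, b)).realizes.map (φ := vertexAt s) (χ := edgeAt s)
        (fun e u v => ends_edgeAt s e u v) (fun e e' h => (edgeAt_injective h).2)
        (fun e => by simp) fun E hE => ?_
      rw [if_neg]
      intro h
      refine hE ⟨((edgeEquiv m M).symm E).2, ?_⟩
      rw [← h]
      exact (edgeEquiv m M).apply_symm_apply E
    have h2 := ih (s + b.1.dir _) b.reflect
    rw [bouAt_reflect] at h2
    have h3 : s + displacement _ (b :: l) = s + b.1.dir (ZMod m) + displacement _ l := by
      simp [displacement, add_assoc]
    rw [h3]
    exact h1.append h2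

/-- As the starting square runs through the torus, each step of the word visits every square exactly
once. So the flow in `s'` involves only the crossings chosen in `s'`: the choices in different
squares do not interact. -/
theorem sum_wordFlow (g : Sq m → SqBou M × SqBou M → SqEdge M → ℝ≥0∞) (x : SqBou M)
    (l : List (SqBou M)) (s' : Sq m) (e : SqEdge M) :
    ∑ s, wordFlow g s x l s' e = ∑ p, usage SqBou.reflect x l p * g s' p e := by
  classical
  induction l generalizing x with
  | nil => simp [wordFlow, usage]
  | cons b l ih =>
    simp only [wordFlow, usage, Finset.sum_add_distrib, Nat.cast_add, add_mul]
    congr 1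
    · simp
    · rw [← ih]
      exact Equiv.sum_comp (Equiv.addRight (b.1.dir (ZMod m))) fun s => wordFlow g s b.reflect l s' e

end TorusWords

/-! ## Environments and costs on the torus and on its squares -/

section Environment

variable {m M : ℕ} [NeZero m]

/-- The edges of the extended square, except the half-edges at the right and top sides. -/
def SqEdge.owned : SqEdge M → Bool
  | .inl _ => true
  | .inr b => b.1.half

/-- The environment seen in the square `s`. -/
def sqEnv (c : TorusEdge (m * M) → ℝ≥0) (s : Sq m) (e : SqEdge M) : ℝ≥0 :=
  if SqEdge.owned e then c (edgeAt s e).parent else 0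

theorem measurable_sqEnv (s : Sq m) :
    Measurable fun c : TorusEdge (m * M) → ℝ≥0 => sqEnv c s := by
  refine measurable_pi_lambda _ fun e => ?_
  unfold sqEnv
  split_ifs
  · exact measurable_pi_apply _
  · exact measurable_const

/-- Ownership is needed when `m = 1`: opposite half-edges of the single square then have the same
parent. -/
theorem parent_edgeAt_injective (s : Sq m) {e e' : SqEdge M} (he : SqEdge.owned e)
    (he' : SqEdge.owned e') (h : (edgeAt s e).parent = (edgeAt s e').parent) : e = e' := by
  refine (edgeAt_injective (s := s) (s' := s) ?_).2
  rcases e with e | b <;> rcases e' with e' | b'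
  · exact congrArg Sum.inl (Subtype.ext h)
  · have h1 := (bouAt s b').2
    simp only [edgeAt, SplitEdge.parent] at h
    rw [← h, isCut_vertAt_iff] at h1
    exact absurd h1 e.2.ne
  · have h1 := (bouAt s b).2
    simp only [edgeAt, SplitEdge.parent] at h
    rw [h, isCut_vertAt_iff] at h1
    exact absurd h1 e'.2.ne
  · simp only [SqEdge.owned] at he he'
    have h1 : bouAt s b = bouAt s b' := Subtype.ext h
    simp only [edgeAt, h1, he, he']

instance (κ : Measure ℝ≥0) [IsProbabilityMeasure κ] (e : SqEdge M) :
    IsProbabilityMeasure (sqEdgeLaw κ e) := by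
  rcases e with e | ⟨_ | _ | _ | _, k⟩ <;> simp only [sqEdgeLaw] <;> infer_instance

theorem sqEdgeLaw_eq (κ : Measure ℝ≥0) (e : SqEdge M) :
    sqEdgeLaw κ e = if SqEdge.owned e then κ else Measure.dirac 0 := by
  rcases e with e | ⟨_ | _ | _ | _, k⟩ <;> rfl

/-- The owned edges of one square have distinct parents, so their cost-factors are independent with
law `κ`; the other half-edges receive 0. The laws are compared on measurable boxes. -/
theorem map_sqEnv (κ : Measure ℝ≥0) [IsProbabilityMeasure κ] (s : Sq m) :
    (torusEnvLaw (m * M) κ).map (fun c => sqEnv c s) = sqEnvLaw M κ := by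
  classical
  refine (Measure.pi_eq fun S hS => ?_).symm
  rw [Measure.map_apply (measurable_sqEnv s) (MeasurableSet.univ_pi hS)]
  by_cases h0 : ∀ e : SqEdge M, ¬ SqEdge.owned e → (0 : ℝ≥0) ∈ S e
  · set T : TorusEdge (m * M) → Set ℝ≥0 := fun E =>
      ⋂ e : {e : SqEdge M // SqEdge.owned e}, {x | (edgeAt s e.1).parent = E → x ∈ S e.1} with hT
    have h1 : (fun c : TorusEdge (m * M) → ℝ≥0 => sqEnv c s) ⁻¹' Set.univ.pi S =
        Set.univ.pi T := by
      ext c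
      simp only [Set.mem_preimage, Set.mem_univ_pi, hT, Set.mem_iInter, Set.mem_ofPred_eq, sqEnv]
      constructor
      · rintro h _ e rfl
        have := h e.1
        rwa [if_pos e.2] at this
      · intro h e
        split_ifs with he
        · exact h _ ⟨e, he⟩ rfl
        · exact h0 e he
    rw [h1, torusEnvLaw, Measure.pi_pi]
    have h2 : ∏ e, sqEdgeLaw κ e (S e) = ∏ e : {e : SqEdge M // SqEdge.owned e}, κ (S e.1) := by
      rw [← Fintype.prod_subtype_mul_prod_subtype (fun e : SqEdge M => SqEdge.owned e = true)]
      rw [Finset.prod_eq_one (s := (Finset.univ : Finset {e : SqEdge M // ¬ SqEdge.owned e = true})),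
        mul_one]
      · exact Finset.prod_congr rfl fun e _ => by rw [sqEdgeLaw_eq, if_pos e.2]
      · intro e _
        rw [sqEdgeLaw_eq, if_neg e.2, Measure.dirac_apply' _ (hS _),
          Set.indicator_of_mem (h0 _ e.2), Pi.one_apply]
    rw [h2]
    refine (Fintype.prod_of_injective (fun e : {e : SqEdge M // SqEdge.owned e} =>
      (edgeAt s e.1).parent) (fun e e' h => Subtype.ext (parent_edgeAt_injective s e.2 e'.2 h))
      _ _ (fun E hE => ?_) fun e => ?_).symm
    · have : T E = Set.univ := by
        refine Set.eq_univ_of_forall fun x => Set.mem_iInter.2 fun e h => absurd ⟨e, h⟩ hE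
      rw [this, measure_univ]
    · congr 1
      ext x
      simp only [hT, Set.mem_iInter, Set.mem_ofPred_eq]
      constructor
      · intro hx e' h
        rwa [parent_edgeAt_injective s e'.2 e.2 h]
      · exact fun h => h e rfl
  · push Not at h0
    obtain ⟨e, he, he0⟩ := h0
    have h1 : (fun c : TorusEdge (m * M) → ℝ≥0 => sqEnv c s) ⁻¹' Set.univ.pi S = ∅ := by
      refine Set.eq_empty_of_forall_notMem fun c hc => he0 ?_
      have := hc e (Set.mem_univ e)
      simp only [sqEnv] at this
      rwa [if_neg he] at this
    rw [h1, measure_empty]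
    refine (Finset.prod_eq_zero (Finset.mem_univ e) ?_).symm
    rw [sqEdgeLaw_eq, if_neg he, Measure.dirac_apply' _ (hS _), Set.indicator_of_notMem he0]

open Classical in
/-- The cost on the torus is the sum of the costs on its squares. -/
theorem cost_eq_sum_squares (f : TorusEdge (m * M) → ℝ≥0∞) (c : TorusEdge (m * M) → ℝ≥0) :
    cost f c = ∑ s : Sq m, cost (fun e => f (edgeAt s e).parent) (sqEnv c s) := by
  set h : TorusEdge (m * M) → ℝ≥0∞ := fun e => c e * f e ^ 2 with hh
  -- A divided edge is charged on its `true` half only, which lies on the left or bottom side of a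
  -- square.
  set t : SplitEdge (m * M) M → ℝ≥0∞ := fun E => match E with
    | .inl e => h e.1
    | .inr (b, true) => h b.1
    | .inr (_, false) => 0 with ht
  have h1 : ∀ p : Sq m × SqEdge M, (sqEnv c p.1 p.2 : ℝ≥0∞) * f (edgeAt p.1 p.2).parent ^ 2 =
      t (edgeEquiv m M p) := by
    rintro ⟨s, e | ⟨_ | _ | _ | _, k⟩⟩ <;>
      simp [ht, sqEnv, SqEdge.owned, edgeEquiv, edgeAt, Side.half, hh, SplitEdge.parent]
  calc cost f c = ∑ e, h e := rfl
    _ = ∑ E, t E := by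
      have h2 : ∑ p : TorusBou (m * M) M × Bool, t (.inr p) = ∑ b : TorusBou (m * M) M, h b.1 := by
        rw [Fintype.sum_prod_type]
        simp [ht]
      rw [Fintype.sum_sum_type, h2,
        ← Fintype.sum_subtype_add_sum_subtype (fun e : TorusEdge (m * M) => IsCut M e), add_comm]

    _ = ∑ p : Sq m × SqEdge M, t (edgeEquiv m M p) := ((edgeEquiv m M).sum_comp t).symm
    _ = _ := by
      rw [Fintype.sum_prod_type]
      exact Finset.sum_congr rfl fun s _ => Finset.sum_congr rfl fun e _ => (h1 (s, e)).symm

/-- Linearity of expectation: only the law of the environment in each single square matters, not the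
dependence between squares. -/
theorem lintegral_cost_torus (κ : Measure ℝ≥0) [IsProbabilityMeasure κ]
    {h : (SqEdge M → ℝ≥0) → SqEdge M → ℝ≥0∞} (hh : Measurable fun c => cost (h c) c)
    {f : (TorusEdge (m * M) → ℝ≥0) → TorusEdge (m * M) → ℝ≥0∞}
    (hf : ∀ c s e, f c (edgeAt s e).parent = h (sqEnv c s) e) :
    ∫⁻ c, cost (f c) c ∂(torusEnvLaw (m * M) κ) =
      (m : ℝ≥0∞) ^ 2 * ∫⁻ c, cost (h c) c ∂(sqEnvLaw M κ) := by
  simp only [cost_eq_sum_squares, hf]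
  rw [lintegral_finsetSum]
  swap
  · exact fun s _ => hh.comp (measurable_sqEnv s)
  have : ∀ s : Sq m, ∫⁻ c, cost (h (sqEnv c s)) (sqEnv c s) ∂(torusEnvLaw (m * M) κ) =
      ∫⁻ c, cost (h c) c ∂(sqEnvLaw M κ) := fun s => by
    rw [← map_sqEnv κ s, lintegral_map hh (measurable_sqEnv s)]
  have hc : ∀ s : Sq m, ∫⁻ c, cost (fun e => h (sqEnv c s) e) (sqEnv c s)
      ∂(torusEnvLaw (m * M) κ) = ∫⁻ c, cost (h c) c ∂(sqEnvLaw M κ) := this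
  rw [Finset.sum_congr rfl fun s _ => hc s, Finset.sum_const, Finset.card_univ, Fintype.card_prod,
    ZMod.card, nsmul_eq_mul]
  push_cast
  ring

end Environment

/-! ## Path-flows on the torus from random words -/

section TorusFlow

variable {m M : ℕ}

/-- Every crossing uses a half-edge only to enter or to leave, so the two marginals add and the
choice of `g` drops out. -/
theorem crossingFlow_inr {Q : SqBou M × SqBou M → ℝ≥0∞}
    {g : SqBou M × SqBou M → SqEdge M → ℝ≥0∞} (hg : ∀ p, Crosses p.1 p.2 (g p)) (b : SqBou M) :
    crossingFlow Q g (.inr b) = ∑ y, Q (b, y) + ∑ x, Q (x, b) := by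
  classical
  have h1 : ∀ x y : SqBou M, Q (x, y) * (SqBou.endCount x y b : ℝ≥0∞) =
      (if x = b then Q (x, y) else 0) + if y = b then Q (x, y) else 0 := by
    intro x y
    simp only [SqBou.endCount]
    push_cast
    rw [mul_add]
    split_ifs <;> simp
  have h2 : crossingFlow Q g (.inr b) =
      ∑ x, ∑ y, Q (x, y) * (SqBou.endCount x y b : ℝ≥0∞) := by
    simp only [crossingFlow, (hg _).apply_inr]
    exact Fintype.sum_prod_type _
  simp only [h2, h1, Finset.sum_add_distrib]
  congr 1
  · rw [Finset.sum_comm]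
    simp
  · simp

/-- Balance exchanges entrances at a point with exits at its reflection. The crossings `g` and `g'`
may differ because neighbouring squares see different environments. -/
theorem crossingFlow_reflect {Q : SqBou M × SqBou M → ℝ≥0∞} (hQ : Balanced SqBou.reflect Q)
    {g g' : SqBou M × SqBou M → SqEdge M → ℝ≥0∞} (hg : ∀ p, Crosses p.1 p.2 (g p))
    (hg' : ∀ p, Crosses p.1 p.2 (g' p)) (b : SqBou M) :
    crossingFlow Q g (.inr b.reflect) = crossingFlow Q g' (.inr b) := by
  have h1 := hQ b.reflect
  rw [SqBou.reflect_reflect] at h1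
  rw [crossingFlow_inr hg, crossingFlow_inr hg', hQ b, h1, add_comm]

/-- The mean number of uses of a transition per square, for random words that start in random
squares; `M / m` is the mass of the words per square. -/
noncomputable def wordTrans (m : ℕ) (lam : Measure (Word M)) (p : SqBou M × SqBou M) : ℝ≥0∞ :=
  (M : ℝ≥0∞) / m * ∫⁻ w, (w.usage p : ℝ≥0∞) ∂lam

theorem balanced_wordTrans {lam : Measure (Word M)} (h : ∀ᵐ w ∂lam, w.Closed) :
    Balanced SqBou.reflect (wordTrans m lam) := fun a => by
  simp only [wordTrans, ← Finset.mul_sum]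
  congr 1
  rw [← lintegral_finsetSum _ fun _ _ => Measurable.of_discrete,
    ← lintegral_finsetSum _ fun _ _ => Measurable.of_discrete]
  refine lintegral_congr_ae ?_
  filter_upwards [h] with w hw
  exact_mod_cast balanced_usage SqBou.reflect_involutive hw a

variable [NeZero m]

/-- Entrance and exit on the torus of the path along a word that starts in the square `s`. -/
def wordEnds (s : Sq m) (w : Word M) : TorusBou (m * M) M × TorusBou (m * M) M :=
  (bouAt s w.1, bouAt (s + displacement _ w.2) (endState SqBou.reflect w.1 w.2))

/-- The transportation measure on the torus of paths along random words. -/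
noncomputable def endsMeasure (m : ℕ) [NeZero m] (lam : Measure (Word M)) :
    Measure (TorusBou (m * M) M × TorusBou (m * M) M) :=
  ∑ s : Sq m, ((M : ℝ≥0∞) / m) • lam.map (wordEnds s)

theorem lintegral_endsMeasure (lam : Measure (Word M))
    (F : TorusBou (m * M) M × TorusBou (m * M) M → ℝ≥0∞) :
    ∫⁻ z, F z ∂(endsMeasure m lam) =
      (M : ℝ≥0∞) / m * ∫⁻ w, ∑ s : Sq m, F (wordEnds s w) ∂lam := by
  rw [endsMeasure, lintegral_finsetSum_measure,
    lintegral_finsetSum _ fun _ _ => Measurable.of_discrete, Finset.mul_sum]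
  refine Finset.sum_congr rfl fun s _ => ?_
  rw [lintegral_smul_measure, lintegral_map Measurable.of_discrete Measurable.of_discrete,
    smul_eq_mul]

theorem natCast_div_ne_top (M m : ℕ) [NeZero m] : (M : ℝ≥0∞) / m ≠ ∞ :=
  ENNReal.div_ne_top (by simp) (by simpa using NeZero.ne m)

theorem endsMeasure_univ (lam : Measure (Word M)) [IsProbabilityMeasure lam] :
    endsMeasure m lam Set.univ = (m * M : ℕ) := by
  have := lintegral_endsMeasure (m := m) lam 1
  simp only [Pi.one_apply, lintegral_one] at this
  rw [this]
  simp only [Finset.sum_const, Finset.card_univ, Fintype.card_prod, ZMod.card, lintegral_const,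
    measure_univ, mul_one, nsmul_eq_mul]
  push_cast
  rw [ENNReal.div_eq_inv_mul]
  have h1 : (m : ℝ≥0∞) ≠ 0 := by simpa using NeZero.ne m
  calc ((m : ℝ≥0∞)⁻¹ * M) * (m * m) = ((m : ℝ≥0∞)⁻¹ * m) * (m * M) := by ring
    _ = m * M := by rw [ENNReal.inv_mul_cancel h1 (by simp), one_mul]

instance (lam : Measure (Word M)) [IsProbabilityMeasure lam] :
    IsFiniteMeasure (endsMeasure m lam) :=
  ⟨by rw [endsMeasure_univ]; exact ENNReal.natCast_lt_top _⟩

/-- There are m² starting squares of mass M/m each, which gives N. Translation permutes the starting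
squares. A closed word ends in its first state, in a square that is again uniform, so the marginals
agree. -/
theorem isBalanced_endsMeasure (h : M ∣ m * M) (lam : Measure (Word M)) [IsProbabilityMeasure lam]
    (hcl : ∀ᵐ w ∂lam, w.Closed) : IsBalanced h ⟨endsMeasure m lam, inferInstance⟩ := by
  refine ⟨?_, fun a => ?_, ?_⟩
  · have h1 : endsMeasure m lam Set.univ = ((m * M : ℕ) : ℝ≥0) := by
      rw [endsMeasure_univ]; simp
    change (endsMeasure m lam Set.univ).toNNReal = _
    rw [h1, ENNReal.toNNReal_coe]
  · refine Subtype.ext (Measure.ext_of_lintegral _ fun F hF => ?_)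
    change ∫⁻ z, F z ∂(endsMeasure m lam).map _ = ∫⁻ z, F z ∂(endsMeasure m lam)
    rw [lintegral_map hF Measurable.of_discrete, lintegral_endsMeasure, lintegral_endsMeasure]
    congr 1
    refine lintegral_congr fun w => ?_
    have : ∀ s : Sq m, Prod.map (TorusBou.translate h a) (TorusBou.translate h a) (wordEnds s w) =
        wordEnds (s + a.unit _) w := fun s => by
      simp [wordEnds, translate_bouAt, add_right_comm]
    simp only [this]
    exact Equiv.sum_comp (Equiv.addRight (a.unit (ZMod m))) fun s => F (wordEnds s w)
  · refine Subtype.ext (Measure.ext_of_lintegral _ fun F hF => ?_)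
    change ∫⁻ z, F z ∂(endsMeasure m lam).map _ = ∫⁻ z, F z ∂(endsMeasure m lam).map _
    rw [lintegral_map hF Measurable.of_discrete, lintegral_map hF Measurable.of_discrete,
      lintegral_endsMeasure, lintegral_endsMeasure]
    congr 1
    refine lintegral_congr_ae ?_
    filter_upwards [hcl] with w hw
    simp only [wordEnds]
    rw [hw]
    exact (Equiv.sum_comp (Equiv.addRight (displacement (ZMod m) w.2))
      fun s => F (bouAt s w.1)).symm

/-- Random words and random crossings yield a path-flow on the torus. -/
theorem exists_pathFlow (lam : Measure (Word M)) [IsProbabilityMeasure lam]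
    {g : Sq m → SqBou M × SqBou M → SqEdge M → ℝ≥0∞} (hg : ∀ s p, Crosses p.1 p.2 (g s p)) :
    ∃ μ : Measure (FinPath (splitGraph (m * M) M)), IsFiniteMeasure μ ∧
      tra μ = (endsMeasure m lam).map (Prod.map Sum.inr Sum.inr) ∧
      ∀ s e, flo μ (edgeAt s e) = crossingFlow (wordTrans m lam) (g s) e := by
  choose P hP hPg using fun (s : Sq m) (w : Word M) => realizes_wordFlow hg s w.1 w.2
  set π : Sq m → Word M → Measure (FinPath (splitGraph (m * M) M)) := fun s w =>
    (P s w).map fun p => ⟨_, _, p⟩ with hπ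
  have hm : ∀ (s : Sq m) (w : Word M), Measurable fun p : (splitGraph (m * M) M).Walk (.inr (bouAt s w.1))
      (.inr (bouAt (s + displacement _ w.2) (endState SqBou.reflect w.1 w.2))) =>
      (⟨_, _, p⟩ : FinPath (splitGraph (m * M) M)) := fun s w => Measurable.of_discrete
  have hπm : ∀ s, AEMeasurable (π s) lam := fun s => Measurable.of_discrete.aemeasurable
  have key : ∀ F : FinPath (splitGraph (m * M) M) → ℝ≥0∞,
      ∫⁻ σ, F σ ∂(∑ s : Sq m, ((M : ℝ≥0∞) / m) • lam.bind (π s)) =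
        (M : ℝ≥0∞) / m * ∫⁻ w, ∑ s : Sq m, ∫⁻ p, F ⟨_, _, p⟩ ∂(P s w) ∂lam := by
    intro F
    rw [lintegral_finsetSum_measure, lintegral_finsetSum _ fun _ _ => Measurable.of_discrete,
      Finset.mul_sum]
    refine Finset.sum_congr rfl fun s _ => ?_
    rw [lintegral_smul_measure, Measure.lintegral_bind (hπm s) Measurable.of_discrete.aemeasurable,
      smul_eq_mul]
    congr 1
    refine lintegral_congr fun w => ?_
    rw [hπ, lintegral_map Measurable.of_discrete (hm s w)]
  have htra : tra (∑ s : Sq m, ((M : ℝ≥0∞) / m) • lam.bind (π s)) =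
      (endsMeasure m lam).map (Prod.map Sum.inr Sum.inr) := by
    refine Measure.ext_of_lintegral _ fun F hF => ?_
    rw [tra, lintegral_map hF Measurable.of_discrete, lintegral_map hF Measurable.of_discrete,
      lintegral_endsMeasure, key]
    simp [wordEnds]
  refine ⟨_, ⟨?_⟩, htra, fun s e => ?_⟩
  · have h1 : tra (∑ s : Sq m, ((M : ℝ≥0∞) / m) • lam.bind (π s)) Set.univ < ∞ := by
      rw [htra]
      exact measure_lt_top _ _
    rwa [tra, Measure.map_apply Measurable.of_discrete .univ] at h1
  · rw [flo, key]
    simp only [hPg, edgeEquiv_symm_edgeAt, sum_wordFlow]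
    rw [lintegral_finsetSum _ fun _ _ => Measurable.of_discrete, Finset.mul_sum, crossingFlow]
    refine Finset.sum_congr rfl fun p _ => ?_
    rw [lintegral_mul_const _ Measurable.of_discrete, ← mul_assoc]
    rfl

/-- A part of an edge of the torus. -/
noncomputable def partOf (M : ℕ) {N : ℕ} (e : TorusEdge N) : SplitEdge N M :=
  open Classical in if h : IsCut M e then .inr (⟨e, h⟩, false) else .inl ⟨e, h⟩

theorem partOf_val {N : ℕ} (b : TorusBou N M) : partOf M b.1 = .inr (b, false) := by
  simp [partOf, b.2]

/-- There is one path-flow `ν k` for each of the countably many patterns `k` of cells, so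
measurability in the environment is automatic. All `ν k` have the same transportation measure,
because the words do not depend on `k`. -/
theorem exists_torus_flow (κ : Measure ℝ≥0) [IsProbabilityMeasure κ] {B : ℝ≥0}
    (lam : Measure (Word M)) [IsProbabilityMeasure lam] (hcl : ∀ᵐ w ∂lam, w.Closed)
    {ι : Type} [Countable ι] [MeasurableSpace ι] [DiscreteMeasurableSpace ι]
    {cell : (SqEdge M → ℝ≥0) → ι} (hcell : Measurable cell)
    {g : ι → SqBou M × SqBou M → SqEdge M → ℝ≥0∞} (hg : ∀ i p, Crosses p.1 p.2 (g i p))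
    (hB : ∀ i e, crossingFlow (wordTrans m lam) (g i) e ≤ B) :
    ∃ (μ : Kernel (TorusEdge (m * M) → ℝ≥0) (FinPath (splitGraph (m * M) M)))
      (f : (TorusEdge (m * M) → ℝ≥0) → TorusEdge (m * M) → ℝ≥0∞),
      (∀ c, IsFiniteMeasure (μ c) ∧ IsTorusFlow (μ c) (f c)) ∧ (∀ c e, f c e ≤ B) ∧
      ∫⁻ c, cost (f c) c ∂(torusEnvLaw (m * M) κ) = (m : ℝ≥0∞) ^ 2 *
        ∫⁻ c, cost (crossingFlow (wordTrans m lam) (g (cell c))) c ∂(sqEnvLaw M κ) ∧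
      ∀ c, tra (μ c) = asVertexMeasure ⟨endsMeasure m lam, inferInstance⟩ := by
  choose ν hν hνt hνf using fun k : Sq m → ι =>
    exists_pathFlow lam (g := fun s => g (k s)) fun s p => hg (k s) p
  have hc : Measurable fun (c : TorusEdge (m * M) → ℝ≥0) (s : Sq m) => cell (sqEnv c s) :=
    measurable_pi_lambda _ fun s => hcell.comp (measurable_sqEnv s)
  -- The halves of a divided edge lie in neighbouring squares with possibly different crossings;
  -- `crossingFlow_reflect` equates their volumes.
  have hflow : ∀ k (E : SplitEdge (m * M) M), flo (ν k) E = flo (ν k) (partOf M E.parent) := by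
    intro k E
    rcases E with ⟨e, he⟩ | ⟨b, _ | _⟩
    · simp [partOf, SplitEdge.parent, he]
    · simp [partOf, SplitEdge.parent, b.2]
    · simp only [partOf, SplitEdge.parent]
      change flo _ _ = flo _ (partOf M b.1)
      rw [partOf_val]
      obtain ⟨s, a, j, rfl⟩ := cutAt_surjective b
      have h1 : ∀ (b₀ : SqBou M), b₀.1.half = false →
          flo (ν k) (.inr (bouAt s b₀, true)) = flo (ν k) (.inr (bouAt s b₀, false)) := by
        intro b₀ hb₀
        have h2 := hνf k s (.inr b₀)
        have h3 := hνf k (s + b₀.1.dir _) (.inr b₀.reflect)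
        rw [crossingFlow_reflect (balanced_wordTrans hcl) (hg _) (hg (k s)), ← h2] at h3
        simp only [edgeAt, bouAt_reflect, hb₀] at h3
        rw [← h3]
        congr 3
        rcases b₀ with ⟨_ | _ | _ | _, j⟩ <;> simp [Side.half, SqBou.reflect] at hb₀ ⊢
      cases a
      · exact h1 (.right, j) rfl
      · exact h1 (.top, j) rfl
  have hval : ∀ k s e, flo (ν k) (partOf M (edgeAt s e).parent) =
      crossingFlow (wordTrans m lam) (g (k s)) e := fun k s e => by
    rw [← hflow, hνf]
  refine ⟨⟨fun c => ν fun s => cell (sqEnv c s), (measurable_of_countable ν).comp hc⟩,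
    fun c e => flo (ν fun s => cell (sqEnv c s)) (partOf M e), fun c => ⟨hν _, fun E => hflow _ E⟩,
    fun c e => ?_, ?_, fun c => hνt _⟩
  · obtain ⟨s, e', h⟩ := edgeAt_surjective (partOf M e)
    change flo _ (partOf M e) ≤ _
    rw [← h, hνf]
    exact hB _ _
  · refine lintegral_cost_torus κ (h := fun c => crossingFlow (wordTrans m lam) (g (cell c))) ?_
      fun c s e => hval _ s e
    refine Finset.measurable_sum _ fun e _ => ?_
    have h1 : Measurable fun c : SqEdge M → ℝ≥0 => (c e : ℝ≥0∞) :=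
      measurable_coe_nnreal_ennreal.comp (measurable_pi_apply e)
    exact h1.mul (((measurable_of_countable
      fun i => crossingFlow (wordTrans m lam) (g i) e).comp hcell).pow_const 2)

end TorusFlow

/-! ## Drift and isotropy -/

section Isotropy

variable {M : ℕ}

theorem SqBou.pos_sub_pos_reflect (b : SqBou M) :
    b.pos - b.reflect.pos = (M : ℝ) • b.1.dir ℝ := by
  rcases b with ⟨_ | _ | _ | _, k⟩ <;> ext <;> simp [SqBou.pos, SqBou.reflect, Side.dir] <;> ring

/-- The drift of a compatible transport is determined by the directions of the exits. -/
theorem drift_eq {Q : SqTrans M} (hQ : Q ∈ compatible M) :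
    Q.drift = (M : ℝ)⁻¹ • ∑ p : SqBou M × SqBou M, (Q p : ℝ) • p.2.1.dir ℝ := by
  -- Compatibility replaces the positions of the entrances by those of the reflected exits; what
  -- remains of an exit is `M` times its direction.
  have h1 : ∑ p : SqBou M × SqBou M, (Q p : ℝ) • p.1.pos =
      ∑ p : SqBou M × SqBou M, (Q p : ℝ) • p.2.reflect.pos := by
    have e1 : ∑ p : SqBou M × SqBou M, (Q p : ℝ) • p.1.pos =
      ∑ x : SqBou M, ∑ y : SqBou M, (Q (x, y) : ℝ) • x.pos := Fintype.sum_prod_type _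
    have e2 : ∑ p : SqBou M × SqBou M, (Q p : ℝ) • p.2.reflect.pos =
      ∑ y : SqBou M, ∑ x : SqBou M, (Q (x, y) : ℝ) • y.reflect.pos := Fintype.sum_prod_type_right _
    rw [e1, e2]
    simp only [← Finset.sum_smul]
    rw [← SqBou.reflect_involutive.bijective.sum_comp
      (fun y : SqBou M => (∑ x, (Q (x, y) : ℝ)) • y.reflect.pos)]
    refine Finset.sum_congr rfl fun a _ => ?_
    rw [SqBou.reflect_reflect]
    congr 1
    exact_mod_cast balanced_of_compatible hQ a
  simp only [SqTrans.drift, smul_sub, Finset.sum_sub_distrib, h1]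
  rw [← smul_sub, ← Finset.sum_sub_distrib]
  simp only [← smul_sub, SqBou.pos_sub_pos_reflect]
  simp only [smul_comm _ (M : ℝ)]
  rw [← Finset.smul_sum, smul_smul]
  rcases eq_or_ne (M : ℝ) 0 with h | h
  · simp [h]
  · congr 1
    field_simp

/-- The strength of the flow that enters through a given side, for straight flows with drift
`(x, y)`. -/
noncomputable def straightWeight (x y : ℝ) : Side → ℝ≥0
  | .left => x.toNNReal
  | .right => (-x).toNNReal
  | .bottom => y.toNNReal
  | .top => (-y).toNNReal

/-- Straight flows with drift `(x, y)`. -/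
noncomputable def straightOf (M : ℕ) (x y : ℝ) : SqTrans M := fun p =>
  if p.2 = p.1.reflect then straightWeight x y p.1.1 else 0

theorem straightOf_mem_compatible (x y : ℝ) : straightOf M x y ∈ compatible M := by
  intro a
  simp only [SqBou.reflect_eq_iff, Finset.filter_eq', Finset.mem_univ, if_true,
    Finset.sum_singleton]
  simp only [SqTrans.exi, SqTrans.ent, straightOf, SqBou.reflect_involutive.injective.eq_iff]
  simp

theorem Fintype.sum_side {R : Type*} [AddCommMonoid R] (f : Side → R) :
    ∑ s, f s = f .left + (f .right + (f .bottom + f .top)) := by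
  change ∑ s ∈ {.left, .right, .bottom, .top}, f s = _
  rw [Finset.sum_insert (by decide), Finset.sum_insert (by decide), Finset.sum_insert (by decide),
    Finset.sum_singleton]

theorem drift_straightOf (hM : 0 < M) (x y : ℝ) : (straightOf M x y).drift = (x, y) := by
  rw [drift_eq (straightOf_mem_compatible x y)]
  have h1 : ∑ p : SqBou M × SqBou M, (straightOf M x y p : ℝ) • p.2.1.dir ℝ =
      ∑ b : SqBou M, (straightWeight x y b.1 : ℝ) • b.reflect.1.dir ℝ := by
    rw [Fintype.sum_prod_type]
    refine Finset.sum_congr rfl fun b _ => ?_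
    rw [Finset.sum_eq_single b.reflect]
    · simp [straightOf]
    · intro b' _ hb'
      simp [straightOf, hb']
    · simp
  have hM' : (M : ℝ) ≠ 0 := by exact_mod_cast hM.ne'
  have hx : ∀ x : ℝ, max x 0 = x + max (-x) 0 := fun x => by
    rcases le_total x 0 with h | h
    · rw [max_eq_right h, max_eq_left (by linarith)]; ring
    · rw [max_eq_left h, max_eq_right (by linarith)]; ring
  rw [h1, Fintype.sum_prod_type, Fintype.sum_side]
  ext
  · simp [straightWeight, SqBou.reflect, Side.dir, Real.coe_toNNReal']
    rw [hx x]
    field_simp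
    ring
  · simp [straightWeight, SqBou.reflect, Side.dir, Real.coe_toNNReal']
    rw [hx y]
    field_simp
    ring

/-- The representative of a point of the circle in `(-1/2, 1/2]`. -/
noncomputable def circleRep (u : UnitAddCircle) : ℝ := AddCircle.measurableEquivIoc 1 (-1 / 2) u

theorem measurable_circleRep : Measurable circleRep :=
  measurable_subtype_coe.comp (AddCircle.measurableEquivIoc 1 (-1 / 2)).measurable

theorem coe_circleRep (u : UnitAddCircle) : (circleRep u : UnitAddCircle) = u :=
  (AddCircle.measurableEquivIoc 1 (-1 / 2)).symm_apply_apply u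

theorem lintegral_circleRep (h : ℝ → ℝ≥0∞) :
    ∫⁻ u : UnitAddCircle, h (circleRep u) = ∫⁻ a in Set.Ioc (-1 / 2 : ℝ) (1 / 2), h a := by
  rw [← AddCircle.lintegral_preimage 1 (-1 / 2), show (-1 / 2 + 1 : ℝ) = 1 / 2 by norm_num]
  refine setLIntegral_congr_fun measurableSet_Ioc fun a ha => ?_
  have : circleRep (a : UnitAddCircle) = a := by
    have h1 : a ∈ Set.Ioc (-1 / 2 : ℝ) (-1 / 2 + 1) := ⟨ha.1, by linarith [ha.2]⟩
    exact congrArg Subtype.val (AddCircle.equivIoc_coe_eq h1)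
  rw [this]

/-- This is the integral of a over [0, 1/2]. Two opposite straight flows of this mean strength give
the threshold 1/4 for `B`. -/
theorem lintegral_circleRep_pos :
    ∫⁻ u : UnitAddCircle, ((circleRep u).toNNReal : ℝ≥0∞) = ((1 / 8 : ℝ≥0) : ℝ≥0∞) := by
  rw [lintegral_circleRep fun a => (a.toNNReal : ℝ≥0∞)]
  have h1 : ∀ a : ℝ, (a.toNNReal : ℝ≥0∞) = ENNReal.ofReal (max a 0) := fun a => by
    rw [ENNReal.ofReal_max]
    simp [ENNReal.ofReal]
  have hc : Continuous fun a : ℝ => max a 0 := by fun_prop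
  simp only [h1]
  rw [← ofReal_integral_eq_lintegral_ofReal
    ((hc.integrableOn_Icc (a := -1 / 2) (b := 1 / 2)).mono_set Set.Ioc_subset_Icc_self)
    (Eventually.of_forall fun a => le_max_right _ _),
    ← intervalIntegral.integral_of_le (by norm_num)]
  rw [← intervalIntegral.integral_add_adjacent_intervals (b := 0) (hc.intervalIntegrable _ _)
    (hc.intervalIntegrable _ _)]
  have h2 : ∫ a in (-1 / 2 : ℝ)..0, max a 0 = ∫ _ in (-1 / 2 : ℝ)..0, (0 : ℝ) :=
    intervalIntegral.integral_congr fun a ha => by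
      rw [Set.uIcc_of_le (by norm_num)] at ha
      exact max_eq_right ha.2
  have h3 : ∫ a in (0 : ℝ)..(1 / 2), max a 0 = ∫ a in (0 : ℝ)..(1 / 2), a :=
    intervalIntegral.integral_congr fun a ha => by
      rw [Set.uIcc_of_le (by norm_num)] at ha
      exact max_eq_left ha.1
  rw [h2, h3, integral_id]
  simp only [intervalIntegral.integral_zero, ENNReal.ofReal]
  congr 1
  ext
  norm_num

theorem lintegral_circleRep_neg :
    ∫⁻ u : UnitAddCircle, ((-circleRep u).toNNReal : ℝ≥0∞) = ((1 / 8 : ℝ≥0) : ℝ≥0∞) := by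
  -- The endpoint 1/2 is discarded in order to make the interval symmetric under negation.
  rw [lintegral_circleRep fun a => ((-a).toNNReal : ℝ≥0∞), ← lintegral_circleRep_pos,
    lintegral_circleRep fun a => (a.toNNReal : ℝ≥0∞), ← restrict_Ioo_eq_restrict_Ioc,
    ← lintegral_indicator measurableSet_Ioo, ← lintegral_indicator measurableSet_Ioo,
    ← lintegral_neg_eq_self]
  refine lintegral_congr fun a => ?_
  by_cases ha : a ∈ Set.Ioo (-1 / 2 : ℝ) (1 / 2)
  · have ha' : -a ∈ Set.Ioo (-1 / 2 : ℝ) (1 / 2) := ⟨by linarith [ha.2], by linarith [ha.1]⟩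
    rw [Set.indicator_of_mem ha, Set.indicator_of_mem ha', neg_neg]
  · have ha' : -a ∉ Set.Ioo (-1 / 2 : ℝ) (1 / 2) := fun h =>
      ha ⟨by linarith [h.2], by linarith [h.1]⟩
    rw [Set.indicator_of_notMem ha, Set.indicator_of_notMem ha']

/-- The straight flows of strength `1 / 8` through all boundary points. -/
noncomputable def straightTrans (M : ℕ) : SqTrans M := fun p =>
  if p.2 = p.1.reflect then 1 / 8 else 0

/-- The isotropy of `Q₀` is witnessed by `ψ`. -/
structure IsIsotropicLaw (Q₀ : SqTrans M) (ψ : Measure (SqTrans M)) : Prop where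
  prob : IsProbabilityMeasure ψ
  compat : ∀ᵐ Q ∂ψ, Q ∈ compatible M
  mean : ∀ p, ∫⁻ Q, (Q p : ℝ≥0∞) ∂ψ = Q₀ p
  unif : ψ.map (fun Q => mod1 Q.drift) = (volume : Measure Torus2)

theorem isIsotropic_iff {Q₀ : SqTrans M} : IsIsotropic Q₀ ↔ ∃ ψ, IsIsotropicLaw Q₀ ψ :=
  ⟨fun ⟨ψ, h1, h2, h3, h4⟩ => ⟨ψ, h1, h2, h3, h4⟩, fun ⟨ψ, h1, h2, h3, h4⟩ => ⟨ψ, h1, h2, h3, h4⟩⟩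

theorem measurable_drift : Measurable (SqTrans.drift (M := M)) := by
  have h : ∀ p : SqBou M × SqBou M,
      Measurable fun Q : SqTrans M => (Q p : ℝ) • (p.2.pos - p.1.pos) := fun p =>
    (measurable_coe_nnreal_real.comp (measurable_pi_apply p)).smul_const _
  exact (Finset.measurable_sum Finset.univ fun p _ => h p).const_smul (((M : ℝ) ^ 2)⁻¹)

theorem measurableSet_compatible : MeasurableSet (compatible M) := by
  have : compatible M = ⋂ b : SqBou M,
      {Q : SqTrans M | ∑ b' with SqBou.reflect b' = b, Q.exi b' = Q.ent b} := by
    ext Q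
    simp [compatible]
  rw [this]
  refine MeasurableSet.iInter fun b => measurableSet_eq_fun ?_ ?_
  · unfold SqTrans.exi
    fun_prop
  · unfold SqTrans.ent
    fun_prop

theorem measurable_mod1 : Measurable mod1 :=
  (AddCircle.measurable_mk'.comp measurable_fst).prodMk
    (AddCircle.measurable_mk'.comp measurable_snd)

theorem measurable_mod1_drift : Measurable fun Q : SqTrans M => mod1 Q.drift :=
  measurable_mod1.comp measurable_drift

theorem measurable_apply (p : SqBou M × SqBou M) :
    Measurable fun Q : SqTrans M => (Q p : ℝ≥0∞) :=
  measurable_coe_nnreal_ennreal.comp (measurable_pi_apply p)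

instance : IsProbabilityMeasure (volume : Measure UnitAddCircle) :=
  ⟨UnitAddCircle.measure_univ⟩

instance : IsProbabilityMeasure (volume : Measure Torus2) :=
  inferInstanceAs (IsProbabilityMeasure ((volume : Measure UnitAddCircle).prod volume))

/-- Take the straight flow whose drift is the representative in (-1/2, 1/2]² of a uniform point u.
Its drift modulo (1,1) is u, and its mean has strength 1/8 in each of the four directions. -/
theorem isIsotropic_straightTrans (hM : 0 < M) : IsIsotropic (straightTrans M) := by
  have hm : Measurable fun u : Torus2 => straightOf M (circleRep u.1) (circleRep u.2) := by
    refine measurable_pi_lambda _ fun p => ?_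
    unfold straightOf
    split_ifs
    · have h1 := measurable_circleRep
      rcases p with ⟨⟨_ | _ | _ | _, k⟩, b⟩ <;> simp only [straightWeight] <;> fun_prop
    · exact measurable_const
  refine isIsotropic_iff.2 ⟨(volume : Measure Torus2).map
    fun u => straightOf M (circleRep u.1) (circleRep u.2),
    Measure.isProbabilityMeasure_map hm.aemeasurable, ?_, fun p => ?_, ?_⟩
  · refine (ae_map_iff (p := fun Q => Q ∈ compatible M) hm.aemeasurable
      measurableSet_compatible).2 ?_
    exact Eventually.of_forall fun u => straightOf_mem_compatible _ _
  · rw [lintegral_map (measurable_apply p) hm]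
    have hfst : ∀ h : UnitAddCircle → ℝ≥0∞, Measurable h →
        ∫⁻ u : Torus2, h u.1 = ∫⁻ x, h x := fun h hh =>
      (measurePreserving_fst (μ := (volume : Measure UnitAddCircle))
        (ν := (volume : Measure UnitAddCircle))).lintegral_comp hh
    have hsnd : ∀ h : UnitAddCircle → ℝ≥0∞, Measurable h →
        ∫⁻ u : Torus2, h u.2 = ∫⁻ x, h x := fun h hh =>
      (measurePreserving_snd (μ := (volume : Measure UnitAddCircle))
        (ν := (volume : Measure UnitAddCircle))).lintegral_comp hh
    have hp : Measurable fun x : UnitAddCircle => ((circleRep x).toNNReal : ℝ≥0∞) := by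
      have := measurable_circleRep
      fun_prop
    have hn : Measurable fun x : UnitAddCircle => ((-circleRep x).toNNReal : ℝ≥0∞) := by
      have := measurable_circleRep
      fun_prop
    simp only [straightOf, straightTrans]
    split_ifs with h
    · rcases p with ⟨⟨_ | _ | _ | _, k⟩, b⟩ <;> simp only [straightWeight]
      · exact (hfst _ hp).trans lintegral_circleRep_pos
      · exact (hfst _ hn).trans lintegral_circleRep_neg
      · exact (hsnd _ hp).trans lintegral_circleRep_pos
      · exact (hsnd _ hn).trans lintegral_circleRep_neg
    · simp
  · rw [Measure.map_map measurable_mod1_drift hm]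
    have : (fun Q : SqTrans M => mod1 Q.drift) ∘
        (fun u : Torus2 => straightOf M (circleRep u.1) (circleRep u.2)) = id := by
      funext u
      simp [drift_straightOf hM, mod1, coe_circleRep]
    rw [this, Measure.map_id]

theorem IsIsotropicLaw.mix {Q₀ Q₁ : SqTrans M} {ψ₀ ψ₁ : Measure (SqTrans M)}
    (h₀ : IsIsotropicLaw Q₀ ψ₀) (h₁ : IsIsotropicLaw Q₁ ψ₁) {a b : ℝ≥0} (hab : a + b = 1) :
    IsIsotropicLaw (fun p => a * Q₀ p + b * Q₁ p) (a • ψ₀ + b • ψ₁) := by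
  have := h₀.prob
  have := h₁.prob
  have hab' : (a : ℝ≥0∞) + b = 1 := by exact_mod_cast hab
  refine ⟨⟨?_⟩, ?_, fun p => ?_, ?_⟩
  · simp only [Measure.add_apply, Measure.smul_apply, measure_univ]
    simpa [ENNReal.smul_def] using hab'
  · rw [ae_add_measure_iff]
    exact ⟨Measure.ae_smul_measure h₀.compat _, Measure.ae_smul_measure h₁.compat _⟩
  · rw [lintegral_add_measure, lintegral_smul_measure, lintegral_smul_measure, h₀.mean, h₁.mean]
    simp [ENNReal.smul_def]
  · rw [Measure.map_add _ _ measurable_mod1_drift, Measure.map_smul,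
      Measure.map_smul, h₀.unif, h₁.unif, ← add_smul, hab, one_smul]

end Isotropy

/-! ## Bounds for costs -/

section Costs

variable {M : ℕ}

/-- An edge is used only by the two opposite straight flows of its row or column, at most once each,
hence 1/8 + 1/8. Pairs of ends that are not opposite have weight 0, so any crossing will do for
them. -/
theorem exists_straight_crossings (M : ℕ) : ∃ g : SqBou M × SqBou M → SqEdge M → ℝ≥0∞,
    (∀ p, Crosses p.1 p.2 (g p)) ∧
    (∀ e, crossingFlow (fun p => straightTrans M p) g e ≤ ((1 / 4 : ℝ≥0) : ℝ≥0∞)) ∧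
    ∃ L : ℝ≥0, ∀ p e, g p e ≤ L := by
  classical
  have : ∀ p : SqBou M × SqBou M, ∃ q : (sqGraph M).Walk (.inr p.1) (.inr p.2), 0 < q.length ∧
      (∀ b, q.count (.inr b) = SqBou.endCount p.1 p.2 b) ∧
      (p.2 = p.1.reflect → ∀ e, q.count (.inl e) ≤
        if e.1.1 = p.1.1.axis ∧ cross e.1.1 e.1.2 = p.1.2 then 1 else 0) := by
    rintro ⟨b₁, b₂⟩
    by_cases h : b₂ = b₁.reflect
    · subst h
      obtain ⟨q, h1, h2, h3⟩ := exists_straight b₁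
      exact ⟨q, h1, h2, fun _ => h3⟩
    · obtain ⟨q, h1, h2⟩ := exists_crossing_walk b₁ b₂
      exact ⟨q, h1, h2, fun h' => absurd h' h⟩
  choose q hq hq' hq'' using this
  have hcr : ∀ p, Crosses p.1 p.2 fun e => ((q p).count e : ℝ≥0∞) := fun p =>
    Crosses.of_walk (q p) (hq p) (hq' p)
  have h8 : ((1 / 8 : ℝ≥0) : ℝ≥0∞) + ((1 / 8 : ℝ≥0) : ℝ≥0∞) = ((1 / 4 : ℝ≥0) : ℝ≥0∞) := by
    rw [← ENNReal.coe_add]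
    congr 1
    ext
    norm_num
  refine ⟨fun p e => (q p).count e, hcr, fun e => ?_, ∑ p, ∑ e, ((q p).count e : ℝ≥0),
    fun p e => ?_⟩
  · rcases e with e | b
    · have h1 : crossingFlow (fun p => straightTrans M p) (fun p e => ((q p).count e : ℝ≥0∞))
          (.inl e) = ∑ b : SqBou M, ((1 / 8 : ℝ≥0) : ℝ≥0∞) *
            ((q (b, b.reflect)).count (.inl e) : ℝ≥0∞) := by
        refine (Fintype.sum_prod_type _).trans (Finset.sum_congr rfl fun b _ => ?_)
        rw [Finset.sum_eq_single b.reflect]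
        · simp [straightTrans]
        · intro b' _ hb'
          simp [straightTrans, hb']
        · simp
      have h2 : ∀ b : SqBou M, ((1 / 8 : ℝ≥0) : ℝ≥0∞) *
          ((q (b, b.reflect)).count (.inl e) : ℝ≥0∞) ≤
          if e.1.1 = b.1.axis ∧ cross e.1.1 e.1.2 = b.2 then ((1 / 8 : ℝ≥0) : ℝ≥0∞) else 0 := by
        intro b
        have h3 : ((q (b, b.reflect)).count (.inl e) : ℝ≥0∞) ≤
            ((if e.1.1 = b.1.axis ∧ cross e.1.1 e.1.2 = b.2 then 1 else 0 : ℕ) : ℝ≥0∞) :=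
          Nat.cast_le.2 (hq'' (b, b.reflect) rfl e)
        refine (mul_le_mul_right h3 _).trans ?_
        split_ifs <;> simp
      rw [h1, ← h8]
      refine (Finset.sum_le_sum fun b _ => h2 b).trans ?_
      rw [Fintype.sum_prod_type, Fintype.sum_side]
      rcases h : e.1.1 with _ | _ <;> simp [Side.axis]
    · rw [crossingFlow_inr hcr, ← h8]
      gcongr
      · rw [Finset.sum_eq_single b.reflect]
        · simp [straightTrans]
        · intro b' _ hb'
          simp [straightTrans, hb']
        · simp
      · rw [Finset.sum_eq_single b.reflect]
        · simp [straightTrans]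
        · intro b' _ hb'
          have : b ≠ b'.reflect := fun h => hb' (by rw [h, SqBou.reflect_reflect])
          simp [straightTrans, this]
        · simp
  · have h1 : ((q p).count e : ℝ≥0) ≤ ∑ p, ∑ e, ((q p).count e : ℝ≥0) :=
      (Finset.single_le_sum (f := fun e => ((q p).count e : ℝ≥0)) (fun _ _ => zero_le)
        (Finset.mem_univ e)).trans
        (Finset.single_le_sum (f := fun p => ∑ e, ((q p).count e : ℝ≥0))
          (fun _ _ => zero_le) (Finset.mem_univ p))
    change ((q p).count e : ℝ≥0∞) ≤ _
    exact_mod_cast h1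

theorem Crosses.mix {b₁ b₂ : SqBou M} {g₀ g₁ : SqEdge M → ℝ≥0∞} (h₀ : Crosses b₁ b₂ g₀)
    (h₁ : Crosses b₁ b₂ g₁) {a b : ℝ≥0} (hab : a + b = 1) :
    Crosses b₁ b₂ fun e => a * g₀ e + b * g₁ e := by
  obtain ⟨P₀, hP₀, hp₀, hg₀⟩ := h₀
  obtain ⟨P₁, hP₁, hp₁, hg₁⟩ := h₁
  have hab' : (a : ℝ≥0∞) + b = 1 := by exact_mod_cast hab
  refine ⟨a • P₀ + b • P₁, ⟨?_⟩, ?_, fun e => ?_⟩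
  · simp only [Measure.add_apply, Measure.smul_apply, measure_univ]
    simpa [ENNReal.smul_def] using hab'
  · rw [ae_add_measure_iff]
    exact ⟨Measure.ae_smul_measure hp₀ _, Measure.ae_smul_measure hp₁ _⟩
  · rw [lintegral_add_measure, lintegral_smul_measure, lintegral_smul_measure, hg₀, hg₁]
    simp [ENNReal.smul_def]

/-- Mixtures of crossings for mixtures of transports. -/
theorem exists_mixed_crossings {Q₀ Q₁ : SqTrans M} {g₀ g₁ : SqBou M × SqBou M → SqEdge M → ℝ≥0∞}
    (h₀ : ∀ p, Crosses p.1 p.2 (g₀ p)) (h₁ : ∀ p, Crosses p.1 p.2 (g₁ p)) {L₀ L₁ : ℝ≥0}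
    (hL₀ : ∀ p e, g₀ p e ≤ L₀) (hL₁ : ∀ p e, g₁ p e ≤ L₁) (a b : ℝ≥0) :
    ∃ g : SqBou M × SqBou M → SqEdge M → ℝ≥0∞, (∀ p, Crosses p.1 p.2 (g p)) ∧
      (∀ e, crossingFlow (fun p => ((a * Q₀ p + b * Q₁ p : ℝ≥0) : ℝ≥0∞)) g e =
        a * crossingFlow (fun p => Q₀ p) g₀ e + b * crossingFlow (fun p => Q₁ p) g₁ e) ∧
      ∀ p e, g p e ≤ (L₀ + L₁ : ℝ≥0) := by
  have : ∀ p : SqBou M × SqBou M, ∃ g : SqEdge M → ℝ≥0∞, Crosses p.1 p.2 g ∧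
      (∀ e, ((a * Q₀ p + b * Q₁ p : ℝ≥0) : ℝ≥0∞) * g e =
        a * (Q₀ p * g₀ p e) + b * (Q₁ p * g₁ p e)) ∧ ∀ e, g e ≤ (L₀ + L₁ : ℝ≥0) := by
    intro p
    have hle : ∀ e, g₀ p e ≤ (L₀ + L₁ : ℝ≥0) := fun e =>
      (hL₀ p e).trans (by exact_mod_cast le_add_of_nonneg_right zero_le)
    have hle' : ∀ e, g₁ p e ≤ (L₀ + L₁ : ℝ≥0) := fun e =>
      (hL₁ p e).trans (by exact_mod_cast le_add_of_nonneg_left zero_le)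
    by_cases hp : a * Q₀ p + b * Q₁ p = 0
    · refine ⟨g₀ p, h₀ p, fun e => ?_, hle⟩
      obtain ⟨h2, h3⟩ := add_eq_zero.1 hp
      rw [hp, ← mul_assoc, ← mul_assoc, ← ENNReal.coe_mul, ← ENNReal.coe_mul, h2, h3]
      simp
    · set T := a * Q₀ p + b * Q₁ p with hT
      have hab : a * Q₀ p / T + b * Q₁ p / T = 1 := by
        rw [← add_div, ← hT, div_self hp]
      -- The weights are the conditional probabilities of the two components, given the ends `p`.
      refine ⟨_, (h₀ p).mix (h₁ p) hab, fun e => ?_, fun e => ?_⟩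
      · rw [mul_add, ← mul_assoc, ← mul_assoc, ← ENNReal.coe_mul, ← ENNReal.coe_mul,
          mul_div_cancel₀ _ hp, mul_div_cancel₀ _ hp]
        push_cast
        ring
      · calc _ ≤ ((a * Q₀ p / T : ℝ≥0) : ℝ≥0∞) * (L₀ + L₁ : ℝ≥0) +
              ((b * Q₁ p / T : ℝ≥0) : ℝ≥0∞) * (L₀ + L₁ : ℝ≥0) :=
            add_le_add (mul_le_mul_right (hle e) _) (mul_le_mul_right (hle' e) _)
          _ = _ := by
            rw [← add_mul, ← ENNReal.coe_add, hab, ENNReal.coe_one, one_mul]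
  choose g hg hgm hgL using this
  refine ⟨g, hg, fun e => ?_, hgL⟩
  simp only [crossingFlow, hgm, Finset.sum_add_distrib, Finset.mul_sum]

theorem cost_mono {E : Type} [Fintype E] {f f' : E → ℝ≥0∞} (h : ∀ e, f e ≤ f' e) (c : E → ℝ≥0) :
    cost f c ≤ cost f' c :=
  Finset.sum_le_sum fun e _ => by
    have := h e
    gcongr

theorem cost_mono_right {E : Type} [Fintype E] (f : E → ℝ≥0∞) {c c' : E → ℝ≥0}
    (h : ∀ e, c e ≤ c' e) : cost f c ≤ cost f c' :=
  Finset.sum_le_sum fun e _ => by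
    have := h e
    gcongr

theorem cost_add_const_le {E : Type} [Fintype E] {f : E → ℝ≥0∞} {B : ℝ≥0} (hf : ∀ e, f e ≤ B)
    (x : ℝ≥0) (c : E → ℝ≥0) :
    cost (fun e => f e + x) c ≤ cost f c + (2 * B * x + x ^ 2 : ℝ≥0) * ∑ e, (c e : ℝ≥0∞) := by
  rw [cost, cost, Finset.mul_sum, ← Finset.sum_add_distrib]
  refine Finset.sum_le_sum fun e _ => ?_
  have h1 : (f e + x) ^ 2 ≤ f e ^ 2 + (2 * B * x + x ^ 2 : ℝ≥0) := by
    calc (f e + x) ^ 2 = f e ^ 2 + (2 * f e * x + x ^ 2) := by ring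
      _ ≤ f e ^ 2 + (2 * B * x + x ^ 2) := by have := hf e; gcongr
      _ = _ := by push_cast; ring
  calc (c e : ℝ≥0∞) * (f e + x) ^ 2 ≤ c e * (f e ^ 2 + (2 * B * x + x ^ 2 : ℝ≥0)) := by gcongr
    _ = _ := by ring

theorem cost_le_of_le {E : Type} [Fintype E] {f : E → ℝ≥0∞} {B : ℝ≥0} (hf : ∀ e, f e ≤ B)
    (c : E → ℝ≥0) : cost f c ≤ (B ^ 2 : ℝ≥0) * ∑ e, (c e : ℝ≥0∞) := by
  rw [cost, Finset.mul_sum]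
  refine Finset.sum_le_sum fun e _ => ?_
  rw [mul_comm]
  push_cast
  have := hf e
  gcongr

theorem lintegral_apply_sqEnvLaw {κ : Measure ℝ≥0} [IsProbabilityMeasure κ] (e : SqEdge M) :
    ∫⁻ c, (c e : ℝ≥0∞) ∂(sqEnvLaw M κ) = ∫⁻ x, (x : ℝ≥0∞) ∂(sqEdgeLaw κ e) :=
  (measurePreserving_eval (sqEdgeLaw κ) e).lintegral_comp (f := fun x : ℝ≥0 => (x : ℝ≥0∞))
    (by fun_prop)

instance (M : ℕ) (κ : Measure ℝ≥0) [IsProbabilityMeasure κ] :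
    IsProbabilityMeasure (sqEnvLaw M κ) :=
  inferInstanceAs (IsProbabilityMeasure (Measure.pi _))

theorem lintegral_sum_sqEnvLaw_le {κ : Measure ℝ≥0} [IsProbabilityMeasure κ] {cstar : ℝ≥0}
    (hκ : κ (Set.Iic cstar) = 1) :
    ∫⁻ c, ∑ e, (c e : ℝ≥0∞) ∂(sqEnvLaw M κ) ≤ (Fintype.card (SqEdge M) * cstar : ℝ≥0) := by
  have h1 : ∫⁻ x, (x : ℝ≥0∞) ∂κ ≤ cstar := by
    have h2 : ∀ᵐ x ∂κ, x ≤ cstar := (prob_compl_eq_zero_iff measurableSet_Iic).2 hκ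
    calc ∫⁻ x, (x : ℝ≥0∞) ∂κ ≤ ∫⁻ _, (cstar : ℝ≥0∞) ∂κ :=
          lintegral_mono_ae (h2.mono fun x hx => by exact_mod_cast hx)
      _ = cstar := by simp
  rw [lintegral_finsetSum _ fun e _ => by fun_prop]
  calc _ ≤ ∑ _ : SqEdge M, (cstar : ℝ≥0∞) := Finset.sum_le_sum fun e _ => by
        rw [lintegral_apply_sqEnvLaw, sqEdgeLaw_eq]
        split_ifs
        · exact h1
        · rw [lintegral_dirac]; simp
    _ = _ := by simp

theorem measurable_sum_apply : Measurable fun c : SqEdge M → ℝ≥0 => ∑ e, (c e : ℝ≥0∞) := by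
  fun_prop

/-- The crossings may depend arbitrarily on the environment: monotonicity of the lower integral
requires no measurability. -/
theorem cConst_le {B : ℝ≥0} {κ : Measure ℝ≥0} {Q : SqTrans M} (hQ : IsIsotropic Q)
    {g : (SqEdge M → ℝ≥0) → SqBou M × SqBou M → SqEdge M → ℝ≥0∞}
    (hg : ∀ c p, Crosses p.1 p.2 (g c p))
    (hB : ∀ c e, crossingFlow (fun p => Q p) (g c) e ≤ B) :
    cConst M B κ ≤ ∫⁻ c, cost (crossingFlow (fun p => Q p) (g c)) c ∂(sqEnvLaw M κ) :=
  (iInf₂_le Q hQ).trans (lintegral_mono fun c => minCost_le_cost_crossingFlow (hg c) (hB c) c)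

theorem cConst_ne_top (hM : 0 < M) {B : ℝ≥0} (hB : 1 / 4 < B) {κ : Measure ℝ≥0}
    [IsProbabilityMeasure κ] {cstar : ℝ≥0} (hκ : κ (Set.Iic cstar) = 1) :
    cConst M B κ ≠ ∞ := by
  obtain ⟨g, hg, hgB, -⟩ := exists_straight_crossings M
  have hle : ∀ e, crossingFlow (fun p => straightTrans M p) g e ≤ B := fun e =>
    (hgB e).trans (by exact_mod_cast hB.le)
  refine ((cConst_le (isIsotropic_straightTrans hM) (g := fun _ => g) (fun _ => hg)
    fun _ => hle).trans_lt ?_).ne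
  calc _ ≤ ∫⁻ c, (B ^ 2 : ℝ≥0) * ∑ e, (c e : ℝ≥0∞) ∂(sqEnvLaw M κ) :=
        lintegral_mono fun c => cost_le_of_le hle c
    _ = (B ^ 2 : ℝ≥0) * ∫⁻ c, ∑ e, (c e : ℝ≥0∞) ∂(sqEnvLaw M κ) :=
        lintegral_const_mul _ measurable_sum_apply
    _ ≤ (B ^ 2 : ℝ≥0) * (Fintype.card (SqEdge M) * cstar : ℝ≥0) := by
        gcongr; exact lintegral_sum_sqEnvLaw_le hκ
    _ < ∞ := ENNReal.mul_lt_top ENNReal.coe_lt_top ENNReal.coe_lt_top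

theorem exists_small (X δ : ℝ≥0) (hδ : 0 < δ) : ∃ b : ℝ≥0, 0 < b ∧ b ≤ 1 ∧ b * X ≤ δ := by
  refine ⟨min 1 (δ / (X + 1)), by positivity, min_le_left _ _, ?_⟩
  calc min 1 (δ / (X + 1)) * X ≤ δ / (X + 1) * (X + 1) := by
        gcongr
        · exact min_le_right _ _
        · exact le_add_of_nonneg_right zero_le
    _ = δ := div_mul_cancel₀ _ (by positivity)

/-- Measurable, nearly optimal flows for a given transport. -/
theorem exists_nearly_optimal_flow {B : ℝ≥0} {κ : Measure ℝ≥0} [IsProbabilityMeasure κ]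
    {Q : SqTrans M} (hQ : ∫⁻ c, minCost B Q c ∂(sqEnvLaw M κ) ≠ ∞) {δ : ℝ≥0} (hδ : 0 < δ) :
    ∃ cell : (SqEdge M → ℝ≥0) → (SqEdge M → ℕ), Measurable cell ∧
      ∃ μ : (SqEdge M → ℕ) → Measure (FinPath (sqGraph M)), (∀ k, IsAdmissible B Q (μ k)) ∧
        ∀ c, cost (flo (μ (cell c))) c ≤ minCost B Q c + δ := by
  -- Cost-factors are rounded down to multiples of a mesh `h`. With volumes at most `B` this changes
  -- any cost by at most `h * B ^ 2` per edge, in total at most `δ / 2`.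
  obtain ⟨h, hh, -, hhδ⟩ := exists_small (B ^ 2 * Fintype.card (SqEdge M)) (δ / 2) (by positivity)
  have hfin : ∃ c, minCost B Q c ≠ ∞ := by
    by_contra hc
    push Not at hc
    simp [hc] at hQ
  obtain ⟨c₀, hc₀⟩ := hfin
  obtain ⟨μ₀, hμ₀⟩ : ∃ μ, IsAdmissible B Q μ := by
    by_contra hc
    push Not at hc
    exact hc₀ (by simp [minCost, hc])
  -- Admissibility does not involve the environment, so one admissible flow gives finite cost
  -- everywhere.
  have hne : ∀ c, minCost B Q c ≠ ∞ := fun c => by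
    refine ((iInf₂_le μ₀ hμ₀).trans_lt ((cost_le_of_le hμ₀.flo_le c).trans_lt ?_)).ne
    exact ENNReal.mul_lt_top ENNReal.coe_lt_top (ENNReal.sum_lt_top.2 fun e _ => ENNReal.coe_lt_top)
  have hex : ∀ k : SqEdge M → ℕ, ∃ μ, IsAdmissible B Q μ ∧
      cost (flo μ) (fun e => k e * h) < minCost B Q (fun e => k e * h) + (δ / 2 : ℝ≥0) := by
    intro k
    have : minCost B Q (fun e => k e * h) < minCost B Q (fun e => k e * h) + (δ / 2 : ℝ≥0) :=
      ENNReal.lt_add_right (hne _) (by simpa using (half_pos hδ).ne')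
    conv_lhs at this => rw [minCost]
    simp only [iInf_lt_iff] at this
    obtain ⟨μ, hμ, h⟩ := this
    exact ⟨μ, hμ, h⟩
  choose μ hμ hμc using hex
  have hdiv : ∀ e, Measurable fun c : SqEdge M → ℝ≥0 => c e / h := fun e => by fun_prop
  refine ⟨fun c e => ⌊c e / h⌋₊, measurable_pi_lambda _ fun e =>
    Nat.measurable_floor.comp (hdiv e), μ, hμ, fun c => ?_⟩
  set k : SqEdge M → ℕ := fun e => ⌊c e / h⌋₊ with hk
  have h1 : ∀ e, k e * h ≤ c e := fun e => by
    have := Nat.floor_le (a := c e / h) zero_le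
    rwa [le_div_iff₀ hh] at this
  have h2 : ∀ e, c e ≤ k e * h + h := fun e => by
    have := (Nat.lt_floor_add_one (c e / h)).le
    rw [div_le_iff₀ hh] at this
    rwa [add_one_mul] at this
  have h3 : minCost B Q (fun e => k e * h) ≤ minCost B Q c :=
    iInf₂_mono fun μ _ => cost_mono_right _ h1
  have h4 : cost (flo (μ k)) c ≤ cost (flo (μ k)) (fun e => k e * h) + (δ / 2 : ℝ≥0) := by
    calc cost (flo (μ k)) c ≤ ∑ e, ((k e * h + h : ℝ≥0) : ℝ≥0∞) * flo (μ k) e ^ 2 :=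
          cost_mono_right _ h2
      _ = cost (flo (μ k)) (fun e => k e * h) + ∑ e, (h : ℝ≥0∞) * flo (μ k) e ^ 2 := by
          simp only [ENNReal.coe_add, add_mul, Finset.sum_add_distrib]
          rfl
      _ ≤ cost (flo (μ k)) (fun e => k e * h) + ∑ _ : SqEdge M, (h : ℝ≥0∞) * B ^ 2 := by
          gcongr with e
          exact (hμ k).flo_le e
      _ = cost (flo (μ k)) (fun e => k e * h) +
          ((h * (B ^ 2 * Fintype.card (SqEdge M)) : ℝ≥0) : ℝ≥0∞) := by
          congr 1
          simp only [Finset.sum_const, Finset.card_univ, nsmul_eq_mul]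
          push_cast
          ring
      _ ≤ _ := by gcongr
  calc cost (flo (μ k)) c ≤ minCost B Q c + (δ / 2 : ℝ≥0) + (δ / 2 : ℝ≥0) :=
        h4.trans (by gcongr; exact (hμc k).le.trans (by gcongr))
    _ = minCost B Q c + δ := by
        rw [add_assoc, ← ENNReal.coe_add, add_halves]

/-- Nearly optimal flows for an isotropic transport, with room for additional flow on all
edges. -/
theorem exists_nearly_optimal_crossings (hM : 0 < M) {B : ℝ≥0} (hB : 1 / 4 < B) {κ : Measure ℝ≥0}
    [IsProbabilityMeasure κ] {cstar : ℝ≥0} (hκ : κ (Set.Iic cstar) = 1) {δ : ℝ≥0} (hδ : 0 < δ) :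
    ∃ (Q : SqTrans M) (ψ : Measure (SqTrans M)), IsIsotropicLaw Q ψ ∧
      ∃ cell : (SqEdge M → ℝ≥0) → (SqEdge M → ℕ), Measurable cell ∧
      ∃ g : (SqEdge M → ℕ) → SqBou M × SqBou M → SqEdge M → ℝ≥0∞,
        (∀ k p, Crosses p.1 p.2 (g k p)) ∧ (∃ L : ℝ≥0, ∀ k p e, g k p e ≤ L) ∧
        (∃ η : ℝ≥0, 0 < η ∧ ∀ k e, crossingFlow (fun p => Q p) (g k) e + η ≤ B) ∧
        ∫⁻ c, cost (crossingFlow (fun p => Q p) (g (cell c))) c ∂(sqEnvLaw M κ) ≤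
          cConst M B κ + δ := by
  have hlt : cConst M B κ < cConst M B κ + (δ / 3 : ℝ≥0) :=
    ENNReal.lt_add_right (cConst_ne_top hM hB hκ)
      (by simpa using (div_pos hδ (by norm_num : (0 : ℝ≥0) < 3)).ne')
  conv_lhs at hlt => rw [cConst]
  simp only [iInf_lt_iff] at hlt
  obtain ⟨Q₀, hQ₀, hQ₀c⟩ := hlt
  obtain ⟨ψ₀, hψ₀⟩ := isIsotropic_iff.1 hQ₀
  obtain ⟨ψ₁, hψ₁⟩ := isIsotropic_iff.1 (isIsotropic_straightTrans hM)
  obtain ⟨cell, hcell, μ, hμ, hμc⟩ := exists_nearly_optimal_flow (Q := Q₀) hQ₀c.ne_top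
    (div_pos hδ (by norm_num : (0 : ℝ≥0) < 3))
  obtain ⟨L₀, hL₀⟩ := exists_crossings B Q₀
  choose g₀ hg₀ hg₀μ hg₀L using fun k => hL₀ (μ k) (hμ k)
  obtain ⟨g₁, hg₁, hg₁B, L₁, hg₁L⟩ := exists_straight_crossings M
  -- `b` is the weight of the straight flow in the mixture. It adds at most `b * B` to each volume,
  -- hence at most `3 * b * B ^ 2` times the sum of the cost-factors to the cost.
  obtain ⟨b, hb, hb1, hbδ⟩ := exists_small
    (3 * B ^ 2 * (Fintype.card (SqEdge M) * cstar)) (δ / 3) (div_pos hδ (by norm_num))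
  choose g hg hgf hgL using fun k =>
    exists_mixed_crossings (hg₀ k) hg₁ (hg₀L k) hg₁L (1 - b) b (Q₀ := Q₀) (Q₁ := straightTrans M)
  have hab : 1 - b + b = 1 := tsub_add_cancel_of_le hb1
  -- The room `η` solves (1 - b) B + b/4 + η = B.
  refine ⟨_, _, hψ₀.mix hψ₁ hab, cell, hcell, g, hg, ⟨_, hgL⟩, ⟨b * (B - 1 / 4),
    mul_pos hb (tsub_pos_of_lt hB), fun k e => ?_⟩, ?_⟩
  · rw [hgf]
    have h1 : crossingFlow (fun p => Q₀ p) (g₀ k) e ≤ B := (hg₀μ k e).trans ((hμ k).flo_le e)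
    calc _ ≤ ((1 - b : ℝ≥0) : ℝ≥0∞) * B + b * ((1 / 4 : ℝ≥0) : ℝ≥0∞) +
          (b * (B - 1 / 4) : ℝ≥0) := by
            gcongr
            exact hg₁B e
      _ = (((1 - b) * B + b * (1 / 4 + (B - 1 / 4)) : ℝ≥0) : ℝ≥0∞) := by push_cast; ring
      _ = B := by rw [add_tsub_cancel_of_le hB.le, ← add_mul, hab, one_mul]
  · have h1 : ∀ c, cost (crossingFlow (fun p => ((1 - b) * Q₀ p + b * straightTrans M p : ℝ≥0))
        (g (cell c))) c ≤ minCost B Q₀ c +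
        ((δ / 3 : ℝ≥0) + (b * (3 * B ^ 2) : ℝ≥0) * ∑ e, (c e : ℝ≥0∞)) := by
      intro c
      have h2 : ∀ e, crossingFlow (fun p => ((1 - b) * Q₀ p + b * straightTrans M p : ℝ≥0))
          (g (cell c)) e ≤ flo (μ (cell c)) e + (b * B : ℝ≥0) := fun e => by
        rw [hgf]
        refine add_le_add ?_ ?_
        · calc _ ≤ (1 : ℝ≥0∞) * crossingFlow (fun p => Q₀ p) (g₀ (cell c)) e := by
                gcongr
                exact_mod_cast tsub_le_self
            _ ≤ _ := by rw [one_mul]; exact hg₀μ _ e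
        · rw [ENNReal.coe_mul]
          gcongr
          exact (hg₁B e).trans (by exact_mod_cast hB.le)
      refine (cost_mono h2 c).trans ((cost_add_const_le (hμ _).flo_le _ c).trans ?_)
      rw [← add_assoc]
      refine add_le_add (hμc c) (mul_le_mul_left ?_ _)
      refine ENNReal.coe_le_coe.2 ?_
      calc 2 * B * (b * B) + (b * B) ^ 2 = 2 * b * B ^ 2 + b * b * B ^ 2 := by ring
        _ ≤ 2 * b * B ^ 2 + 1 * b * B ^ 2 := by gcongr
        _ = _ := by ring
    have hm : Measurable fun c : SqEdge M → ℝ≥0 =>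
        ((δ / 3 : ℝ≥0) : ℝ≥0∞) + (b * (3 * B ^ 2) : ℝ≥0) * ∑ e, (c e : ℝ≥0∞) :=
      measurable_const.add (measurable_sum_apply.const_mul _)
    refine (lintegral_mono h1).trans ?_
    rw [lintegral_add_right _ hm, lintegral_add_left measurable_const,
      lintegral_const_mul _ measurable_sum_apply]
    simp only [lintegral_const, measure_univ, mul_one]
    have h3 : ((b * (3 * B ^ 2) : ℝ≥0) : ℝ≥0∞) * ∫⁻ c, ∑ e, (c e : ℝ≥0∞) ∂(sqEnvLaw M κ) ≤
        (δ / 3 : ℝ≥0) := by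
      calc _ ≤ ((b * (3 * B ^ 2) : ℝ≥0) : ℝ≥0∞) * (Fintype.card (SqEdge M) * cstar : ℝ≥0) := by
            gcongr; exact lintegral_sum_sqEnvLaw_le hκ
        _ ≤ _ := by
            rw [← ENNReal.coe_mul]
            refine ENNReal.coe_le_coe.2 (le_trans (le_of_eq ?_) hbδ)
            ring
    calc _ ≤ cConst M B κ + (δ / 3 : ℝ≥0) + ((δ / 3 : ℝ≥0) + (δ / 3 : ℝ≥0)) := by
          gcongr
      _ = cConst M B κ + ((δ / 3 + (δ / 3 + δ / 3) : ℝ≥0) : ℝ≥0∞) := by push_cast; ring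
      _ = _ := by
          congr 2
          ext
          push_cast
          ring

end Costs

/-! ## Positivity of the minimal cost -/

section Positivity

variable {M : ℕ}

/-- Pruning does not increase volumes, and a pruned flow uses a half-edge exactly as often as paths
enter or leave there. -/
theorem IsAdmissible.le_flo {B : ℝ≥0} {Q : SqTrans M} {μ : Measure (FinPath (sqGraph M))}
    (h : IsAdmissible B Q μ) (b : SqBou M) :
    ∑ y, (Q (b, y) : ℝ≥0∞) + ∑ x, (Q (x, b) : ℝ≥0∞) ≤ flo μ (.inr b) := by
  obtain ⟨L, hL⟩ := exists_crossings B Q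
  obtain ⟨g, hg, hgμ, -⟩ := hL μ h
  have := hgμ (.inr b)
  rwa [crossingFlow_inr hg] at this

/-- The flow through the boundary point `(-1/2, j)`. -/
noncomputable def leftFlow (Q : SqTrans M) (j : Fin M) : ℝ≥0∞ :=
  ∑ y, (Q ((.left, j), y) : ℝ≥0∞) + ∑ x, (Q (x, (.left, j)) : ℝ≥0∞)

theorem UnitAddCircle.norm_coe_le (x : ℝ) : ‖(x : UnitAddCircle)‖ ≤ |x| := by
  rw [UnitAddCircle.norm_eq]
  simpa using round_le x 0

/-- Horizontal drift comes from exits on the left and on the right, and by compatibility the latter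
match the entrances on the left. So the flow through the left side alone bounds it. -/
theorem enorm_drift_le {Q : SqTrans M} (hM : 0 < M) (hQ : Q ∈ compatible M) :
    ‖(mod1 Q.drift).1‖ₑ ≤ ∑ j, leftFlow Q j := by
  have hb := balanced_of_compatible hQ
  have h1 : |Q.drift.1| ≤ ∑ p : SqBou M × SqBou M, (Q p : ℝ) * |(p.2.1.dir ℝ).1| := by
    rw [drift_eq hQ, Prod.smul_fst, Prod.fst_sum, smul_eq_mul, abs_mul]
    have hM' : |(M : ℝ)⁻¹| ≤ 1 := by
      rw [abs_of_nonneg (by positivity)]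
      exact inv_le_one_of_one_le₀ (by exact_mod_cast hM)
    refine (mul_le_of_le_one_left (abs_nonneg _) hM').trans ?_
    refine (Finset.abs_sum_le_sum_abs _ _).trans (Finset.sum_le_sum fun p _ => ?_)
    simp [abs_mul]
  have h2 : ∑ p : SqBou M × SqBou M, (Q p : ℝ) * |(p.2.1.dir ℝ).1| =
      ((∑ j : Fin M, (∑ y, Q ((.left, j), y) + ∑ x, Q (x, (.left, j))) : ℝ≥0) : ℝ) := by
    have e0 : ∑ p : SqBou M × SqBou M, (Q p : ℝ) * |(p.2.1.dir ℝ).1| =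
        ∑ y : SqBou M, ∑ x : SqBou M, (Q (x, y) : ℝ) * |(y.1.dir ℝ).1| :=
      Fintype.sum_prod_type_right _
    have e1 : ∀ j : Fin M, ∑ y, (Q ((.left, j), y) : ℝ) = ∑ x, (Q (x, (.right, j)) : ℝ) :=
      fun j => by exact_mod_cast hb (.left, j)
    rw [e0, Fintype.sum_prod_type, Fintype.sum_side]
    push_cast
    simp only [e1, Finset.sum_add_distrib]
    simp [Side.dir, add_comm]
  have h3 : ∑ j, leftFlow Q j =
      ((∑ j : Fin M, (∑ y, Q ((.left, j), y) + ∑ x, Q (x, (.left, j))) : ℝ≥0) : ℝ≥0∞) := by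
    simp [leftFlow]
  rw [h3, ← ofReal_norm, ← ENNReal.ofReal_coe_nnreal]
  refine ENNReal.ofReal_le_ofReal ?_
  rw [← h2]
  exact (UnitAddCircle.norm_coe_le _).trans h1

theorem lintegral_enorm_circle_ne_zero : ∫⁻ u : UnitAddCircle, ‖u‖ₑ ≠ 0 := by
  have hc : Continuous fun u : UnitAddCircle => ‖u‖ₑ := continuous_enorm
  intro h
  rw [lintegral_eq_zero_iff hc.measurable] at h
  have h1 : (fun u : UnitAddCircle => ‖u‖ₑ) = 0 :=
    Continuous.ae_eq_iff_eq (volume : Measure UnitAddCircle) hc continuous_const |>.1 h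
  have h2 := congrFun h1 ((1 / 2 : ℝ) : UnitAddCircle)
  simp only [Pi.zero_apply, enorm_eq_zero] at h2
  have h3 : ‖((1 / 2 : ℝ) : UnitAddCircle)‖ = |(1 : ℝ)| / 2 := AddCircle.norm_half_period_eq 1
  rw [h2] at h3
  norm_num at h3

/-- Average the previous bound over `ψ`: the drift being uniform, the left side of the inequality
becomes a positive constant independent of `Q₀`. -/
theorem IsIsotropicLaw.le_sum_leftFlow (hM : 0 < M) {Q₀ : SqTrans M} {ψ : Measure (SqTrans M)}
    (h : IsIsotropicLaw Q₀ ψ) : ∫⁻ u : UnitAddCircle, ‖u‖ₑ ≤ ∑ j, leftFlow Q₀ j := by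
  have hn : Measurable fun u : UnitAddCircle => ‖u‖ₑ := continuous_enorm.measurable
  have h1 : ∫⁻ Q, ∑ j, leftFlow Q j ∂ψ = ∑ j, leftFlow Q₀ j := by
    have hm : ∀ p, Measurable fun Q : SqTrans M => (Q p : ℝ≥0∞) := measurable_apply
    have hm1 : ∀ j : Fin M, Measurable fun Q : SqTrans M => ∑ y, (Q ((.left, j), y) : ℝ≥0∞) :=
      fun j => Finset.measurable_sum _ fun y _ => hm _
    have hm2 : ∀ j : Fin M, Measurable fun Q : SqTrans M => ∑ x, (Q (x, (.left, j)) : ℝ≥0∞) :=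
      fun j => Finset.measurable_sum _ fun y _ => hm _
    simp only [leftFlow]
    rw [lintegral_finsetSum]
    swap
    · exact fun j _ => (hm1 j).add (hm2 j)
    refine Finset.sum_congr rfl fun j _ => ?_
    rw [lintegral_add_left (hm1 j), lintegral_finsetSum _ fun y _ => hm _,
      lintegral_finsetSum _ fun y _ => hm _]
    simp only [h.mean]
  rw [← h1]
  calc ∫⁻ u : UnitAddCircle, ‖u‖ₑ = ∫⁻ u : Torus2, ‖u.1‖ₑ :=
        ((measurePreserving_fst (μ := (volume : Measure UnitAddCircle))
          (ν := (volume : Measure UnitAddCircle))).lintegral_comp hn).symm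
    _ = ∫⁻ Q, ‖(mod1 Q.drift).1‖ₑ ∂ψ := by
        rw [← h.unif]
        exact lintegral_map (hn.comp measurable_fst) measurable_mod1_drift
    _ ≤ _ := lintegral_mono_ae (h.compat.mono fun Q hQ => enorm_drift_le hM hQ)

/-- Every isotropic transport sends at least `r / M` through one of the M left half-edges, whose
cost-factor has law `κ`. The half-edge may depend on `Q`, the resulting lower bound does not. -/
theorem cConst_ne_zero (hM : 0 < M) {B : ℝ≥0} {κ : Measure ℝ≥0} [IsProbabilityMeasure κ]
    (hκ : ∫⁻ x, (x : ℝ≥0∞) ∂κ ≠ 0) : cConst M B κ ≠ 0 := by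
  set r : ℝ≥0∞ := ∫⁻ u : UnitAddCircle, ‖u‖ₑ with hr
  have hr0 : r / M ≠ 0 := ENNReal.div_ne_zero.2 ⟨lintegral_enorm_circle_ne_zero, by simp⟩
  have key : (∫⁻ x, (x : ℝ≥0∞) ∂κ) * (r / M) ^ 2 ≤ cConst M B κ := by
    refine le_iInf₂ fun Q hQ => ?_
    obtain ⟨ψ, hψ⟩ := isIsotropic_iff.1 hQ
    obtain ⟨j, hj⟩ : ∃ j, r / M ≤ leftFlow Q j := by
      by_contra hc
      push Not at hc
      have h1 : ∑ j, leftFlow Q j < ∑ _ : Fin M, r / M :=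
        ENNReal.sum_lt_sum_of_nonempty ⟨⟨0, hM⟩, Finset.mem_univ _⟩ fun j _ => hc j
      have h2 : ∑ _ : Fin M, r / M = r := by
        simp only [Finset.sum_const, Finset.card_univ, Fintype.card_fin, nsmul_eq_mul]
        exact ENNReal.mul_div_cancel (by simpa using hM.ne') (by simp)
      rw [h2] at h1
      exact absurd (hψ.le_sum_leftFlow hM) (not_le.2 h1)
    have h1 : ∀ c, (c (.inr (.left, j)) : ℝ≥0∞) * (r / M) ^ 2 ≤ minCost B Q c := by
      intro c
      refine le_iInf₂ fun μ hμ => ?_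
      calc (c (.inr (.left, j)) : ℝ≥0∞) * (r / M) ^ 2 ≤
            (c (.inr (.left, j)) : ℝ≥0∞) * flo μ (.inr (.left, j)) ^ 2 := by
            gcongr
            exact hj.trans (hμ.le_flo _)
        _ ≤ cost (flo μ) c := Finset.single_le_sum
            (f := fun e => (c e : ℝ≥0∞) * flo μ e ^ 2) (fun _ _ => zero_le) (Finset.mem_univ _)
    calc (∫⁻ x, (x : ℝ≥0∞) ∂κ) * (r / M) ^ 2 =
          ∫⁻ c, (c (.inr (.left, j)) : ℝ≥0∞) * (r / M) ^ 2 ∂(sqEnvLaw M κ) := by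
          rw [lintegral_mul_const _ (by fun_prop), lintegral_apply_sqEnvLaw]
          rfl
      _ ≤ _ := lintegral_mono h1
  exact fun h => mul_ne_zero hκ (pow_ne_zero 2 hr0) (le_antisymm (key.trans h.le) zero_le)

end Positivity

/-! ## Flows on the torus with exact cost -/

section Exact

variable {m M : ℕ}

/-- A transportation measure on the torus that is realized by flows with exact mean cost. -/
def HasExactFlow (κ : Measure ℝ≥0) (B : ℝ≥0) {N M : ℕ} (h : M ∣ N)
    (θ : FiniteMeasure (TorusBou N M × TorusBou N M)) : Prop :=
  IsBalanced h θ ∧ ∃ (μ : Kernel (TorusEdge N → ℝ≥0) (FinPath (splitGraph N M)))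
    (f : (TorusEdge N → ℝ≥0) → TorusEdge N → ℝ≥0∞),
    (∀ c, IsFiniteMeasure (μ c) ∧ IsTorusFlow (μ c) (f c)) ∧ (∀ c e, f c e ≤ B) ∧
    ∫⁻ c, cost (f c) c ∂(torusEnvLaw N κ) = ((N : ℝ≥0∞) / M) ^ 2 * cConst M B κ ∧
    ∀ c, tra (μ c) = asVertexMeasure θ

/-- The word that stays at `x₀`. -/
def Word.stay (x₀ : SqBou M) : Word M := (x₀, [])

/-- Random words that stay at their first state with probability `t`. -/
noncomputable def lazyLaw (x₀ : SqBou M) (t : ℝ≥0) (lam : Measure (Word M)) : Measure (Word M) :=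
  (1 - t) • lam + t • Measure.dirac (Word.stay x₀)

theorem isProbabilityMeasure_lazyLaw (x₀ : SqBou M) {t : ℝ≥0} (ht : t ≤ 1) (lam : Measure (Word M))
    [IsProbabilityMeasure lam] : IsProbabilityMeasure (lazyLaw x₀ t lam) := ⟨by
  have h : ((1 - t : ℝ≥0) : ℝ≥0∞) + t = 1 := by
    rw [← ENNReal.coe_add, tsub_add_cancel_of_le ht, ENNReal.coe_one]
  simp only [lazyLaw, Measure.add_apply, Measure.smul_apply, measure_univ]
  simpa [ENNReal.smul_def] using h⟩

theorem closed_lazyLaw (x₀ : SqBou M) (t : ℝ≥0) {lam : Measure (Word M)}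
    (h : ∀ᵐ w ∂lam, w.Closed) : ∀ᵐ w ∂(lazyLaw x₀ t lam), w.Closed := by
  rw [lazyLaw, ae_add_measure_iff]
  refine ⟨Measure.ae_smul_measure h _, Measure.ae_smul_measure ?_ _⟩
  rw [ae_dirac_eq]
  exact rfl

theorem wordTrans_lazyLaw (x₀ : SqBou M) (t : ℝ≥0) (lam : Measure (Word M)) :
    wordTrans m (lazyLaw x₀ t lam) = fun p => ((1 - t : ℝ≥0) : ℝ≥0∞) * wordTrans m lam p := by
  funext p
  simp only [wordTrans, lazyLaw]
  rw [lintegral_add_measure, lintegral_smul_measure, lintegral_smul_measure, lintegral_dirac]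
  have : (Word.stay x₀).usage p = 0 := rfl
  rw [this, ENNReal.smul_def, smul_eq_mul]
  simp only [Nat.cast_zero, smul_zero, add_zero]
  ring

theorem crossingFlow_mul (a : ℝ≥0∞) (Q : SqBou M × SqBou M → ℝ≥0∞)
    (g : SqBou M × SqBou M → SqEdge M → ℝ≥0∞) (e : SqEdge M) :
    crossingFlow (fun p => a * Q p) g e = a * crossingFlow Q g e := by
  simp only [crossingFlow, Finset.mul_sum, mul_assoc]

theorem crossingFlow_mono {Q Q' : SqBou M × SqBou M → ℝ≥0∞} (h : ∀ p, Q p ≤ Q' p)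
    (g : SqBou M × SqBou M → SqEdge M → ℝ≥0∞) (e : SqEdge M) :
    crossingFlow Q g e ≤ crossingFlow Q' g e :=
  Finset.sum_le_sum fun p _ => mul_le_mul_left (h p) _

/-- The solution is t = 1 - √(c/A); the hypothesis on `t₀` says that this is at most `t₀`. -/
theorem exists_scaling {A c : ℝ≥0} (hcA : c ≤ A) {t₀ : ℝ≥0} (ht₀ : (1 - t₀) ^ 2 * A ≤ c) :
    ∃ t ≤ 1, t ≤ t₀ ∧ (1 - t) ^ 2 * A = c := by
  rcases eq_or_ne A 0 with rfl | hA
  · exact ⟨0, zero_le, zero_le, by simpa using (le_antisymm hcA zero_le).symm⟩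
  · have hs : NNReal.sqrt (c / A) ≤ 1 := by
      rw [NNReal.sqrt_le_one]
      exact div_le_one_of_le₀ hcA zero_le
    have hs2 : NNReal.sqrt (c / A) ^ 2 * A = c := by
      rw [NNReal.sq_sqrt, div_mul_cancel₀ _ hA]
    refine ⟨1 - NNReal.sqrt (c / A), tsub_le_self, ?_, ?_⟩
    · rw [tsub_le_iff_tsub_le]
      refine NNReal.le_sqrt_iff_sq_le.2 ?_
      rwa [le_div_iff₀ (pos_iff_ne_zero.2 hA)]
    · rw [tsub_tsub_cancel_of_le hs, hs2]

variable [NeZero m]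

/-- If random words yield flows at least as costly as required, then a suitable lazy version yields
exactly the required cost. -/
theorem exists_exactFlow (h : M ∣ m * M) (x₀ : SqBou M) {κ : Measure ℝ≥0} [IsProbabilityMeasure κ]
    {cstar : ℝ≥0} (hκ : κ (Set.Iic cstar) = 1) {B : ℝ≥0}
    (lam : Measure (Word M)) [IsProbabilityMeasure lam] (hcl : ∀ᵐ w ∂lam, w.Closed)
    {ι : Type} [Countable ι] [MeasurableSpace ι] [DiscreteMeasurableSpace ι]
    {cell : (SqEdge M → ℝ≥0) → ι} (hcell : Measurable cell)
    {g : ι → SqBou M × SqBou M → SqEdge M → ℝ≥0∞} (hg : ∀ i p, Crosses p.1 p.2 (g i p))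
    (hB : ∀ i e, crossingFlow (wordTrans m lam) (g i) e ≤ B)
    {Q : SqTrans M} (hQ : IsIsotropic Q) (hQl : ∀ p, Q p ≤ wordTrans m lam p) {t₀ : ℝ≥0}
    (ht₀ : ((1 - t₀) ^ 2 : ℝ≥0) * ∫⁻ c, cost (crossingFlow (wordTrans m lam) (g (cell c))) c
      ∂(sqEnvLaw M κ) ≤ cConst M B κ) :
    ∃ t ≤ 1, t ≤ t₀ ∧ ∀ θ : FiniteMeasure (TorusBou (m * M) M × TorusBou (m * M) M),
      (θ : Measure _) = endsMeasure m (lazyLaw x₀ t lam) → HasExactFlow κ B h θ := by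
  set A := ∫⁻ c, cost (crossingFlow (wordTrans m lam) (g (cell c))) c ∂(sqEnvLaw M κ) with hA
  have hM : 0 < M := x₀.2.pos
  have hQg := fun i e => crossingFlow_mono hQl (g i) e
  -- The word transport dominates the isotropic `Q`, and the same crossings carry `Q` within the
  -- bound `B`, so the cost cannot fall below the infimum.
  have hcA : cConst M B κ ≤ A :=
    (cConst_le hQ (g := fun c => g (cell c)) (fun c => hg _)
      fun c e => (hQg _ e).trans (hB _ e)).trans
      (lintegral_mono fun c => cost_mono (hQg _) c)
  have hAtop : A ≠ ∞ := by
    refine (lt_of_le_of_lt (lintegral_mono fun c => cost_le_of_le (hB _) c) ?_).ne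
    rw [lintegral_const_mul _ measurable_sum_apply]
    exact ENNReal.mul_lt_top ENNReal.coe_lt_top
      ((lintegral_sum_sqEnvLaw_le hκ).trans_lt ENNReal.coe_lt_top)
  have hctop : cConst M B κ ≠ ∞ := ne_top_of_le_ne_top hAtop hcA
  obtain ⟨t, ht1, htt, ht⟩ := exists_scaling (A := A.toNNReal) (c := (cConst M B κ).toNNReal)
    (ENNReal.toNNReal_mono hAtop hcA) (t₀ := t₀) (by
      rw [← ENNReal.coe_le_coe, ENNReal.coe_mul, ENNReal.coe_toNNReal hAtop,
        ENNReal.coe_toNNReal hctop]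
      exact ht₀)
  have ht' : ((1 - t : ℝ≥0) : ℝ≥0∞) ^ 2 * A = cConst M B κ := by
    rw [← ENNReal.coe_toNNReal hAtop, ← ENNReal.coe_toNNReal hctop, ← ht]
    push_cast
    rfl
  refine ⟨t, ht1, htt, fun θ hθ => ?_⟩
  have := isProbabilityMeasure_lazyLaw x₀ ht1 lam
  obtain rfl : θ = ⟨endsMeasure m (lazyLaw x₀ t lam), inferInstance⟩ := Subtype.ext hθ
  have hcl' := closed_lazyLaw x₀ t hcl
  have hfl : ∀ i e, crossingFlow (wordTrans m (lazyLaw x₀ t lam)) (g i) e =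
      ((1 - t : ℝ≥0) : ℝ≥0∞) * crossingFlow (wordTrans m lam) (g i) e := fun i e => by
    rw [wordTrans_lazyLaw, crossingFlow_mul]
  have hle : ((1 - t : ℝ≥0) : ℝ≥0∞) ≤ 1 := by exact_mod_cast tsub_le_self
  obtain ⟨μ, f, h1, h2, h3, h4⟩ := exists_torus_flow κ (lazyLaw x₀ t lam) hcl' hcell hg (B := B)
    fun i e => by
      rw [hfl]
      exact (mul_le_of_le_one_left zero_le hle).trans (hB i e)
  refine ⟨isBalanced_endsMeasure h _ hcl', μ, f, h1, h2, h3.trans ?_, h4⟩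
  have hNM : (((m * M : ℕ) : ℝ≥0∞) / M) = m := by
    push_cast
    exact ENNReal.mul_div_cancel_right (by simpa using hM.ne') (by simp)
  rw [hNM, ← ht', hA]
  congr 1
  rw [← lintegral_const_mul' _ _ (ENNReal.pow_ne_top ENNReal.coe_ne_top)]
  refine lintegral_congr fun c => ?_
  simp only [cost, hfl, Finset.mul_sum]
  refine Finset.sum_congr rfl fun e _ => ?_
  ring

end Exact

/-! ## Rescaling of the torus -/

section Rescale

theorem mod1_add (x y : ℝ × ℝ) : mod1 (x + y) = mod1 x + mod1 y := rfl

theorem mod1_sub (x y : ℝ × ℝ) : mod1 (x - y) = mod1 x - mod1 y := rfl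

theorem norm_mod1_le (x : ℝ × ℝ) : ‖mod1 x‖ ≤ ‖x‖ :=
  max_le_max (UnitAddCircle.norm_coe_le x.1) (UnitAddCircle.norm_coe_le x.2)

variable {m M : ℕ}

theorem norm_scaled_pos_le (x : SqBou M) :
    ‖mod1 (((m * M : ℕ) : ℝ)⁻¹ • x.pos)‖ ≤ (m : ℝ)⁻¹ := by
  have hM0 : 0 < M := x.2.pos
  have hM : (M : ℝ) ≠ 0 := by exact_mod_cast hM0.ne'
  have hpos : ‖x.pos‖ ≤ M := by
    have h1 : (1 : ℝ) ≤ M := by exact_mod_cast hM0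
    have h2 : ∀ k : Fin M, |((k : ℕ) : ℝ)| ≤ M := fun k => by
      rw [Nat.abs_cast]
      exact_mod_cast k.2.le
    have h3 : |(-1 / 2 : ℝ)| ≤ M := by rw [abs_of_nonpos (by norm_num)]; linarith
    have h4 : |(M - 1 / 2 : ℝ)| ≤ M := by rw [abs_of_nonneg (by linarith)]; linarith
    rcases x with ⟨_ | _ | _ | _, k⟩
    · exact max_le h3 (h2 k)
    · exact max_le h4 (h2 k)
    · exact max_le (h2 k) h3
    · exact max_le (h2 k) h4
  calc ‖mod1 (((m * M : ℕ) : ℝ)⁻¹ • x.pos)‖ ≤ ‖((m * M : ℕ) : ℝ)⁻¹ • x.pos‖ := norm_mod1_le _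
    _ = ((m * M : ℕ) : ℝ)⁻¹ * ‖x.pos‖ := by
        rw [norm_smul, norm_inv, Real.norm_natCast]
    _ ≤ ((m * M : ℕ) : ℝ)⁻¹ * M := by gcongr
    _ = (m : ℝ)⁻¹ := by push_cast; field_simp

variable [NeZero m]

/-- The corner of a square in the continuous torus. -/
noncomputable def sqPt (s : Sq m) : Torus2 := (ZMod.toAddCircle s.1, ZMod.toAddCircle s.2)

theorem sqPt_add (s s' : Sq m) : sqPt (s + s') = sqPt s + sqPt s' := by
  simp [sqPt, map_add]

theorem exists_norm_sub_sqPt_le (u : Torus2) : ∃ s : Sq m, ‖u - sqPt s‖ ≤ (m : ℝ)⁻¹ := by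
  have hm : (0 : ℝ) < m := by exact_mod_cast Nat.pos_of_ne_zero (NeZero.ne m)
  have key : ∀ v : UnitAddCircle, ∃ i : ZMod m, ‖v - ZMod.toAddCircle i‖ ≤ (m : ℝ)⁻¹ := by
    intro v
    obtain ⟨x, rfl⟩ := QuotientAddGroup.mk_surjective v
    refine ⟨((⌊x * m⌋ : ℤ) : ZMod m), ?_⟩
    rw [ZMod.toAddCircle_intCast]
    refine (UnitAddCircle.norm_coe_le (x - (⌊x * m⌋ : ℝ) / m)).trans ?_
    have h1 := Int.floor_le (x * m)
    have h2 := (Int.lt_floor_add_one (x * m)).le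
    have h3 : x - (⌊x * m⌋ : ℝ) / m = (x * m - ⌊x * m⌋) * (m : ℝ)⁻¹ := by field_simp
    rw [h3, abs_of_nonneg (mul_nonneg (by linarith) (by positivity))]
    exact mul_le_of_le_one_left (by positivity) (by linarith)
  obtain ⟨i, hi⟩ := key u.1
  obtain ⟨j, hj⟩ := key u.2
  exact ⟨(i, j), max_le hi hj⟩

theorem toAddCircle_one : ZMod.toAddCircle (1 : ZMod m) = (((m : ℝ)⁻¹ : ℝ) : UnitAddCircle) := by
  have := ZMod.toAddCircle_natCast (N := m) 1
  simpa using this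

theorem sqPt_dir (d : Side) : sqPt (d.dir (ZMod m)) = mod1 ((m : ℝ)⁻¹ • d.dir ℝ) := by
  cases d <;> simp [sqPt, Side.dir, mod1, toAddCircle_one]

theorem sqPt_displacement (l : List (SqBou M)) :
    sqPt (displacement (ZMod m) l) = mod1 ((m : ℝ)⁻¹ • displacement ℝ l) := by
  induction l with
  | nil => simp [displacement, sqPt, mod1]
  | cons b l ih =>
    simp only [displacement, List.map_cons, List.sum_cons] at ih ⊢
    rw [sqPt_add, ih, sqPt_dir, smul_add, mod1_add]

theorem scaled_bouAt (s : Sq m) (x : SqBou M) :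
    (bouAt s x).scaled = sqPt s + mod1 (((m * M : ℕ) : ℝ)⁻¹ • x.pos) := by
  have hm : (m : ℝ) ≠ 0 := by exact_mod_cast NeZero.ne m
  have hM : (M : ℝ) ≠ 0 := by exact_mod_cast x.2.pos.ne'
  have h1 : ∀ k : Fin M, ((lastOf k : ℕ) : ℝ) = M - 1 := fun k => by
    have := lastOf_add_one k
    rw [eq_sub_iff_add_eq]
    exact_mod_cast this
  have key : ∀ (i : ZMod m) (y : ℝ), ((((i.val * M : ℕ) : ℝ) + y) / (m * M : ℕ) : ℝ) =
      (i.val : ℝ) / m + ((m * M : ℕ) : ℝ)⁻¹ * y := fun i y => by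
    push_cast
    field_simp
  have key' : ∀ (i : ZMod m) (y : ℝ), (((((i.val * M : ℕ) : ℝ) + y) / (m * M : ℕ) : ℝ) :
      UnitAddCircle) = ZMod.toAddCircle i + ((((m * M : ℕ) : ℝ)⁻¹ * y : ℝ) : UnitAddCircle) :=
    fun i y => by rw [key, AddCircle.coe_add, ← ZMod.toAddCircle_apply]
  -- A left or bottom boundary point is recorded as the right or top one of the preceding square. On
  -- the circle the shift by one block compensates, including at the wrap-around.
  have key'' : ∀ i : ZMod m, ((((((i - 1).val * M : ℕ) : ℝ) + (M - 1 / 2)) / (m * M : ℕ) : ℝ) :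
      UnitAddCircle) =
      ZMod.toAddCircle i + ((((m * M : ℕ) : ℝ)⁻¹ * (-1 / 2) : ℝ) : UnitAddCircle) := by
    intro i
    rw [key', map_sub, toAddCircle_one, sub_add_eq_add_sub, sub_eq_iff_eq_add, add_assoc,
      ← AddCircle.coe_add]
    congr 2
    push_cast
    field_simp
    ring
  rcases x with ⟨_ | _ | _ | _, k⟩
  · refine Prod.ext ?_ ?_
    · refine Eq.trans ?_ (key'' s.1)
      simp [bouAt, TorusBou.scaled, cutAt, mod1, vertAt, place, gridPt, Side.dir, h1,
        sub_eq_add_neg]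
      congr 1; ring
    · refine Eq.trans ?_ (key' s.2 k)
      simp [bouAt, TorusBou.scaled, cutAt, mod1, vertAt, place, gridPt, Side.dir]
  · refine Prod.ext ?_ ?_
    · refine Eq.trans ?_ (key' s.1 (M - 1 / 2))
      simp [bouAt, TorusBou.scaled, cutAt, mod1, vertAt, place, gridPt, h1]
      congr 1; ring
    · refine Eq.trans ?_ (key' s.2 k)
      simp [bouAt, TorusBou.scaled, cutAt, mod1, vertAt, place, gridPt]
  · refine Prod.ext ?_ ?_
    · refine Eq.trans ?_ (key' s.1 k)
      simp [bouAt, TorusBou.scaled, cutAt, mod1, vertAt, place, gridPt, Side.dir]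
    · refine Eq.trans ?_ (key'' s.2)
      simp [bouAt, TorusBou.scaled, cutAt, mod1, vertAt, place, gridPt, Side.dir, h1,
        sub_eq_add_neg]
      congr 1; ring
  · refine Prod.ext ?_ ?_
    · refine Eq.trans ?_ (key' s.1 k)
      simp [bouAt, TorusBou.scaled, cutAt, mod1, vertAt, place, gridPt]
    · refine Eq.trans ?_ (key' s.2 (M - 1 / 2))
      simp [bouAt, TorusBou.scaled, cutAt, mod1, vertAt, place, gridPt, h1]
      congr 1; ring

end Rescale

/-! ### Displacement of a word compared with the drift -/

section Displacement

variable {M : ℕ}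

theorem displacement_eq (x : SqBou M) (l : List (SqBou M)) :
    displacement ℝ l = ∑ p, (usage SqBou.reflect x l p : ℝ) • p.2.1.dir ℝ := by
  induction l generalizing x with
  | nil => simp [displacement, usage]
  | cons b l ih =>
    simp only [displacement, List.map_cons, List.sum_cons] at ih ⊢
    rw [ih b.reflect]
    simp only [usage, Nat.cast_add, add_smul, Finset.sum_add_distrib, Nat.cast_ite, Nat.cast_one,
      Nat.cast_zero, ite_smul, one_smul, zero_smul, Finset.sum_ite_eq', Finset.mem_univ, if_true]

theorem norm_dir_le (d : Side) : ‖d.dir ℝ‖ ≤ 1 := by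
  cases d <;> simp [Side.dir, Prod.norm_def]

/-- Both vectors are combinations of the exit directions. The scale m/M of the rounding is chosen so
that division by m turns it into the factor 1/M of the drift, which leaves an error C/m per
transition. -/
theorem norm_displacement_sub_drift_le (hM : 0 < M) {m : ℕ} (hm : 0 < m) {C : ℕ} {Q : SqTrans M}
    (hQ : Q ∈ compatible M) {w : Word M} (hw : ∀ p, ((m : ℝ≥0) / M) * Q p ≤ w.usage p ∧
      (w.usage p : ℝ≥0) ≤ ((m : ℝ≥0) / M) * Q p + C) :
    ‖(m : ℝ)⁻¹ • displacement ℝ w.2 - Q.drift‖ ≤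
      Fintype.card (SqBou M × SqBou M) * (C * (m : ℝ)⁻¹) := by
  have hM' : (0 : ℝ) < M := by exact_mod_cast hM
  have hm' : (0 : ℝ) < m := by exact_mod_cast hm
  rw [displacement_eq w.1, drift_eq hQ, Finset.smul_sum, Finset.smul_sum, ← Finset.sum_sub_distrib]
  refine (norm_sum_le _ _).trans ((Finset.sum_le_card_nsmul _ _ (C * (m : ℝ)⁻¹) fun p _ => ?_).trans
    (by simp))
  rw [smul_smul, smul_smul, ← sub_smul, norm_smul]
  refine (mul_le_of_le_one_right (norm_nonneg _) (norm_dir_le _)).trans ?_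
  obtain ⟨h1, h2⟩ := hw p
  have h1' : (m : ℝ) / M * Q p ≤ w.usage p := by exact_mod_cast h1
  have h2' : (w.usage p : ℝ) ≤ (m : ℝ) / M * Q p + C := by exact_mod_cast h2
  change ‖(m : ℝ)⁻¹ * (w.usage p : ℝ) - (M : ℝ)⁻¹ * Q p‖ ≤ _
  have h3 : (m : ℝ)⁻¹ * (w.usage p : ℝ) - (M : ℝ)⁻¹ * Q p =
      (w.usage p - (m : ℝ) / M * Q p) * (m : ℝ)⁻¹ := by field_simp
  rw [h3, Real.norm_eq_abs, abs_of_nonneg (mul_nonneg (by linarith) (by positivity))]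
  gcongr
  linarith

end Displacement

/-! ## Quantitative weak convergence -/

section Near

variable {X : Type*} [MetricSpace X] [MeasurableSpace X]

/-- The measures give almost the same integrals to functions that vary slowly at the scale `ε`. -/
def Near (ε : ℝ) (ν ν' : Measure X) : Prop :=
  ∀ F : X → ℝ, Continuous F → ∀ r C : ℝ, (∀ x y, dist x y ≤ ε → |F x - F y| ≤ r) →
    (∀ x, |F x| ≤ C) → |∫ x, F x ∂ν - ∫ x, F x ∂ν'| ≤ r + ε * C

theorem Near.mono [Nonempty X] {ε ε' : ℝ} {ν ν' : Measure X} (h : Near ε ν ν') (hε : ε ≤ ε') : Near ε' ν ν' := by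
  intro F hF r C hr hC
  refine (h F hF r C (fun x y hxy => hr x y (hxy.trans hε)) hC).trans ?_
  have hC0 : 0 ≤ C := (abs_nonneg _).trans (hC (Classical.arbitrary X))
  gcongr

/-- On a compact space a test function is uniformly continuous, so for small ε both error terms in
`Near` are small. -/
theorem tendsto_of_eventually_near [CompactSpace X] [BorelSpace X] {ι : Type*} {l : Filter ι}
    {ν : ι → FiniteMeasure X} {ν' : FiniteMeasure X}
    (h : ∀ ε : ℝ, 0 < ε → ∀ᶠ i in l, Near ε (ν i : Measure X) ν') : Tendsto ν l (𝓝 ν') := by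
  rw [FiniteMeasure.tendsto_iff_forall_integral_tendsto]
  intro F
  rw [Metric.tendsto_nhds]
  intro δ hδ
  obtain ⟨η, hη, hF⟩ := Metric.uniformContinuous_iff.1
    (CompactSpace.uniformContinuous_of_continuous F.continuous) (δ / 3) (by positivity)
  have hK : 0 < 3 * (‖F‖ + 1) := by positivity
  set ε := min (η / 2) (δ / (3 * (‖F‖ + 1))) with hε
  have hε0 : 0 < ε := by positivity
  filter_upwards [h ε hε0] with i hi
  have h1 := hi F F.continuous (δ / 3) ‖F‖
    (fun x y hxy => (hF (hxy.trans_lt ((min_le_left _ _).trans_lt (by linarith)))).le)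
    F.norm_coe_le_norm
  have h2 : ε * ‖F‖ ≤ δ / 3 := by
    calc ε * ‖F‖ ≤ δ / (3 * (‖F‖ + 1)) * (‖F‖ + 1) := by
          gcongr
          · exact min_le_right _ _
          · linarith
      _ = δ / 3 := by field_simp
  rw [Real.dist_eq]
  linarith

end Near

/-! ## Averages over the squares -/

section Averages

instance : (volume : Measure Torus2).IsAddLeftInvariant :=
  inferInstanceAs (((volume : Measure UnitAddCircle).prod volume).IsAddLeftInvariant)

instance : (volume : Measure Torus2).IsAddRightInvariant :=
  inferInstanceAs (((volume : Measure UnitAddCircle).prod volume).IsAddRightInvariant)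

theorem integrable_of_continuous {X : Type*} [TopologicalSpace X] [CompactSpace X]
    [MeasurableSpace X] [BorelSpace X] {ν : Measure X} [IsFiniteMeasure ν] {F : X → ℝ}
    (hF : Continuous F) : Integrable F ν :=
  (BoundedContinuousFunction.mkOfCompact ⟨F, hF⟩).integrable ν

theorem abs_integral_le {X : Type*} [MeasurableSpace X] {ν : Measure X} [IsProbabilityMeasure ν]
    {f : X → ℝ} {r : ℝ} (h : ∀ᵐ x ∂ν, |f x| ≤ r) : |∫ x, f x ∂ν| ≤ r := by
  have := norm_integral_le_of_norm_le_const (μ := ν) (f := f) (C := r) h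
  rwa [probReal_univ, mul_one] at this

variable {F : Torus2 × Torus2 → ℝ}

/-- The mean value of `F` over pairs of points with a given difference. -/
noncomputable def meanAlong (F : Torus2 × Torus2 → ℝ) (v : Torus2) : ℝ := ∫ u, F (u, u + v)

variable {m M : ℕ} [NeZero m]

/-- By translation invariance `meanAlong` is also an average over u of sums over the grid of corners
translated by u. Replacing u by a corner within 1/m only permutes the grid, and then the two sums
are compared term by term. -/
theorem abs_average_sub_meanAlong_le (hF : Continuous F) {ε r : ℝ}
    (hr : ∀ x y, dist x y ≤ ε → |F x - F y| ≤ r) {o₁ o₂ v : Torus2}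
    (h₁ : (m : ℝ)⁻¹ + ‖o₁‖ ≤ ε) (h₂ : (m : ℝ)⁻¹ + ‖o₂ - v‖ ≤ ε) :
    |((m : ℝ) ^ 2)⁻¹ * ∑ s : Sq m, F (sqPt s + o₁, sqPt s + o₂) - meanAlong F v| ≤ r := by
  have hm : (m : ℝ) ≠ 0 := by exact_mod_cast NeZero.ne m
  have hcard : ((Finset.univ : Finset (Sq m)).card : ℝ) = (m : ℝ) ^ 2 := by
    simp [sq]
  have hmean : meanAlong F v =
      ∫ u : Torus2, ((m : ℝ) ^ 2)⁻¹ * ∑ s : Sq m, F (u + sqPt s, u + sqPt s + v) := by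
    rw [integral_const_mul, integral_finsetSum]
    · have : ∀ s : Sq m, ∫ u : Torus2, F (u + sqPt s, u + sqPt s + v) = meanAlong F v := fun s =>
        integral_add_right_eq_self (fun u : Torus2 => F (u, u + v)) (sqPt s)
      rw [Finset.sum_congr rfl fun s _ => this s, Finset.sum_const, nsmul_eq_mul, hcard]
      field_simp
    · exact fun s _ => integrable_of_continuous (by fun_prop)
  have hconst : ((m : ℝ) ^ 2)⁻¹ * ∑ s : Sq m, F (sqPt s + o₁, sqPt s + o₂) =
      ∫ _ : Torus2, ((m : ℝ) ^ 2)⁻¹ * ∑ s : Sq m, F (sqPt s + o₁, sqPt s + o₂) := by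
    simp
  rw [hmean, hconst, ← integral_sub (integrable_const _)
    (integrable_of_continuous (by fun_prop))]
  refine abs_integral_le (Eventually.of_forall fun u => ?_)
  obtain ⟨t, ht⟩ := exists_norm_sub_sqPt_le (m := m) u
  have hre : ∑ s : Sq m, F (sqPt s + o₁, sqPt s + o₂) =
      ∑ s : Sq m, F (sqPt (t + s) + o₁, sqPt (t + s) + o₂) :=
    (Equiv.sum_comp (Equiv.addLeft t) fun s => F (sqPt s + o₁, sqPt s + o₂)).symm
  rw [hre, ← mul_sub, ← Finset.sum_sub_distrib, abs_mul]
  have hterm : ∀ s : Sq m, |F (sqPt (t + s) + o₁, sqPt (t + s) + o₂) -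
      F (u + sqPt s, u + sqPt s + v)| ≤ r := by
    intro s
    refine hr _ _ ?_
    rw [dist_comm, Prod.dist_eq, dist_eq_norm, dist_eq_norm]
    refine max_le ?_ ?_
    · have : u + sqPt s - (sqPt (t + s) + o₁) = (u - sqPt t) - o₁ := by rw [sqPt_add]; abel
      rw [this]
      exact (norm_sub_le _ _).trans ((add_le_add_left ht _).trans h₁)
    · have : u + sqPt s + v - (sqPt (t + s) + o₂) = (u - sqPt t) - (o₂ - v) := by
        rw [sqPt_add]; abel
      rw [this]
      exact (norm_sub_le _ _).trans ((add_le_add_left ht _).trans h₂)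
  calc |((m : ℝ) ^ 2)⁻¹| * |∑ s : Sq m, (F (sqPt (t + s) + o₁, sqPt (t + s) + o₂) -
        F (u + sqPt s, u + sqPt s + v))| ≤ ((m : ℝ) ^ 2)⁻¹ * ((m : ℝ) ^ 2 * r) := by
        rw [abs_of_nonneg (by positivity)]
        gcongr
        refine (Finset.abs_sum_le_sum_abs _ _).trans
          ((Finset.sum_le_sum fun s _ => hterm s).trans ?_)
        rw [Finset.sum_const, nsmul_eq_mul, hcard]
    _ = r := by field_simp

/-- The mean value of `F` at the rescaled ends of a word that starts in a uniform square. -/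
noncomputable def wordAverage (m : ℕ) [NeZero m] (F : Torus2 × Torus2 → ℝ) (w : Word M) : ℝ :=
  ((m : ℝ) ^ 2)⁻¹ * ∑ s : Sq m, F ((wordEnds s w).1.scaled, (wordEnds s w).2.scaled)

theorem abs_wordAverage_le {C : ℝ} (hC : ∀ x, |F x| ≤ C) (w : Word M) :
    |wordAverage m F w| ≤ C := by
  have hm : (m : ℝ) ≠ 0 := by exact_mod_cast NeZero.ne m
  have hcard : ((Finset.univ : Finset (Sq m)).card : ℝ) = (m : ℝ) ^ 2 := by
    simp [sq]
  rw [wordAverage, abs_mul, abs_of_nonneg (by positivity : (0 : ℝ) ≤ ((m : ℝ) ^ 2)⁻¹)]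
  calc ((m : ℝ) ^ 2)⁻¹ * |∑ s : Sq m, F ((wordEnds s w).1.scaled, (wordEnds s w).2.scaled)| ≤
        ((m : ℝ) ^ 2)⁻¹ * ((m : ℝ) ^ 2 * C) := by
        gcongr
        refine (Finset.abs_sum_le_sum_abs _ _).trans
          ((Finset.sum_le_sum fun s _ => hC _).trans ?_)
        rw [Finset.sum_const, nsmul_eq_mul, hcard]
    _ = C := by field_simp

/-- Since the word is closed, both ends have the same offset, of norm at most 1/m, from the corners
of their squares. Offset, grid and rounding together give the 2 and the constant multiple of `C` in
`hε`. -/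
theorem abs_wordAverage_sub_meanAlong_le (hF : Continuous F) {ε r : ℝ}
    (hr : ∀ x y, dist x y ≤ ε → |F x - F y| ≤ r) {C : ℕ} {Q : SqTrans M} (hQ : Q ∈ compatible M)
    {w : Word M} (hcl : w.Closed) (hw : ∀ p, ((m : ℝ≥0) / M) * Q p ≤ w.usage p ∧
      (w.usage p : ℝ≥0) ≤ ((m : ℝ≥0) / M) * Q p + C)
    (hε : (2 + Fintype.card (SqBou M × SqBou M) * C) * (m : ℝ)⁻¹ ≤ ε) :
    |wordAverage m F w - meanAlong F (mod1 Q.drift)| ≤ r := by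
  have hM : 0 < M := w.1.2.pos
  have hm : 0 < m := Nat.pos_of_ne_zero (NeZero.ne m)
  set o := mod1 (((m * M : ℕ) : ℝ)⁻¹ • w.1.pos) with ho
  have ho' : ‖o‖ ≤ (m : ℝ)⁻¹ := norm_scaled_pos_le w.1
  have h1 : wordAverage m F w = ((m : ℝ) ^ 2)⁻¹ * ∑ s : Sq m, F (sqPt s + o,
      sqPt s + (mod1 ((m : ℝ)⁻¹ • displacement ℝ w.2) + o)) := by
    rw [wordAverage]
    congr 1
    refine Finset.sum_congr rfl fun s _ => ?_
    have : endState SqBou.reflect w.1 w.2 = w.1 := hcl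
    simp only [wordEnds, this, scaled_bouAt, sqPt_add, sqPt_displacement, ho, add_assoc]
  have hm0 : (0 : ℝ) ≤ (m : ℝ)⁻¹ := by positivity
  have hc0 : (0 : ℝ) ≤ Fintype.card (SqBou M × SqBou M) * C * (m : ℝ)⁻¹ := by positivity
  rw [h1]
  refine abs_average_sub_meanAlong_le hF hr (by linarith) ?_
  have h2 : mod1 ((m : ℝ)⁻¹ • displacement ℝ w.2) + o - mod1 Q.drift =
      mod1 ((m : ℝ)⁻¹ • displacement ℝ w.2 - Q.drift) + o := by
    rw [mod1_sub]; abel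
  rw [h2]
  have h3 := (norm_mod1_le _).trans (norm_displacement_sub_drift_le hM hm hQ hw)
  have h4 := norm_add_le (mod1 ((m : ℝ)⁻¹ • displacement ℝ w.2 - Q.drift)) o
  linarith

theorem stronglyMeasurable_meanAlong (hF : Continuous F) : StronglyMeasurable (meanAlong F) := by
  have h : Continuous fun p : Torus2 × Torus2 => F (p.2, p.2 + p.1) := by fun_prop
  exact h.stronglyMeasurable.integral_prod_right

/-- The shear (u, v) ↦ (u, u + v) preserves the uniform measure. -/
theorem integral_meanAlong (hF : Continuous F) :
    ∫ v, meanAlong F v = ∫ z, F z ∂(volume : Measure (Torus2 × Torus2)) := by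
  simp only [meanAlong]
  rw [integral_integral_swap (f := fun v u : Torus2 => F (u, u + v))
    (integrable_of_continuous (by fun_prop)), Measure.volume_eq_prod (Torus2) (Torus2),
    integral_prod _ (integrable_of_continuous hF)]
  exact integral_congr_ae (Eventually.of_forall fun u =>
    integral_add_left_eq_self (fun v : Torus2 => F (u, v)) u)

/-- Uniformity of the drift makes the end of a path independent of its start in the limit. -/
theorem IsIsotropicLaw.integral_meanAlong {Q₀ : SqTrans M} {ψ : Measure (SqTrans M)}
    (h : IsIsotropicLaw Q₀ ψ) (hF : Continuous F) :
    ∫ Q, meanAlong F (mod1 Q.drift) ∂ψ = ∫ z, F z ∂(volume : Measure (Torus2 × Torus2)) := by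
  rw [← DisorderedFlow.integral_meanAlong hF, ← h.unif, integral_map
    measurable_mod1_drift.aemeasurable (stronglyMeasurable_meanAlong hF).aestronglyMeasurable]

theorem integral_endsMeasure (lam : Measure (Word M)) [IsProbabilityMeasure lam] (hM : 0 < M) {C : ℝ}
    (hC : ∀ x, |F x| ≤ C) :
    ∫ z, F (z.1.scaled, z.2.scaled) ∂(endsMeasure m lam) =
      (m * M : ℕ) * ∫ w, wordAverage m F w ∂lam := by
  have hi : ∀ s : Sq m, Integrable (fun w : Word M =>
      F ((wordEnds s w).1.scaled, (wordEnds s w).2.scaled)) lam := fun s =>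
    Integrable.of_bound (Measurable.of_discrete.aestronglyMeasurable) C
      (Eventually.of_forall fun w => hC _)
  have hm : (m : ℝ) ≠ 0 := by exact_mod_cast NeZero.ne m
  have hfin : IsFiniteMeasure (endsMeasure m lam) := inferInstance
  simp only [wordAverage]
  rw [integral_const_mul, integral_finsetSum _ fun s _ => hi s, endsMeasure,
    integral_finsetSum_measure]
  · rw [Finset.mul_sum, Finset.mul_sum]
    refine Finset.sum_congr rfl fun s _ => ?_
    rw [integral_smul_measure, integral_map Measurable.of_discrete.aemeasurable
      Measurable.of_discrete.aestronglyMeasurable, ENNReal.toReal_div, smul_eq_mul, ← mul_assoc]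
    congr 1
    simp
    field_simp
  · intro s _
    refine Integrable.of_bound Measurable.of_discrete.aestronglyMeasurable C
      (Eventually.of_forall fun z => hC _) |>.smul_measure (natCast_div_ne_top M m)

end Averages

/-! ## Straight flows on the torus -/

section Straight

variable {m M : ℕ}

theorem usage_replicate_reflect (b : SqBou M) (k : ℕ) (p : SqBou M × SqBou M) :
    usage SqBou.reflect b (List.replicate k b.reflect) p = if p = (b, b.reflect) then k else 0 := by
  induction k with
  | zero => simp [usage]
  | succ k ih =>
    simp only [List.replicate_succ, usage, SqBou.reflect_reflect, ih]
    split_ifs <;> omega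

theorem endState_replicate_reflect (b : SqBou M) (k : ℕ) :
    endState SqBou.reflect b (List.replicate k b.reflect) = b := by
  induction k with
  | zero => rfl
  | succ k ih => simpa only [List.replicate_succ, endState, SqBou.reflect_reflect] using ih

/-- The word of a straight path that crosses `k` squares. -/
def straightWord (k : ℕ) (b : SqBou M) : Word M := (b, List.replicate k b.reflect)

/-- The law of a uniformly chosen straight path once around the torus. -/
noncomputable def straightLaw (k M : ℕ) : Measure (Word M) :=
  ∑ b : SqBou M, ((4 * M : ℕ) : ℝ≥0∞)⁻¹ • Measure.dirac (straightWord k b)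

theorem isProbabilityMeasure_straightLaw (k : ℕ) (hM : 0 < M) :
    IsProbabilityMeasure (straightLaw k M) := ⟨by
  have h4 : Fintype.card Side = 4 := rfl
  simp only [straightLaw, Measure.finsetSum_apply, Measure.smul_apply, measure_univ, smul_eq_mul,
    mul_one, Finset.sum_const, Finset.card_univ, Fintype.card_prod, Fintype.card_fin, h4,
    nsmul_eq_mul]
  exact ENNReal.mul_inv_cancel (by simpa using hM.ne') (ENNReal.natCast_ne_top _)⟩

theorem closed_straightLaw (k : ℕ) : ∀ᵐ w ∂(straightLaw k M), w.Closed := by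
  rw [ae_iff]
  simp only [straightLaw, Measure.finsetSum_apply, Measure.smul_apply, smul_eq_mul]
  refine Finset.sum_eq_zero fun b _ => ?_
  rw [Measure.dirac_apply' _ MeasurableSet.of_discrete, Set.indicator_of_notMem, mul_zero]
  exact fun h => h (endState_replicate_reflect b k)

variable [NeZero m]

/-- A given straight transition has mean use m/(4M); the factor M/m makes this 1/4, and staying with
probability 1/2 reduces it to 1/8. -/
theorem wordTrans_straightLaw (hM : 0 < M) (x₀ : SqBou M) :
    wordTrans m (lazyLaw x₀ (1 / 2) (straightLaw m M)) =
      fun p => (straightTrans M p : ℝ≥0∞) := by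
  rw [wordTrans_lazyLaw]
  funext p
  have hm : (m : ℝ≥0) ≠ 0 := by exact_mod_cast NeZero.ne m
  have hM' : (M : ℝ≥0) ≠ 0 := by exact_mod_cast hM.ne'
  have h1 : ∫⁻ w, (w.usage p : ℝ≥0∞) ∂(straightLaw m M) =
      ((if p.2 = p.1.reflect then ((4 * M : ℕ) : ℝ≥0)⁻¹ * m else 0 : ℝ≥0) : ℝ≥0∞) := by
    rw [straightLaw, lintegral_finsetSum_measure]
    have h2 : ∀ b : SqBou M, ∫⁻ w, (w.usage p : ℝ≥0∞)
        ∂(((4 * M : ℕ) : ℝ≥0∞)⁻¹ • Measure.dirac (straightWord m b)) =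
        if p.1 = b then (if p.2 = p.1.reflect then ((4 * M : ℕ) : ℝ≥0∞)⁻¹ * m else 0) else 0 := by
      intro b
      rw [lintegral_smul_measure, lintegral_dirac]
      change _ * ((usage SqBou.reflect b (List.replicate m b.reflect) p : ℕ) : ℝ≥0∞) = _
      rw [usage_replicate_reflect]
      by_cases hb : p.1 = b
      · subst hb
        simp [Prod.ext_iff]
      · simp [Prod.ext_iff, hb]
    simp only [h2, Finset.sum_ite_eq, Finset.mem_univ, if_true]
    split_ifs
    · rw [ENNReal.coe_mul, ENNReal.coe_inv (by simpa using hM.ne')]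
      simp
    · simp
  simp only [wordTrans, h1]
  have h3 : (M : ℝ≥0∞) / m = ((M / m : ℝ≥0) : ℝ≥0∞) := by
    rw [ENNReal.coe_div hm]; simp
  rw [h3, ← ENNReal.coe_mul, ← ENNReal.coe_mul, ENNReal.coe_inj, straightTrans]
  have h4 : (1 - 1 / 2 : ℝ≥0) = 1 / 2 := by
    rw [tsub_eq_iff_eq_add_of_le (by norm_num)]; norm_num
  rw [h4]
  split_ifs
  · push_cast
    field_simp
    norm_num
  · simp

/-- This serves all N, including those too small for the rounding errors to fit below `B`. With `t₀
= 1` nothing is asked of the amount of laziness. -/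
theorem exists_straight_exactFlow (hM : 0 < M) (h : M ∣ m * M) {κ : Measure ℝ≥0}
    [IsProbabilityMeasure κ] {cstar : ℝ≥0} (hκ : κ (Set.Iic cstar) = 1) {B : ℝ≥0} (hB : 1 / 4 < B) :
    ∃ θ : FiniteMeasure (TorusBou (m * M) M × TorusBou (m * M) M), HasExactFlow κ B h θ := by
  obtain ⟨g, hg, hgB, -⟩ := exists_straight_crossings M
  set x₀ : SqBou M := (.left, ⟨0, hM⟩)
  have := isProbabilityMeasure_straightLaw m hM
  have hhalf : (1 / 2 : ℝ≥0) ≤ 1 := by norm_num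
  have := isProbabilityMeasure_lazyLaw x₀ hhalf (straightLaw m M)
  obtain ⟨t, ht, -, hθ⟩ := exists_exactFlow h x₀ hκ (lazyLaw x₀ (1 / 2) (straightLaw m M))
    (closed_lazyLaw x₀ _ (closed_straightLaw m)) (cell := fun _ => ()) measurable_const
    (g := fun _ => g) (fun _ => hg) (B := B)
    (fun _ e => by
      rw [wordTrans_straightLaw hM]
      exact (hgB e).trans (ENNReal.coe_le_coe.2 hB.le))
    (isIsotropic_straightTrans hM) (fun p => by rw [wordTrans_straightLaw hM]) (t₀ := 1) (by simp)
  have := isProbabilityMeasure_lazyLaw x₀ ht (lazyLaw x₀ (1 / 2) (straightLaw m M))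
  exact ⟨⟨endsMeasure m _, inferInstance⟩, hθ _ rfl⟩

end Straight

/-! ## Nearly uniform flows on the torus -/

section NearUniform

variable {m M : ℕ}

/-- The factor M/m cancels the scale m/M of the words, the mean over `ψ` restores the isotropic
transport, and the rounding error becomes O(1/m). -/
theorem le_wordTrans_map (hM : 0 < M) (hm : 0 < m) {Q : SqTrans M} {ψ : Measure (SqTrans M)}
    (hψ : IsIsotropicLaw Q ψ) {W : SqTrans M → Word M} (hWm : Measurable W) {C : ℕ}
    (hW : ∀ Q ∈ compatible M, ∀ p, ((m : ℝ≥0) / M) * Q p ≤ (W Q).usage p ∧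
      ((W Q).usage p : ℝ≥0) ≤ ((m : ℝ≥0) / M) * Q p + C) (p : SqBou M × SqBou M) :
    Q p ≤ wordTrans m (ψ.map W) p ∧
      wordTrans m (ψ.map W) p ≤ Q p + ((M / m * C : ℝ≥0) : ℝ≥0∞) := by
  have := hψ.prob
  have hm' : (m : ℝ≥0) ≠ 0 := by exact_mod_cast hm.ne'
  have hM' : (M : ℝ≥0) ≠ 0 := by exact_mod_cast hM.ne'
  have h1 : (M : ℝ≥0∞) / m = ((M / m : ℝ≥0) : ℝ≥0∞) := by
    rw [ENNReal.coe_div hm']; simp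
  have h2 : ((M / m : ℝ≥0) : ℝ≥0∞) * ((m / M : ℝ≥0) : ℝ≥0∞) = 1 := by
    have : (M / m : ℝ≥0) * (m / M) = 1 := by field_simp
    rw [← ENNReal.coe_mul, this, ENNReal.coe_one]
  have hmq : Measurable fun Q : SqTrans M => (((m : ℝ≥0) / M : ℝ≥0) : ℝ≥0∞) * (Q p : ℝ≥0∞) :=
    (measurable_apply p).const_mul _
  have h3 : (Q p : ℝ≥0∞) = (M : ℝ≥0∞) / m *
      ∫⁻ Q, (((m : ℝ≥0) / M : ℝ≥0) : ℝ≥0∞) * (Q p : ℝ≥0∞) ∂ψ := by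
    rw [lintegral_const_mul _ (measurable_apply p), hψ.mean, h1, ← mul_assoc, h2, one_mul]
  rw [wordTrans, lintegral_map Measurable.of_discrete hWm]
  constructor
  · rw [h3]
    gcongr 1
    refine lintegral_mono_ae (hψ.compat.mono fun Q hQ => ?_)
    exact_mod_cast (hW Q hQ p).1
  · have h4 : ((M / m * C : ℝ≥0) : ℝ≥0∞) = (M : ℝ≥0∞) / m * ∫⁻ _, (C : ℝ≥0∞) ∂ψ := by
      rw [h1, lintegral_const, measure_univ, mul_one]
      simp
    rw [h3, h4, ← mul_add, ← lintegral_add_left hmq]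
    gcongr 1
    refine lintegral_mono_ae (hψ.compat.mono fun Q hQ => ?_)
    exact_mod_cast (hW Q hQ p).2

theorem crossingFlow_le_add {Q Q' : SqBou M × SqBou M → ℝ≥0∞} {y L : ℝ≥0}
    (h : ∀ p, Q' p ≤ Q p + y) {g : SqBou M × SqBou M → SqEdge M → ℝ≥0∞} (hg : ∀ p e, g p e ≤ L)
    (e : SqEdge M) : crossingFlow Q' g e ≤ crossingFlow Q g e +
      ((Fintype.card (SqBou M × SqBou M) * (y * L) : ℝ≥0) : ℝ≥0∞) := by
  calc crossingFlow Q' g e ≤ ∑ p, (Q p * g p e + y * L) := by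
        refine Finset.sum_le_sum fun p _ => ?_
        calc Q' p * g p e ≤ (Q p + y) * g p e := by have := h p; gcongr
          _ = Q p * g p e + y * g p e := add_mul _ _ _
          _ ≤ _ := by have := hg p e; gcongr
    _ = _ := by
        rw [Finset.sum_add_distrib, Finset.sum_const, Finset.card_univ, nsmul_eq_mul]
        push_cast
        rfl

/-- For c > 0 take δ = tc, since (1 - t)²(1 + t) ≤ 1. For c = 0 no laziness can help, but then the a
priori bound `Z` already vanishes. -/
theorem exists_laziness {c Z : ℝ≥0∞} (hc : c ≠ ∞) (h : c = 0 → Z = 0) {ε : ℝ≥0} (hε : 0 < ε) :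
    ∃ t δ : ℝ≥0, 2 * t ≤ ε ∧ 0 < δ ∧
      ∀ A, A ≤ c + δ → A ≤ Z → (((1 - t) ^ 2 : ℝ≥0) : ℝ≥0∞) * A ≤ c := by
  rcases eq_or_ne c 0 with h0 | h0
  · refine ⟨0, 1, by simp, one_pos, fun A _ hA => ?_⟩
    rw [h h0] at hA
    simp [le_antisymm hA zero_le]
  · lift c to ℝ≥0 using hc
    have hc0 : 0 < c := pos_iff_ne_zero.2 (by simpa using h0)
    set t := min 1 (ε / 2) with ht
    have ht0 : 0 < t := by positivity
    have ht1 : t ≤ 1 := min_le_left _ _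
    refine ⟨t, t * c, ?_, by positivity, fun A hA _ => ?_⟩
    · calc 2 * t ≤ 2 * (ε / 2) := by gcongr; exact min_le_right _ _
        _ = ε := by field_simp
    · refine (mul_le_mul_right hA _).trans ?_
      rw [← ENNReal.coe_add, ← ENNReal.coe_mul, ENNReal.coe_le_coe, ← NNReal.coe_le_coe]
      push_cast [NNReal.coe_sub ht1]
      have h1 : (0 : ℝ) ≤ t := t.2
      have h2 : (t : ℝ) ≤ 1 := by exact_mod_cast ht1
      have h3 : (0 : ℝ) ≤ c := c.2
      have h4 : (1 - (t : ℝ)) ^ 2 * (c + t * c) = c * ((1 - t) * (1 - t ^ 2)) := by ring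
      rw [h4]
      refine mul_le_of_le_one_right h3 (mul_le_one₀ (by linarith) ?_ ?_)
      · nlinarith
      · nlinarith

variable [NeZero m]

/-- The normalized integral is the mean of `wordAverage`. The lazy words change it by at most 2t
times the bound on F; the others compare with `meanAlong` at the drift, whose mean over `ψ` is the
uniform integral. -/
theorem near_endsMeasure (hM : 0 < M) {Q : SqTrans M} {ψ : Measure (SqTrans M)}
    (hψ : IsIsotropicLaw Q ψ) {W : SqTrans M → Word M} (hWm : Measurable W)
    (hWcl : ∀ Q, (W Q).Closed) {C : ℕ}
    (hW : ∀ Q ∈ compatible M, ∀ p, ((m : ℝ≥0) / M) * Q p ≤ (W Q).usage p ∧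
      ((W Q).usage p : ℝ≥0) ≤ ((m : ℝ≥0) / M) * Q p + C) (x₀ : SqBou M) {t : ℝ≥0} (ht : t ≤ 1)
    {ε : ℝ} (hε : (2 + Fintype.card (SqBou M × SqBou M) * C) * (m : ℝ)⁻¹ ≤ ε) (htε : 2 * t ≤ ε)
    (θ : FiniteMeasure (TorusBou (m * M) M × TorusBou (m * M) M))
    (hθ : (θ : Measure _) = endsMeasure m (lazyLaw x₀ t (ψ.map W))) :
    Near ε ((((m * M : ℕ) : ℝ≥0)⁻¹ • θ.map (Prod.map TorusBou.scaled TorusBou.scaled) :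
      FiniteMeasure (Torus2 × Torus2)) : Measure (Torus2 × Torus2)) uniformPair := by
  intro F hF r C₀ hr hC₀
  have := hψ.prob
  have := Measure.isProbabilityMeasure_map (μ := ψ) hWm.aemeasurable
  have := isProbabilityMeasure_lazyLaw x₀ ht (ψ.map W)
  have hN : ((m * M : ℕ) : ℝ) ≠ 0 := by
    exact_mod_cast Nat.mul_ne_zero (NeZero.ne m) hM.ne'
  have hC₀0 : 0 ≤ C₀ := (abs_nonneg _).trans (hC₀ 0)
  have e1 : ∫ x, F x ∂((((m * M : ℕ) : ℝ≥0)⁻¹ • θ.map (Prod.map TorusBou.scaled TorusBou.scaled) :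
      FiniteMeasure (Torus2 × Torus2)) : Measure (Torus2 × Torus2)) =
      ∫ w, wordAverage m F w ∂(lazyLaw x₀ t (ψ.map W)) := by
    rw [FiniteMeasure.toMeasure_smul, FiniteMeasure.toMeasure_map, hθ, integral_smul_nnreal_measure,
      integral_map Measurable.of_discrete.aemeasurable hF.aestronglyMeasurable]
    refine (congrArg _ (integral_endsMeasure (F := F) _ hM hC₀)).trans ?_
    rw [NNReal.smul_def, smul_eq_mul, ← mul_assoc]
    push_cast at hN ⊢
    rw [inv_mul_cancel₀ hN, one_mul]
  have hint : ∀ ν : Measure (Word M), IsFiniteMeasure ν → Integrable (wordAverage m F) ν :=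
    fun ν _ => Integrable.of_bound Measurable.of_discrete.aestronglyMeasurable C₀
      (Eventually.of_forall (abs_wordAverage_le hC₀))
  have e2 : ∫ w, wordAverage m F w ∂(lazyLaw x₀ t (ψ.map W)) =
      (1 - t) * ∫ Q, wordAverage m F (W Q) ∂ψ + t * wordAverage m F (Word.stay x₀) := by
    rw [lazyLaw, integral_add_measure (hint _ inferInstance) (hint _ inferInstance),
      integral_smul_nnreal_measure, integral_smul_nnreal_measure, integral_dirac,
      integral_map hWm.aemeasurable Measurable.of_discrete.aestronglyMeasurable]
    simp [NNReal.smul_def, NNReal.coe_sub ht]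
  have hwm : Measurable (wordAverage (M := M) m F) := Measurable.of_discrete
  have e3 : |∫ Q, wordAverage m F (W Q) ∂ψ - ∫ z, F z ∂(volume : Measure (Torus2 × Torus2))| ≤ r := by
    have hi1 : Integrable (fun Q => wordAverage m F (W Q)) ψ :=
      Integrable.of_bound (hwm.comp hWm).aestronglyMeasurable C₀
        (Eventually.of_forall fun Q => abs_wordAverage_le hC₀ _)
    have hi2 : Integrable (fun Q : SqTrans M => meanAlong F (mod1 Q.drift)) ψ := by
      refine Integrable.of_bound ((stronglyMeasurable_meanAlong hF).comp_measurable
        measurable_mod1_drift).aestronglyMeasurable C₀ (Eventually.of_forall fun Q => ?_)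
      exact abs_integral_le (Eventually.of_forall fun u => hC₀ _)
    rw [← hψ.integral_meanAlong hF, ← integral_sub hi1 hi2]
    refine abs_integral_le ?_
    filter_upwards [hψ.compat] with Q hQ
    exact abs_wordAverage_sub_meanAlong_le hF hr hQ (hWcl Q) (hW Q hQ) hε
  have e4 : |∫ Q, wordAverage m F (W Q) ∂ψ| ≤ C₀ :=
    abs_integral_le (Eventually.of_forall fun Q => abs_wordAverage_le hC₀ _)
  have e5 := abs_wordAverage_le (m := m) hC₀ (Word.stay x₀)
  rw [e1, e2]
  change |_ - ∫ z, F z ∂(volume : Measure (Torus2 × Torus2))| ≤ _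
  generalize ∫ Q, wordAverage m F (W Q) ∂ψ = a at *
  generalize wordAverage m F (Word.stay x₀) = b at *
  generalize ∫ z, F z ∂(volume : Measure (Torus2 × Torus2)) = i at *
  have h1 : (1 - (t : ℝ)) * a + t * b - i = (a - i) + t * (b - a) := by ring
  have h2 : |(t : ℝ) * (b - a)| ≤ t * (2 * C₀) := by
    rw [abs_mul, NNReal.abs_eq]
    gcongr
    exact (abs_sub _ _).trans (by linarith)
  rw [h1]
  calc |a - i + t * (b - a)| ≤ |a - i| + |t * (b - a)| := abs_add_le _ _
    _ ≤ r + 2 * t * C₀ := by linarith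
    _ ≤ r + ε * C₀ := by gcongr

end NearUniform

/-! ### Exact flows with uniform limit -/

section Assembly

variable {M : ℕ}

/-- The measure `θ`, normalized and rescaled to the continuous torus. -/
noncomputable def rescaled {N : ℕ} (θ : FiniteMeasure (TorusBou N M × TorusBou N M)) :
    FiniteMeasure (Torus2 × Torus2) :=
  (N : ℝ≥0)⁻¹ • θ.map (Prod.map TorusBou.scaled TorusBou.scaled)

theorem eventually_exists_exactFlow (hM : 0 < M) {κ : Measure ℝ≥0} [IsProbabilityMeasure κ]
    {cstar : ℝ≥0} (hκ : κ (Set.Iic cstar) = 1) {B : ℝ≥0} (hB : 1 / 4 < B) {ε : ℝ≥0} (hε : 0 < ε) :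
    ∃ m₀ : ℕ, ∀ (m : ℕ) (h : M ∣ m * M), m₀ ≤ m → 0 < m →
      ∃ θ : FiniteMeasure (TorusBou (m * M) M × TorusBou (m * M) M), HasExactFlow κ B h θ ∧
        Near ε (rescaled θ : Measure (Torus2 × Torus2)) uniformPair := by
  set S := ∫⁻ c, ∑ e, (c e : ℝ≥0∞) ∂(sqEnvLaw M κ) with hS
  -- If the constant vanishes then `κ` is concentrated at 0, and every cost is almost surely 0.
  have hZ : cConst M B κ = 0 → ((B ^ 2 : ℝ≥0) : ℝ≥0∞) * S = 0 := by
    intro h0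
    have h1 : ∫⁻ x, (x : ℝ≥0∞) ∂κ = 0 := by
      by_contra hne
      exact cConst_ne_zero hM hne h0
    have h2 : κ (Set.Iic 0) = 1 := by
      rw [lintegral_eq_zero_iff measurable_coe_nnreal_ennreal] at h1
      refine (prob_compl_eq_zero_iff measurableSet_Iic).1 ?_
      change ∀ᵐ x ∂κ, x ≤ 0
      filter_upwards [h1] with x hx
      simpa using hx
    have h3 := lintegral_sum_sqEnvLaw_le (M := M) h2
    rw [mul_zero, ENNReal.coe_zero] at h3
    rw [hS, le_antisymm h3 zero_le, mul_zero]
  obtain ⟨t₀, δ, ht₀, hδ, hA⟩ := exists_laziness (cConst_ne_top hM hB hκ) hZ hε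
  obtain ⟨Q, ψ, hψ, cell, hcell, g, hg, ⟨L, hL⟩, ⟨η, hη, hgη⟩, hcost⟩ :=
    exists_nearly_optimal_crossings hM hB hκ (half_pos hδ)
  obtain ⟨b, hb0, hb1, hb⟩ := exists_small ((2 * B + 1) * (Fintype.card (SqEdge M) * cstar)) (δ / 2)
    (half_pos hδ)
  obtain ⟨C, hC⟩ := exists_measurable_word hM
  set K := Fintype.card (SqBou M × SqBou M) with hK
  -- The rounding may add up to `x₁` to each volume: `b` limits the extra cost to `δ / 2`, and `η`
  -- is the room below `B`.
  set x₁ := min b η with hx₁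
  have hx₁0 : 0 < x₁ := lt_min hb0 hη
  -- `m₁` brings the added volume K (M/m) C L below `x₁`; `m₂` brings the error of the ends below
  -- `ε`.
  obtain ⟨m₁, hm₁⟩ := exists_nat_ge ((K * (M * C * L)) / x₁ : ℝ≥0)
  obtain ⟨m₂, hm₂⟩ := exists_nat_ge ((2 + K * C) / ε : ℝ≥0)
  refine ⟨max m₁ m₂, fun m h hm hm0 => ?_⟩
  have : NeZero m := ⟨hm0.ne'⟩
  have hmpos : (0 : ℝ≥0) < m := by exact_mod_cast hm0
  have hMpos : (0 : ℝ≥0) < M := by exact_mod_cast hM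
  obtain ⟨W, hWm, hWcl, hW⟩ := hC ((m : ℝ≥0) / M) (div_pos hmpos hMpos)
  set x : ℝ≥0 := K * (M / m * C * L) with hx
  have hxx : x ≤ x₁ := by
    have h1 : K * (M * C * L) / x₁ ≤ m := hm₁.trans (by exact_mod_cast (le_max_left _ _).trans hm)
    rw [div_le_iff₀ hx₁0] at h1
    have h2 : x = K * (M * C * L) / m := by rw [hx]; field_simp
    rw [h2, div_le_iff₀ hmpos, mul_comm x₁]
    exact h1
  have hεm : (2 + (K : ℝ) * C) * (m : ℝ)⁻¹ ≤ ε := by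
    have h1 : (2 + K * C) / ε ≤ m := hm₂.trans (by exact_mod_cast (le_max_right _ _).trans hm)
    rw [div_le_iff₀ hε, mul_comm (m : ℝ≥0), ← div_le_iff₀ hmpos] at h1
    rw [← div_eq_mul_inv]
    exact_mod_cast h1
  have := hψ.prob
  have := Measure.isProbabilityMeasure_map (μ := ψ) hWm.aemeasurable
  have hwt := le_wordTrans_map hM hm0 hψ hWm hW
  have hflow : ∀ k e, crossingFlow (wordTrans m (ψ.map W)) (g k) e ≤
      crossingFlow (fun p => Q p) (g k) e + x := fun k e =>
    crossingFlow_le_add (fun p => (hwt p).2) (hL k) e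
  have hQB : ∀ k e, crossingFlow (fun p => Q p) (g k) e ≤ B := fun k e =>
    le_self_add.trans (hgη k e)
  have hflowB : ∀ k e, crossingFlow (wordTrans m (ψ.map W)) (g k) e ≤ B := fun k e =>
    (hflow k e).trans (le_trans (by
      gcongr
      exact hxx.trans (min_le_right _ _)) (hgη k e))
  have hx2 : (2 * B * x + x ^ 2) * (Fintype.card (SqEdge M) * cstar) ≤ δ / 2 := by
    have h1 : x ≤ b := hxx.trans (min_le_left _ _)
    calc (2 * B * x + x ^ 2) * (Fintype.card (SqEdge M) * cstar) =
          x * ((2 * B + x) * (Fintype.card (SqEdge M) * cstar)) := by ring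
      _ ≤ b * ((2 * B + 1) * (Fintype.card (SqEdge M) * cstar)) := by
          gcongr
          exact h1.trans hb1
      _ ≤ δ / 2 := hb
  have hA1 : ∫⁻ c, cost (crossingFlow (wordTrans m (ψ.map W)) (g (cell c))) c ∂(sqEnvLaw M κ) ≤
      cConst M B κ + δ := by
    calc _ ≤ ∫⁻ c, (cost (crossingFlow (fun p => Q p) (g (cell c))) c +
          ((2 * B * x + x ^ 2 : ℝ≥0) : ℝ≥0∞) * ∑ e, (c e : ℝ≥0∞)) ∂(sqEnvLaw M κ) :=
          lintegral_mono fun c => (cost_mono (hflow _) c).trans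
            (cost_add_const_le (hQB _) x c)
      _ = ∫⁻ c, cost (crossingFlow (fun p => Q p) (g (cell c))) c ∂(sqEnvLaw M κ) +
          ((2 * B * x + x ^ 2 : ℝ≥0) : ℝ≥0∞) * S := by
          rw [lintegral_add_right _ (measurable_sum_apply.const_mul _),
            lintegral_const_mul _ measurable_sum_apply]
      _ ≤ cConst M B κ + (δ / 2 : ℝ≥0) + (δ / 2 : ℝ≥0) := by
          refine add_le_add hcost ((mul_le_mul_right (lintegral_sum_sqEnvLaw_le hκ) _).trans ?_)
          rw [← ENNReal.coe_mul]
          exact ENNReal.coe_le_coe.2 hx2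
      _ = cConst M B κ + δ := by
          rw [add_assoc, ← ENNReal.coe_add, add_halves]
  have hA2 : ∫⁻ c, cost (crossingFlow (wordTrans m (ψ.map W)) (g (cell c))) c ∂(sqEnvLaw M κ) ≤
      ((B ^ 2 : ℝ≥0) : ℝ≥0∞) * S := by
    rw [hS, ← lintegral_const_mul _ measurable_sum_apply]
    exact lintegral_mono fun c => cost_le_of_le (hflowB _) c
  set x₀ : SqBou M := (.left, ⟨0, hM⟩)
  have hcl : ∀ᵐ w ∂(ψ.map W), w.Closed :=
    (ae_map_iff hWm.aemeasurable MeasurableSet.of_discrete).2 (Eventually.of_forall hWcl)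
  obtain ⟨t, ht1, htt, hθ⟩ := exists_exactFlow h x₀ hκ (ψ.map W) hcl hcell hg hflowB
    (isIsotropic_iff.2 ⟨ψ, hψ⟩) (fun p => (hwt p).1) (hA _ hA1 hA2)
  have := isProbabilityMeasure_lazyLaw x₀ ht1 (ψ.map W)
  refine ⟨⟨endsMeasure m _, inferInstance⟩, hθ _ rfl, ?_⟩
  refine near_endsMeasure hM hψ hWm hWcl hW x₀ ht1 hεm ?_ _ rfl
  have : 2 * t ≤ ε := (mul_le_mul_right htt 2).trans ht₀
  exact_mod_cast this

/-- Transportation measures with exact flows that become uniform. -/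
theorem exists_exactFlow_tendsto (hM : 0 < M) {κ : Measure ℝ≥0} [IsProbabilityMeasure κ]
    {cstar : ℝ≥0} (hκ : κ (Set.Iic cstar) = 1) {B : ℝ≥0} (hB : 1 / 4 < B) :
    ∃ ρ : (N : ℕ) → FiniteMeasure (TorusBou N M × TorusBou N M),
      (∀ (N : ℕ) (h : M ∣ N), 0 < N → HasExactFlow κ B h (ρ N)) ∧
      Tendsto (fun N => rescaled (ρ N)) (atTop ⊓ 𝓟 {N : ℕ | M ∣ N}) (𝓝 uniformPair) := by
  classical
  -- `k` measures quality: nearness `1 / k` is required, and nothing when `k = 0`. So quality 0 is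
  -- attained by straight flows for every N, and each fixed quality is attained for large N.
  let P : (N : ℕ) → M ∣ N → ℕ → Prop := fun N h k =>
    ∃ θ : FiniteMeasure (TorusBou N M × TorusBou N M), HasExactFlow κ B h θ ∧
      (0 < k → Near (k : ℝ)⁻¹ (rescaled θ : Measure (Torus2 × Torus2)) uniformPair)
  have hP0 : ∀ (N : ℕ) (h : M ∣ N), 0 < N → P N h 0 := by
    rintro N h hN
    obtain ⟨m, rfl⟩ := exists_eq_mul_left_of_dvd h
    have : NeZero m := ⟨fun h0 => by simp [h0] at hN⟩
    obtain ⟨θ, hθ⟩ := exists_straight_exactFlow hM h hκ hB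
    exact ⟨θ, hθ, fun h0 => absurd h0 (lt_irrefl 0)⟩
  have hPk : ∀ k : ℕ, ∃ N₀ : ℕ, ∀ (N : ℕ) (h : M ∣ N), 0 < N → N₀ ≤ N → P N h k := by
    intro k
    rcases Nat.eq_zero_or_pos k with rfl | hk
    · exact ⟨0, fun N h hN _ => hP0 N h hN⟩
    obtain ⟨m₀, hm₀⟩ := eventually_exists_exactFlow hM hκ hB
      (inv_pos.2 (by exact_mod_cast hk : (0 : ℝ≥0) < k))
    refine ⟨m₀ * M, fun N h hN hN₀ => ?_⟩
    obtain ⟨m, rfl⟩ := exists_eq_mul_left_of_dvd h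
    obtain ⟨θ, hθ, hθn⟩ := hm₀ m h (Nat.le_of_mul_le_mul_right hN₀ hM)
      (Nat.pos_of_mul_pos_right hN)
    exact ⟨θ, hθ, fun _ => by simpa using hθn⟩
  -- Choose for each N a measure of the best quality not exceeding N. This diagonal choice has
  -- quality tending to infinity along the multiples of M.
  have hbest : ∀ N : ℕ, ∃ θ : FiniteMeasure (TorusBou N M × TorusBou N M),
      ∀ h : M ∣ N, 0 < N → HasExactFlow κ B h θ ∧
        (0 < Nat.findGreatest (P N h) N → Near (Nat.findGreatest (P N h) N : ℝ)⁻¹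
          (rescaled θ : Measure (Torus2 × Torus2)) uniformPair) := by
    intro N
    by_cases hN : M ∣ N ∧ 0 < N
    · obtain ⟨θ, hθ⟩ := Nat.findGreatest_spec (P := P N hN.1) (Nat.zero_le N) (hP0 N hN.1 hN.2)
      exact ⟨θ, fun _ _ => hθ⟩
    · exact ⟨0, fun h h' => absurd ⟨h, h'⟩ hN⟩
  choose ρ hρ using hbest
  refine ⟨ρ, fun N h hN => (hρ N h hN).1, tendsto_of_eventually_near fun ε hε => ?_⟩
  obtain ⟨k, hk⟩ := exists_nat_gt ε⁻¹
  have hk0 : 0 < k := by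
    have : (0 : ℝ) < k := (inv_pos.2 hε).trans hk
    exact_mod_cast this
  obtain ⟨N₀, hN₀⟩ := hPk k
  rw [eventually_inf_principal]
  filter_upwards [eventually_ge_atTop (max N₀ k)] with N hN h
  have hkN : k ≤ N := (le_max_right _ _).trans hN
  have h1 : k ≤ Nat.findGreatest (P N h) N :=
    Nat.le_findGreatest hkN (hN₀ N h (hk0.trans_le hkN) ((le_max_left _ _).trans hN))
  refine ((hρ N h (hk0.trans_le hkN)).2 (hk0.trans_le h1)).mono ?_
  refine (inv_le_comm₀ ?_ hε).2 (hk.le.trans ?_)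
  · exact_mod_cast hk0.trans_le h1
  · exact_mod_cast h1

end Assembly

end DisorderedFlow

theorem proposition5 (κ : Measure ℝ≥0) [IsProbabilityMeasure κ]
    (cstar : ℝ≥0) (hcstar : 0 < cstar) (hκ : κ (Set.Iic cstar) = 1)
    (B : ℝ≥0) (hB : 1 / 4 < B) (M : ℕ) (hM : 0 < M) :
    ∃ (μ : (N : ℕ) → Kernel (TorusEdge N → ℝ≥0) (FinPath (splitGraph N M)))
      (f : (N : ℕ) → (TorusEdge N → ℝ≥0) → TorusEdge N → ℝ≥0∞)
      (ρ : (N : ℕ) → FiniteMeasure (TorusBou N M × TorusBou N M)),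
      (∀ (N : ℕ) (hMN : M ∣ N), 0 < N →
        (∀ c, IsFiniteMeasure (μ N c) ∧ IsTorusFlow (μ N c) (f N c)) ∧
        (∀ c e, f N c e ≤ B) ∧
        ∫⁻ c, cost (f N c) c ∂(torusEnvLaw N κ) = ((N : ℝ≥0∞) / M) ^ 2 * cConst M B κ ∧
        (∀ c, tra (μ N c) = asVertexMeasure (ρ N)) ∧
        IsBalanced hMN (ρ N)) ∧
      Tendsto
        (fun N : ℕ => (N : ℝ≥0)⁻¹ • (ρ N).map (Prod.map TorusBou.scaled TorusBou.scaled))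
        (atTop ⊓ 𝓟 {N : ℕ | M ∣ N}) (𝓝 uniformPair) := by
  obtain ⟨ρ, hρ, hlim⟩ := exists_exactFlow_tendsto hM hκ hB
  have hex : ∀ N : ℕ, ∃ (μ : Kernel (TorusEdge N → ℝ≥0) (FinPath (splitGraph N M)))
      (f : (TorusEdge N → ℝ≥0) → TorusEdge N → ℝ≥0∞), M ∣ N → 0 < N →
      (∀ c, IsFiniteMeasure (μ c) ∧ IsTorusFlow (μ c) (f c)) ∧ (∀ c e, f c e ≤ B) ∧
      ∫⁻ c, cost (f c) c ∂(torusEnvLaw N κ) = ((N : ℝ≥0∞) / M) ^ 2 * cConst M B κ ∧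
      ∀ c, tra (μ c) = asVertexMeasure (ρ N) := by
    intro N
    by_cases h : M ∣ N ∧ 0 < N
    · obtain ⟨-, μ, f, h'⟩ := hρ N h.1 h.2
      exact ⟨μ, f, fun _ _ => h'⟩
    · exact ⟨0, 0, fun h₁ h₂ => absurd ⟨h₁, h₂⟩ h⟩
  choose μ f hμ using hex
  refine ⟨μ, f, ρ, fun N h hN => ?_, hlim⟩
  obtain ⟨h1, h2, h3, h4⟩ := hμ N h hN
  exact ⟨h1, h2, h3, h4, (hρ N h hN).1⟩
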